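/- \textbf{Theorem (Rakhmanov's theorem for orthogonal matrix polynomials on the unit circle).} Let $\rho$ be a positive $p\times p$ matrix measure on the unit circle, i.e. a countably additive set function on the Borel sets of $\mathbb{R}/2\pi\mathbb{Z}$ whose values are Hermitian positive semidefinite $p\times p$ matrices, and let $$d\rho(\theta)=\rho'(\theta)\,\frac{d\theta}{2\pi}+d\rho_s(\theta)$$ be its Lebesgue decomposition, with $\rho'$ integrable and $\rho_s$ singular with respect to Lebesgue measure. Suppose that $\det\rho'(\theta)>0$ for almost every $\theta\in[0,2\pi)$. Write $z=e^{i\theta}$ and let $A^*$ denote the conjugate transpose of a matrix $A$. Then there exist sequences $(\varphi_n^L)_{n\ge0}$ and $(\varphi_n^R)_{n\ge0}$ of left and right orthonormal matrix polynomials for $\rho$, i.e. polynomials $$\varphi_n^L(z)=\sum_{k=0}^n L_{n,k}z^k,\qquad \varphi_n^R(z)=\sum_{k=0}^n K_{n,k}z^k$$ with $p\times p$ matrix coefficients such that for all $m,n\ge 0$ $$\int_0^{2\pi}\varphi_n^L(z)\,d\rho(\theta)\,[\varphi_m^L(z)]^*=\delta_{m,n}I,\qquad \int_0^{2\pi}[\varphi_n^R(z)]^*\,d\rho(\theta)\,\varphi_m^R(z)=\delta_{m,n}I.$$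 For every choice of such sequences (they are unique only up to multiplication of each $\varphi_n^L$ on the left, and of each $\varphi_n^R$ on the right, by unitary matrices), the leading coefficients $L_{n,n}$ and $K_{n,n}$ are non-singular, the reflection coefficients $$H_n=(L_{n,n}^*)^{-1}K_{n,0}=L_{n,0}(K_{n,n}^*)^{-1}$$ are well defined (the two expressions agree) for every $n\ge 0$, and $$\lim_{n\to\infty}H_n=0.$$ -/

import Mathlib

open MeasureTheory Filter Topology Polynomial
open scoped ComplexOrder Matrix

noncomputable section

namespace MatrixOPUC

/-- The circle `ℝ / 2πℤ`, on which the angle `θ` lives. -/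
abbrev Torus : Type := AddCircle (2 * Real.pi)

instance factTwoPiPos : Fact ((0 : ℝ) < 2 * Real.pi) := ⟨Real.two_pi_pos⟩

/-- The normalized Lebesgue measure `dθ / 2π`. -/
abbrev leb : Measure Torus := AddCircle.haarAddCircle

/-- `p × p` complex matrices. -/
abbrev Mat (p : ℕ) : Type := Matrix (Fin p) (Fin p) ℂ

/-- Matrix-valued measures: countably additive set functions with values in `p × p` matrices. -/
abbrev MatrixMeasure (p : ℕ) : Type := VectorMeasure Torus (Mat p)

/-- The point `z = e^{iθ}` of the unit circle. -/
def zOf (θ : Torus) : ℂ := (AddCircle.toCircle θ : ℂ)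

/-- The value `P(z) = ∑ₖ zᵏ Aₖ` of a matrix polynomial at a complex number. -/
def evalMat {p : ℕ} (P : (Mat p)[X]) (z : ℂ) : Mat p :=
  P.sum fun k A => z ^ k • A

theorem continuous_entryHom {p : ℕ} (i j : Fin p) :
    Continuous (Matrix.entryAddMonoidHom ℂ i j : Mat p →+ ℂ) :=
  continuous_id.matrix_elem i j

/-- The complex measure `ρᵢⱼ`. -/
def entry {p : ℕ} (ρ : MatrixMeasure p) (i j : Fin p) : ComplexMeasure Torus :=
  ρ.mapRange (Matrix.entryAddMonoidHom ℂ i j) (continuous_entryHom i j)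

theorem entry_apply {p : ℕ} (ρ : MatrixMeasure p) (i j : Fin p) (E : Set Torus) :
    entry ρ i j E = ρ E i j := rfl

/-- The matrix `∫ F(θ) dρ(θ) G(θ)`, whose `(i, j)` entry is `∑ₖ ∑ₗ ∫ Fᵢₖ Gₗⱼ dρₖₗ`. -/
def matrixIntegral {p : ℕ} (ρ : MatrixMeasure p) (F G : Torus → Mat p) : Mat p :=
  Matrix.of fun i j => ∑ k, ∑ l,
    (entry ρ k l).integral (fun θ => F θ i k * G θ l j) (ContinuousLinearMap.mul ℝ ℂ)

/-- `⟨P, Q⟩_L = ∫ P(z) dρ(θ) Q(z)^*`. -/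
def innerL {p : ℕ} (ρ : MatrixMeasure p) (P Q : (Mat p)[X]) : Mat p :=
  matrixIntegral ρ (fun θ => evalMat P (zOf θ)) (fun θ => (evalMat Q (zOf θ))ᴴ)

/-- `⟨P, Q⟩_R = ∫ P(z)^* dρ(θ) Q(z)`. -/
def innerR {p : ℕ} (ρ : MatrixMeasure p) (P Q : (Mat p)[X]) : Mat p :=
  matrixIntegral ρ (fun θ => (evalMat P (zOf θ))ᴴ) (fun θ => evalMat Q (zOf θ))

/-- `φ` is a sequence of left orthonormal matrix polynomials for `ρ`, with `φₙ` of degree at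
most `n`. -/
structure IsLeftOrthonormal {p : ℕ} (ρ : MatrixMeasure p) (φ : ℕ → (Mat p)[X]) : Prop where
  natDegree_le : ∀ n, (φ n).natDegree ≤ n
  inner_eq : ∀ m n, innerL ρ (φ n) (φ m) = if m = n then 1 else 0

/-- `φ` is a sequence of right orthonormal matrix polynomials for `ρ`, with `φₙ` of degree at
most `n`. -/
structure IsRightOrthonormal {p : ℕ} (ρ : MatrixMeasure p) (φ : ℕ → (Mat p)[X]) : Prop where
  natDegree_le : ∀ n, (φ n).natDegree ≤ n
  inner_eq : ∀ m n, innerR ρ (φ n) (φ m) = if m = n then 1 else 0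

/-- The reflection coefficient `Hₙ = (Lₙₙ^*)⁻¹ Kₙ₀`, where `Lₙₖ` and `Kₙₖ` are the coefficients of
`zᵏ` in the `n`-th left and right orthonormal polynomial. -/
def reflectionCoeff {p : ℕ} (φL φR : ℕ → (Mat p)[X]) (n : ℕ) : Mat p :=
  (((φL n).coeff n)ᴴ)⁻¹ * (φR n).coeff 0

/-- `dρ = ρ'(θ) dθ/2π + dρₛ` with `ρ'` integrable and `ρₛ` singular with respect to Lebesgue
measure. -/
structure IsLebesgueDecomposition {p : ℕ} (ρ : MatrixMeasure p) (ρ' : Torus → Mat p)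
    (ρs : MatrixMeasure p) : Prop where
  integrable : ∀ i j, Integrable (fun θ => ρ' θ i j) leb
  singular : ρs ⟂ᵥ leb.toENNRealVectorMeasure
  eq_add : ∀ E, MeasurableSet E →
    ρ E = Matrix.of (fun i j => ∫ θ in E, ρ' θ i j ∂leb) + ρs E

end MatrixOPUC

end

/-! Write `ρ = M dμ`, where `μ` is normalized Lebesgue measure plus a finite measure carried by a
Lebesgue null set `N` (`exists_density`). With `φₙ = φₙ^L` and `ψₙ(z) = zⁿ φₙ^R(1/z̄)^*`,
orthogonality alone gives the Szegő recursion `zφₙ = Uφₙ₊₁ + Aψₙ`, `ψₙ = Zψₙ₊₁ + A^* zφₙ`, where `A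
= Aₙ = ∫ zφₙ dρ ψₙ^*`, `UU^* = 1 - AA^*` and `ZZ^* = 1 - A^*A`. At `z = 0` it yields `U Hₙ₊₁ = -AZ`,
so it suffices that `Aₙ → 0` (`IsSzegoPair.tendsto_reflection`).

On the circle `φₙ^*φₙ = ψₙ^*ψₙ`, and `ψₙ` is invertible on the closed disc. Hence `V = zφₙψₙ⁻¹` is
unitary on the circle and has Lebesgue mean `0`. With `F = ψₙMψₙ^*` this gives `Aₙ = ∫_N VF dμ + ∫
V(F - 1) dθ/2π`, so one needs `F → 1` in mean off `N` and `∫_N tr F dμ → 0`. Since `∫ tr F dμ = p`,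
the arithmetic-geometric mean inequality applied to the eigenvalues of `F` reduces both to `∫ (det
F)^(1/2p) dθ/2π → 1` (`IsDensity.norm_reflection_le`).

That limit comes from a variational argument with the functional `E(S) = 3p ∫ (det M |det
S|²)^(1/3p) dθ/2π - tr ∫ S dρ S^*`. If `S` is a polynomial of degree at most `n`, the last integral
is unchanged when `dρ` is replaced by the Bernstein–Szegő measure `(ψₙ^*ψₙ)⁻¹ dθ/2π`
(`IsSzegoPair.weightForm_eq`), and a pointwise mean inequality gives `E(S) ≤ 2p ∫ (det F)^(1/2p)
dθ/2π` (`IsDensity.integral_entropy_le`). On the other hand, `S = M^(-1/2)` off `N` and `S = 0` on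
`N` formally give `E(S) = 3p - p = 2p`, and approximation makes polynomials come arbitrarily close
(`IsDensity.exists_polynomial_entropy`). Here `det ρ' > 0` almost everywhere is essential. -/

noncomputable section

namespace MatrixOPUC

variable {p : ℕ}

/-! ### Evaluation of matrix polynomials at scalars. -/

theorem evalMat_eq_eval (P : (Mat p)[X]) (z : ℂ) :
    evalMat P z = P.eval (algebraMap ℂ (Mat p) z) := by
  rw [evalMat, Polynomial.eval_eq_sum]
  refine Finset.sum_congr rfl fun k _ => ?_
  beta_reduce
  rw [← map_pow, ← Algebra.commutes, Algebra.smul_def]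

@[simp] theorem evalMat_zero (z : ℂ) : evalMat (0 : (Mat p)[X]) z = 0 := by
  simp [evalMat_eq_eval]

@[simp] theorem evalMat_add (P Q : (Mat p)[X]) (z : ℂ) :
    evalMat (P + Q) z = evalMat P z + evalMat Q z := by
  simp [evalMat_eq_eval]

@[simp] theorem evalMat_C (A : Mat p) (z : ℂ) : evalMat (C A) z = A := by
  simp [evalMat_eq_eval]

@[simp] theorem evalMat_C_mul (A : Mat p) (P : (Mat p)[X]) (z : ℂ) :
    evalMat (C A * P) z = A * evalMat P z := by
  simp [evalMat_eq_eval]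

@[simp] theorem evalMat_X_mul (P : (Mat p)[X]) (z : ℂ) :
    evalMat (X * P) z = z • evalMat P z := by
  rw [evalMat_eq_eval, evalMat_eq_eval, X_mul, eval_mul_X, ← Algebra.commutes, Algebra.smul_def]

@[simp] theorem evalMat_X_pow_mul (n : ℕ) (P : (Mat p)[X]) (z : ℂ) :
    evalMat (X ^ n * P) z = z ^ n • evalMat P z := by
  induction n with
  | zero => simp
  | succ n ih => rw [pow_succ', mul_assoc, evalMat_X_mul, ih, smul_smul, pow_succ']

@[simp] theorem evalMat_one (z : ℂ) : evalMat (1 : (Mat p)[X]) z = 1 := by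
  simp [evalMat_eq_eval]

@[simp] theorem evalMat_X_pow (n : ℕ) (z : ℂ) :
    evalMat (X ^ n : (Mat p)[X]) z = z ^ n • (1 : Mat p) := by
  simpa using evalMat_X_pow_mul n (1 : (Mat p)[X]) z

theorem evalMat_sum {ι : Type*} (s : Finset ι) (P : ι → (Mat p)[X]) (z : ℂ) :
    evalMat (∑ i ∈ s, P i) z = ∑ i ∈ s, evalMat (P i) z := by
  simp [evalMat_eq_eval, eval_finsetSum]

theorem evalMat_eq_sum_range {P : (Mat p)[X]} {n : ℕ} (h : P.natDegree ≤ n) (z : ℂ) :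
    evalMat P z = ∑ k ∈ Finset.range (n + 1), z ^ k • P.coeff k := by
  rw [evalMat]
  exact P.sum_over_range' (by simp) (n + 1) (by omega)

@[simp] theorem evalMat_at_zero (P : (Mat p)[X]) : evalMat P 0 = P.coeff 0 := by
  rw [evalMat_eq_eval, map_zero, coeff_zero_eq_eval_zero]

/-! ### Matrix-valued Toeplitz forms on polynomials. -/

/-- A left-linear functional vanishing on a sequence of polynomials with invertible leading
coefficients vanishes on their span. -/
theorem functional_eq_zero_of_degree_lt {ℓ : (Mat p)[X] → Mat p}
    (hadd : ∀ P Q, ℓ (P + Q) = ℓ P + ℓ Q) (hC : ∀ A P, ℓ (C A * P) = A * ℓ P)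
    {φ : ℕ → (Mat p)[X]} {n : ℕ} (hdeg : ∀ k < n, (φ k).natDegree ≤ k)
    (hunit : ∀ k < n, IsUnit ((φ k).coeff k)) (hφ : ∀ k < n, ℓ (φ k) = 0)
    {P : (Mat p)[X]} (hP : P.degree < n) : ℓ P = 0 := by
  induction n generalizing P with
  | zero =>
    have : P = 0 := by simpa using hP
    subst this
    simpa using hC 0 0
  | succ n ih =>
    obtain ⟨u, hu⟩ := hunit n (by omega)
    set D : Mat p := P.coeff n * ↑u⁻¹
    have hlt : (P - C D * φ n).degree < n := by
      rw [degree_lt_iff_coeff_zero] at hP ⊢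
      intro m hm
      rcases hm.eq_or_lt with rfl | hm
      · simp [D, mul_assoc, ← hu]
      · rw [coeff_sub, coeff_C_mul, hP m (by omega),
          coeff_eq_zero_of_natDegree_lt ((hdeg n (by omega)).trans_lt hm), mul_zero, sub_zero]
    have h := ih (fun k hk => hdeg k (by omega)) (fun k hk => hunit k (by omega))
      (fun k hk => hφ k (by omega)) hlt
    have h2 := hadd (P - C D * φ n) (C D * φ n)
    rwa [sub_add_cancel, h, hC, hφ n (by omega), mul_zero, add_zero] at h2

/-- `B` is left-linear over matrices, Hermitian, and invariant under multiplication by `z`. -/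
structure IsToeplitzForm (B : (Mat p)[X] → (Mat p)[X] → Mat p) : Prop where
  add_left : ∀ P Q R, B (P + Q) R = B P R + B Q R
  C_mul_left : ∀ A P R, B (C A * P) R = A * B P R
  conj_symm : ∀ P Q, (B P Q)ᴴ = B Q P
  X_mul : ∀ P Q, B (X * P) (X * Q) = B P Q

namespace IsToeplitzForm

variable {B : (Mat p)[X] → (Mat p)[X] → Mat p} (hB : IsToeplitzForm B)
include hB

theorem add_right (P Q R : (Mat p)[X]) : B P (Q + R) = B P Q + B P R := by
  rw [← hB.conj_symm, hB.add_left, Matrix.conjTranspose_add, hB.conj_symm, hB.conj_symm]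

theorem C_mul_right (A : Mat p) (P Q : (Mat p)[X]) : B P (C A * Q) = B P Q * Aᴴ := by
  rw [← hB.conj_symm, hB.C_mul_left, Matrix.conjTranspose_mul, hB.conj_symm]

theorem zero_left (P : (Mat p)[X]) : B 0 P = 0 := by
  simpa using hB.C_mul_left 0 0 P

theorem zero_right (P : (Mat p)[X]) : B P 0 = 0 := by
  rw [← hB.conj_symm, hB.zero_left, Matrix.conjTranspose_zero]

theorem sum_right {ι : Type*} (s : Finset ι) (P : (Mat p)[X]) (Q : ι → (Mat p)[X]) :
    B P (∑ i ∈ s, Q i) = ∑ i ∈ s, B P (Q i) := by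
  classical
  induction s using Finset.induction_on with
  | empty => simp [hB.zero_right]
  | insert a s ha ih => rw [Finset.sum_insert ha, Finset.sum_insert ha, hB.add_right, ih]

theorem sub_left (P Q R : (Mat p)[X]) : B (P - Q) R = B P R - B Q R := by
  rw [eq_sub_iff_add_eq, ← hB.add_left, sub_add_cancel]

theorem eq_zero_symm {P Q : (Mat p)[X]} (h : B P Q = 0) : B Q P = 0 := by
  rw [← hB.conj_symm, h, Matrix.conjTranspose_zero]

theorem eq_zero_of_degree_lt {φ P : (Mat p)[X]} {n : ℕ} (h : ∀ j < n, B φ (X ^ j) = 0)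
    (hP : P.degree < n) : B φ P = 0 := by
  rcases eq_or_ne P 0 with rfl | h0
  · exact hB.zero_right φ
  rw [P.as_sum_range_C_mul_X_pow' ((natDegree_lt_iff_degree_lt h0).2 hP), hB.sum_right]
  refine Finset.sum_eq_zero fun j hj => ?_
  rw [hB.C_mul_right, h j (Finset.mem_range.1 hj), zero_mul]

end IsToeplitzForm

theorem eq_lead_add {P : (Mat p)[X]} {n : ℕ} (h : P.natDegree ≤ n) :
    ∃ R : (Mat p)[X], R.degree < n ∧ P = C (P.coeff n) * X ^ n + R := by
  refine ⟨P - C (P.coeff n) * X ^ n, ?_, by abel⟩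
  rw [degree_lt_iff_coeff_zero]
  intro m hm
  rcases hm.eq_or_lt with rfl | hm
  · simp
  · rw [coeff_sub, coeff_C_mul_X_pow, if_neg (by omega),
      coeff_eq_zero_of_natDegree_lt (h.trans_lt hm), sub_zero]

theorem eq_const_add {P : (Mat p)[X]} {n : ℕ} (h : P.natDegree ≤ n) :
    ∃ R : (Mat p)[X], R.degree < n ∧ P = C (P.coeff 0) * 1 + X * R := by
  refine ⟨P.divX, ?_, ?_⟩
  · rw [degree_lt_iff_coeff_zero]
    intro m hm
    rw [coeff_divX]
    exact coeff_eq_zero_of_natDegree_lt (by omega)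
  · rw [mul_one, X_mul, add_comm, divX_mul_X_add]

/-! ### Szegő pairs and their recursion. -/

/-- `φₙ` is orthonormal to the lower degrees, and `ψₙ` is orthonormal to the polynomials of degree
at most `n` that vanish at `0`. -/
structure IsSzegoPair (B : (Mat p)[X] → (Mat p)[X] → Mat p) (φ ψ : ℕ → (Mat p)[X]) : Prop where
  left_deg : ∀ n, (φ n).natDegree ≤ n
  right_deg : ∀ n, (ψ n).natDegree ≤ n
  left_orth : ∀ n, ∀ j < n, B (φ n) (X ^ j) = 0
  right_orth : ∀ n, ∀ j < n, B (ψ n) (X * X ^ j) = 0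
  left_norm : ∀ n, B (φ n) (φ n) = 1
  right_norm : ∀ n, B (ψ n) (ψ n) = 1

namespace IsToeplitzForm

variable {B : (Mat p)[X] → (Mat p)[X] → Mat p} (hB : IsToeplitzForm B)
include hB

theorem left_apply {φ P : (Mat p)[X]} {n : ℕ} (h : ∀ j < n, B φ (X ^ j) = 0)
    (hP : P.natDegree ≤ n) : B φ P = B φ (X ^ n) * (P.coeff n)ᴴ := by
  obtain ⟨R, hR, hPR⟩ := eq_lead_add hP
  conv_lhs => rw [hPR]
  rw [hB.add_right, hB.C_mul_right, hB.eq_zero_of_degree_lt h hR, add_zero]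

theorem right_apply_X_mul {ψ R : (Mat p)[X]} {n : ℕ} (h : ∀ j < n, B ψ (X * X ^ j) = 0)
    (hR : R.degree < n) : B ψ (X * R) = 0 := by
  rcases eq_or_ne R 0 with rfl | h0
  · rw [mul_zero, hB.zero_right]
  rw [R.as_sum_range_C_mul_X_pow' ((natDegree_lt_iff_degree_lt h0).2 hR), Finset.mul_sum,
    hB.sum_right]
  refine Finset.sum_eq_zero fun j hj => ?_
  rw [← mul_assoc, X_mul_C, mul_assoc, hB.C_mul_right, h j (Finset.mem_range.1 hj), zero_mul]

theorem right_apply {ψ P : (Mat p)[X]} {n : ℕ} (h : ∀ j < n, B ψ (X * X ^ j) = 0)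
    (hP : P.natDegree ≤ n) : B ψ P = B ψ 1 * (P.coeff 0)ᴴ := by
  obtain ⟨R, hR, hPR⟩ := eq_const_add hP
  conv_lhs => rw [hPR]
  rw [hB.add_right, hB.C_mul_right, hB.right_apply_X_mul h hR, add_zero]

/-- Only the leading term of `φ` contributes to `B φ φ`, so the normalization exhibits a one-sided
inverse of the leading coefficient, which suffices for square matrices. -/
theorem isUnit_lead {φ : (Mat p)[X]} {n : ℕ} (h : ∀ j < n, B φ (X ^ j) = 0)
    (hdeg : φ.natDegree ≤ n) (hnorm : B φ φ = 1) : IsUnit (φ.coeff n) := by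
  rw [hB.left_apply h hdeg] at hnorm
  exact (Matrix.isUnit_conjTranspose _).1 (IsUnit.of_mul_eq_one_right _ hnorm)

theorem isUnit_coeff_zero {ψ : (Mat p)[X]} {n : ℕ} (h : ∀ j < n, B ψ (X * X ^ j) = 0)
    (hdeg : ψ.natDegree ≤ n) (hnorm : B ψ ψ = 1) : IsUnit (ψ.coeff 0) := by
  rw [hB.right_apply h hdeg] at hnorm
  exact (Matrix.isUnit_conjTranspose _).1 (IsUnit.of_mul_eq_one_right _ hnorm)

end IsToeplitzForm

theorem degree_lt_succ_of_natDegree_le {P : (Mat p)[X]} {n : ℕ} (h : P.natDegree ≤ n) :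
    P.degree < (n + 1 : ℕ) := by
  rw [degree_lt_iff_coeff_zero]
  intro m hm
  exact coeff_eq_zero_of_natDegree_lt (by omega)

theorem natDegree_le_of_degree_lt_succ {P : (Mat p)[X]} {n : ℕ} (h : P.degree < (n + 1 : ℕ)) :
    P.natDegree ≤ n := by
  rw [degree_lt_iff_coeff_zero] at h
  exact natDegree_le_iff_coeff_eq_zero.2 fun m hm => h m (by omega)

theorem natDegree_C_mul_le_of_le {P : (Mat p)[X]} {n : ℕ} (A : Mat p) (h : P.natDegree ≤ n) :
    (C A * P).natDegree ≤ n :=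
  (natDegree_C_mul_le A P).trans h

/-- The recursion coefficients of a Szegő pair. -/
structure IsRecursion (φ ψ : ℕ → (Mat p)[X]) (n : ℕ) (U A Z : Mat p) : Prop where
  isUnit_left : IsUnit U
  isUnit_right : IsUnit Z
  left : X * φ n = C U * φ (n + 1) + C A * ψ n
  right : ψ n = C Z * ψ (n + 1) + C Aᴴ * (X * φ n)
  left_defect : U * Uᴴ = 1 - A * Aᴴ
  right_defect : Z * Zᴴ = 1 - Aᴴ * A

namespace IsSzegoPair

variable {B : (Mat p)[X] → (Mat p)[X] → Mat p} {φ ψ : ℕ → (Mat p)[X]}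

theorem isUnit_left (hS : IsSzegoPair B φ ψ) (hB : IsToeplitzForm B) (n : ℕ) :
    IsUnit ((φ n).coeff n) :=
  hB.isUnit_lead (hS.left_orth n) (hS.left_deg n) (hS.left_norm n)

theorem isUnit_right (hS : IsSzegoPair B φ ψ) (hB : IsToeplitzForm B) (n : ℕ) :
    IsUnit ((ψ n).coeff 0) :=
  hB.isUnit_coeff_zero (hS.right_orth n) (hS.right_deg n) (hS.right_norm n)

/-- Subtracting a left multiple of `φ (n + 1)` from `X * φ n` removes the top coefficient, and a
left multiple of `ψ n` then removes the constant one. The remainder has the form `X * R` with `R` of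
degree below `n` and is orthogonal to itself, hence zero. -/
theorem exists_left_recursion (hS : IsSzegoPair B φ ψ) (hB : IsToeplitzForm B)
    (hdef : ∀ P, B P P = 0 → P = 0) (n : ℕ) :
    ∃ U, IsUnit U ∧ X * φ n = C U * φ (n + 1) + C (B (X * φ n) (ψ n)) * ψ n := by
  obtain ⟨u, hu⟩ := hS.isUnit_left hB n
  obtain ⟨v, hv⟩ := hS.isUnit_left hB (n + 1)
  obtain ⟨w, hw⟩ := hS.isUnit_right hB n
  have key : ∃ A : Mat p, X * φ n = C (↑u * ↑v⁻¹ : Mat p) * φ (n + 1) + C A * ψ n := by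
    set q := X * φ n - C (↑u * ↑v⁻¹ : Mat p) * φ (n + 1) with hq
    have hqd : q.natDegree ≤ n := by
      refine natDegree_le_iff_coeff_eq_zero.2 fun m hm => ?_
      obtain ⟨m, rfl⟩ : ∃ k, m = k + 1 := ⟨m - 1, by omega⟩
      rw [hq, coeff_sub, coeff_X_mul, coeff_C_mul]
      rcases (show n ≤ m by omega).eq_or_lt with rfl | hlt
      · rw [← hu, ← hv, mul_assoc, Units.inv_mul, mul_one, sub_self]
      · rw [coeff_eq_zero_of_natDegree_lt ((hS.left_deg n).trans_lt hlt),
          coeff_eq_zero_of_natDegree_lt ((hS.left_deg (n + 1)).trans_lt (by omega)), mul_zero,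
          sub_zero]
    set A : Mat p := q.coeff 0 * ↑w⁻¹
    refine ⟨A, ?_⟩
    have hrd : (q - C A * ψ n).natDegree ≤ n :=
      (natDegree_sub_le _ _).trans (max_le hqd (natDegree_C_mul_le_of_le A (hS.right_deg n)))
    obtain ⟨R, hR, hrR⟩ := eq_const_add hrd
    have h0 : (q - C A * ψ n).coeff 0 = 0 := by
      rw [coeff_sub, coeff_C_mul, ← hw, mul_assoc, Units.inv_mul, mul_one, sub_self]
    rw [h0, map_zero, zero_mul, zero_add] at hrR
    have hXR : (X * R : (Mat p)[X]).degree < ((n + 1 : ℕ) : WithBot ℕ) := by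
      rw [← hrR]; exact degree_lt_succ_of_natDegree_le hrd
    have hz : B (q - C A * ψ n) (X * R) = 0 := by
      rw [hB.sub_left, hq, hB.sub_left, hB.X_mul, hB.C_mul_left, hB.C_mul_left,
        hB.eq_zero_of_degree_lt (hS.left_orth n) hR,
        hB.eq_zero_of_degree_lt (hS.left_orth (n + 1)) hXR,
        hB.right_apply_X_mul (hS.right_orth n) hR, mul_zero, mul_zero, sub_zero, sub_zero]
    have := hdef (q - C A * ψ n) (by conv_lhs => arg 2; rw [hrR]
                                     exact hz)
    rw [sub_eq_zero, hq, sub_eq_iff_eq_add'] at this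
    exact this
  obtain ⟨A, hA⟩ := key
  refine ⟨↑u * ↑v⁻¹, ⟨u * v⁻¹, Units.val_mul _ _⟩, ?_⟩
  have : B (X * φ n) (ψ n) = A := by
    rw [hA, hB.add_left, hB.C_mul_left, hB.C_mul_left, hS.right_norm, mul_one,
      hB.eq_zero_of_degree_lt (hS.left_orth (n + 1))
        (degree_lt_succ_of_natDegree_le (hS.right_deg n)), mul_zero, zero_add]
  rwa [this]

/-- Cancelling the constant term of `ψ n` against `ψ (n + 1)` leaves `X * R`. Toeplitz invariance
makes `R`, of degree at most `n`, orthogonal to all lower powers, so `R` is a left multiple of `φ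
n`; pairing with `φ n` identifies the factor. -/
theorem exists_right_recursion (hS : IsSzegoPair B φ ψ) (hB : IsToeplitzForm B)
    (hdef : ∀ P, B P P = 0 → P = 0) (n : ℕ) :
    ∃ Z, IsUnit Z ∧ ψ n = C Z * ψ (n + 1) + C (B (X * φ n) (ψ n))ᴴ * (X * φ n) := by
  obtain ⟨u, hu⟩ := hS.isUnit_left hB n
  obtain ⟨v, hv⟩ := hS.isUnit_right hB (n + 1)
  obtain ⟨w, hw⟩ := hS.isUnit_right hB n
  set Z : Mat p := ↑w * ↑v⁻¹ with hZ
  have hsd : (ψ n - C Z * ψ (n + 1)).natDegree ≤ n + 1 :=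
    (natDegree_sub_le _ _).trans (max_le ((hS.right_deg n).trans (by omega))
      (natDegree_C_mul_le_of_le Z (hS.right_deg (n + 1))))
  obtain ⟨R, hR, hsR⟩ := eq_const_add hsd
  have h0 : (ψ n - C Z * ψ (n + 1)).coeff 0 = 0 := by
    rw [coeff_sub, coeff_C_mul, ← hw, ← hv, hZ, mul_assoc, Units.inv_mul, mul_one, sub_self]
  rw [h0, map_zero, zero_mul, zero_add] at hsR
  have hRorth : ∀ j < n, B R (X ^ j) = 0 := by
    intro j hj
    rw [← hB.X_mul, ← hsR, hB.sub_left, hB.C_mul_left, hS.right_orth n j hj,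
      hS.right_orth (n + 1) j (by omega), mul_zero, sub_zero]
  set D : Mat p := R.coeff n * ↑u⁻¹ with hD
  have hR' : (R - C D * φ n).degree < n := by
    rw [degree_lt_iff_coeff_zero] at hR ⊢
    intro m hm
    rcases hm.eq_or_lt with rfl | hm
    · rw [coeff_sub, coeff_C_mul, ← hu, hD, mul_assoc, Units.inv_mul, mul_one, sub_self]
    · rw [coeff_sub, coeff_C_mul, hR m hm,
        coeff_eq_zero_of_natDegree_lt ((hS.left_deg n).trans_lt hm), mul_zero, sub_zero]
  have hRD : R = C D * φ n := by
    refine sub_eq_zero.1 (hdef _ ?_)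
    rw [hB.sub_left, hB.C_mul_left, hB.eq_zero_of_degree_lt hRorth hR',
      hB.eq_zero_of_degree_lt (hS.left_orth n) hR', mul_zero, sub_zero]
  have hDA : D = (B (X * φ n) (ψ n))ᴴ := by
    calc D = B R (φ n) := by rw [hRD, hB.C_mul_left, hS.left_norm, mul_one]
      _ = B (ψ n) (X * φ n) := by
        rw [← hB.X_mul, ← hsR, hB.sub_left, hB.C_mul_left,
          hB.right_apply_X_mul (hS.right_orth (n + 1))
            (degree_lt_succ_of_natDegree_le (hS.left_deg n)), mul_zero, sub_zero]
      _ = _ := by rw [hB.conj_symm]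
  refine ⟨Z, ⟨w * v⁻¹, by simp [hZ]⟩, ?_⟩
  rw [← hDA, ← mul_assoc, ← X_mul_C, mul_assoc, ← hRD, ← hsR]
  abel

/-- The defect relations are Pythagoras' theorem: in each recursion the two terms on the right are
mutually orthogonal and the left side has norm one. -/
theorem exists_recursion (hS : IsSzegoPair B φ ψ) (hB : IsToeplitzForm B)
    (hdef : ∀ P, B P P = 0 → P = 0) (n : ℕ) :
    ∃ U Z, IsRecursion φ ψ n U (B (X * φ n) (ψ n)) Z := by
  obtain ⟨U, hU, hl⟩ := hS.exists_left_recursion hB hdef n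
  obtain ⟨Z, hZ, hr⟩ := hS.exists_right_recursion hB hdef n
  set A := B (X * φ n) (ψ n)
  refine ⟨U, Z, hU, hZ, hl, hr, ?_, ?_⟩
  · have h1 : B (X * φ n) (X * φ n) = 1 := by rw [hB.X_mul, hS.left_norm]
    have h2 : B (φ (n + 1)) (ψ n) = 0 := hB.eq_zero_of_degree_lt (hS.left_orth (n + 1))
      (degree_lt_succ_of_natDegree_le (hS.right_deg n))
    rw [hl] at h1
    simp only [hB.add_left, hB.add_right, hB.C_mul_left, hB.C_mul_right, hS.left_norm,
      hS.right_norm, h2, hB.eq_zero_symm h2, mul_zero, zero_mul, add_zero, zero_add, one_mul] at h1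
    rw [← h1]; abel
  · have h1 : B (ψ n) (ψ n) = 1 := hS.right_norm n
    have h2 : B (ψ (n + 1)) (X * φ n) = 0 := hB.right_apply_X_mul (hS.right_orth (n + 1))
      (degree_lt_succ_of_natDegree_le (hS.left_deg n))
    rw [hr] at h1
    simp only [hB.add_left, hB.add_right, hB.C_mul_left, hB.C_mul_right, hS.left_norm,
      hS.right_norm, h2, hB.eq_zero_symm h2, mul_zero, zero_mul, add_zero, zero_add, one_mul,
      hB.X_mul, Matrix.conjTranspose_conjTranspose] at h1
    rw [← h1]; abel

/-- Both sides compute `B (φ n) (ψ n)`: the left one by the orthogonality of `φ n`, the right one by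
that of `ψ n`. This is the agreement of the two expressions for the reflection coefficient. -/
theorem conjTranspose_inv_mul (hS : IsSzegoPair B φ ψ) (hB : IsToeplitzForm B) (n : ℕ) :
    (((φ n).coeff n)ᴴ)⁻¹ * ((ψ n).coeff n)ᴴ = (φ n).coeff 0 * ((ψ n).coeff 0)⁻¹ := by
  have h1 : (((φ n).coeff n)ᴴ)⁻¹ = B (φ n) (X ^ n) := by
    have h := hS.left_norm n
    rw [hB.left_apply (hS.left_orth n) (hS.left_deg n)] at h
    exact Matrix.inv_eq_left_inv h
  have h2 : ((ψ n).coeff 0)⁻¹ = (B (ψ n) 1)ᴴ := by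
    have h := hS.right_norm n
    rw [hB.right_apply (hS.right_orth n) (hS.right_deg n)] at h
    refine Matrix.inv_eq_right_inv ?_
    rw [← Matrix.conjTranspose_conjTranspose ((ψ n).coeff 0), ← Matrix.conjTranspose_mul, h,
      Matrix.conjTranspose_one]
  rw [h1, h2, ← hB.left_apply (hS.left_orth n) (hS.right_deg n), ← hB.conj_symm,
    hB.right_apply (hS.right_orth n) (hS.left_deg n), Matrix.conjTranspose_mul,
    Matrix.conjTranspose_conjTranspose]

end IsSzegoPair

/-! ### From the recursion coefficients to the reflection coefficients. -/

theorem norm_sq_le_mul_conjTranspose_self (U : Mat p) (i j : Fin p) :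
    ‖U i j‖ ^ 2 ≤ ((U * Uᴴ) i i).re := by
  have h : ((U * Uᴴ) i i).re = ∑ k, ‖U i k‖ ^ 2 := by
    simp only [Matrix.mul_apply, Matrix.conjTranspose_apply, Complex.re_sum]
    refine Finset.sum_congr rfl fun k _ => ?_
    rw [← starRingEnd_apply, Complex.mul_conj, Complex.ofReal_re, Complex.normSq_eq_norm_sq]
  rw [h]
  exact Finset.single_le_sum (f := fun k => ‖U i k‖ ^ 2) (fun k _ => by positivity)
    (Finset.mem_univ j)

theorem norm_apply_le_one_of_mul_conjTranspose {U A : Mat p} (h : U * Uᴴ = 1 - A * Aᴴ)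
    (i j : Fin p) : ‖U i j‖ ≤ 1 := by
  have h1 := norm_sq_le_mul_conjTranspose_self U i j
  have h2 := norm_sq_le_mul_conjTranspose_self A i j
  rw [h, Matrix.sub_apply, Matrix.one_apply_eq, Complex.sub_re, Complex.one_re] at h1
  have : ‖U i j‖ ^ 2 ≤ 1 := by nlinarith [sq_nonneg ‖A i j‖]
  exact (sq_le_one_iff₀ (norm_nonneg _)).1 this

/-- The defect relation gives `U⁻¹ = Uᴴ (1 - A Aᴴ)⁻¹`, hence `H = -Uᴴ W Z` with `W → 0`, while the
entries of `U` and `Z` are bounded by one. No separate bound on `U⁻¹` is needed. -/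
theorem tendsto_zero_of_defect {U Z A H : ℕ → Mat p} (hA : Tendsto A atTop (𝓝 0))
    (hU : ∀ n, U n * (U n)ᴴ = 1 - A n * (A n)ᴴ) (hZ : ∀ n, Z n * (Z n)ᴴ = 1 - (A n)ᴴ * A n)
    (hunit : ∀ n, IsUnit (U n)) (hH : ∀ n, U n * H n = -(A n * Z n)) :
    Tendsto H atTop (𝓝 0) := by
  set W : ℕ → Mat p := fun n => (1 - A n * (A n)ᴴ)⁻¹ * A n
  have hW : Tendsto W atTop (𝓝 0) := by
    have h1 : Tendsto (fun n => 1 - A n * (A n)ᴴ) atTop (𝓝 1) := by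
      have : Continuous fun M : Mat p => 1 - M * Mᴴ := by fun_prop
      simpa [Function.comp_def] using (this.tendsto 0).comp hA
    have h2 : Tendsto (fun n => (1 - A n * (A n)ᴴ)⁻¹) atTop (𝓝 (1⁻¹)) := by
      have : ContinuousAt (fun M : Mat p => M⁻¹) 1 := by
        simp only [Matrix.inv_def, Ring.inverse_eq_inv']
        exact ContinuousAt.smul (ContinuousAt.inv₀
          (Continuous.matrix_det continuous_id).continuousAt (by simp))
          (Continuous.matrix_adjugate continuous_id).continuousAt
      exact this.tendsto.comp h1
    simpa using h2.mul hA
  have hHW : ∀ n, H n = -((U n)ᴴ * W n * Z n) := by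
    intro n
    have hdet := (Matrix.isUnit_iff_isUnit_det _).1 (hunit n)
    have e1 : (U n)⁻¹ = (U n)ᴴ * (1 - A n * (A n)ᴴ)⁻¹ := by
      rw [← hU, Matrix.mul_inv_rev, ← mul_assoc, Matrix.mul_nonsing_inv, one_mul]
      exact (Matrix.isUnit_iff_isUnit_det _).1 ((Matrix.isUnit_conjTranspose _).2 (hunit n))
    calc H n = (U n)⁻¹ * (U n * H n) := by
          rw [← mul_assoc, Matrix.nonsing_inv_mul _ hdet, one_mul]
      _ = _ := by rw [hH, e1]; simp only [W, mul_neg, mul_assoc]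
  refine tendsto_pi_nhds.2 fun i => tendsto_pi_nhds.2 fun j => ?_
  have hb : Tendsto (fun n => ∑ k, ∑ l, ‖W n l k‖) atTop (𝓝 0) := by
    have : Continuous fun M : Mat p => ∑ k, ∑ l, ‖M l k‖ := by fun_prop
    simpa [Function.comp_def] using (this.tendsto 0).comp hW
  refine squeeze_zero_norm (fun n => ?_) hb
  rw [hHW, Matrix.neg_apply, norm_neg, Matrix.mul_apply]
  refine (norm_sum_le _ _).trans (Finset.sum_le_sum fun k _ => ?_)
  rw [norm_mul, Matrix.mul_apply]
  refine (mul_le_of_le_one_right (norm_nonneg _)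
    (norm_apply_le_one_of_mul_conjTranspose (A := (A n)ᴴ) (by simpa using hZ n) k j)).trans ?_
  refine (norm_sum_le _ _).trans (Finset.sum_le_sum fun l _ => ?_)
  rw [norm_mul, Matrix.conjTranspose_apply, norm_star]
  exact mul_le_of_le_one_left (norm_nonneg _)
    (norm_apply_le_one_of_mul_conjTranspose (hU n) l i)

namespace IsRecursion

variable {φ ψ : ℕ → (Mat p)[X]} {n : ℕ} {U A Z : Mat p}

theorem left_eval (h : IsRecursion φ ψ n U A Z) (z : ℂ) :
    z • evalMat (φ n) z = U * evalMat (φ (n + 1)) z + A * evalMat (ψ n) z := by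
  simpa using congrArg (evalMat · z) h.left

theorem right_eval (h : IsRecursion φ ψ n U A Z) (z : ℂ) :
    evalMat (ψ n) z = Z * evalMat (ψ (n + 1)) z + Aᴴ * (z • evalMat (φ n) z) := by
  have := congrArg (evalMat · z) h.right
  simpa only [evalMat_add, evalMat_C_mul, evalMat_X_mul] using this

theorem reflection_eq (h : IsRecursion φ ψ n U A Z) (hψ : IsUnit ((ψ (n + 1)).coeff 0)) :
    U * ((φ (n + 1)).coeff 0 * ((ψ (n + 1)).coeff 0)⁻¹) = -(A * Z) := by
  have h1 := h.left_eval 0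
  have h2 := h.right_eval 0
  simp only [zero_smul, mul_zero, add_zero, evalMat_at_zero] at h1 h2
  have h3 : U * (φ (n + 1)).coeff 0 = -(A * (Z * (ψ (n + 1)).coeff 0)) := by
    rw [← h2]; exact eq_neg_of_add_eq_zero_left h1.symm
  rw [← mul_assoc, h3, neg_mul, ← mul_assoc, mul_assoc,
    Matrix.mul_nonsing_inv _ ((Matrix.isUnit_iff_isUnit_det _).1 hψ), mul_one]

end IsRecursion

theorem IsSzegoPair.tendsto_reflection {B : (Mat p)[X] → (Mat p)[X] → Mat p}
    {φ ψ : ℕ → (Mat p)[X]} (hS : IsSzegoPair B φ ψ) (hB : IsToeplitzForm B)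
    (hdef : ∀ P, B P P = 0 → P = 0)
    (hA : Tendsto (fun n => B (X * φ n) (ψ n)) atTop (𝓝 0)) :
    Tendsto (fun n => (φ n).coeff 0 * ((ψ n).coeff 0)⁻¹) atTop (𝓝 0) := by
  -- The recursion at level `n` controls the reflection coefficient at level `n + 1`.
  rw [← tendsto_add_atTop_iff_nat 1]
  choose U Z h using hS.exists_recursion hB hdef
  exact tendsto_zero_of_defect hA (fun n => (h n).left_defect) (fun n => (h n).right_defect)
    (fun n => (h n).isUnit_left) fun n => (h n).reflection_eq (hS.isUnit_right hB (n + 1))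

/-! ### Invertibility of the pair inside, outside and on the unit circle. -/

/-- The matrix form of the identity `|g'|² - |f'|² = |g|² - |a|²` for a Szegő step. -/
theorem szego_step_identity {U A Z g a f' g' : Mat p} (hU : IsUnit U) (hZ : IsUnit Z)
    (hUA : U * Uᴴ = 1 - A * Aᴴ) (hZA : Z * Zᴴ = 1 - Aᴴ * A) (hf : a = U * f' + A * g)
    (hg : g = Z * g' + Aᴴ * a) : g'ᴴ * g' - f'ᴴ * f' = gᴴ * g - aᴴ * a := by
  have hUd := (Matrix.isUnit_iff_isUnit_det _).1 hU
  have hZd := (Matrix.isUnit_iff_isUnit_det _).1 hZ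
  have hf' : f' = U⁻¹ * (a - A * g) := by
    rw [hf, add_sub_cancel_right, ← mul_assoc, Matrix.nonsing_inv_mul _ hUd, one_mul]
  have hg' : g' = Z⁻¹ * (g - Aᴴ * a) := by
    have : g - Aᴴ * a = Z * g' := by rw [sub_eq_iff_eq_add]; exact hg
    rw [this, ← mul_assoc, Matrix.nonsing_inv_mul _ hZd, one_mul]
  set R : Mat p := (1 - A * Aᴴ)⁻¹ with hR
  have hRu : IsUnit (1 - A * Aᴴ).det := by
    rw [← hUA, Matrix.det_mul]
    exact hUd.mul ((Matrix.isUnit_iff_isUnit_det _).1 ((Matrix.isUnit_conjTranspose _).2 hU))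
  have hR1 : R * (1 - A * Aᴴ) = 1 := Matrix.nonsing_inv_mul _ hRu
  have hUR : (U⁻¹)ᴴ * U⁻¹ = R := by
    rw [Matrix.conjTranspose_nonsing_inv, ← Matrix.mul_inv_rev, hUA]
  -- The inverse of `1 - Aᴴ * A` is expressed through the inverse `R` of `1 - A * Aᴴ`, so that both
  -- quadratic forms involve the same `R`.
  have hZT : (Z⁻¹)ᴴ * Z⁻¹ = 1 + Aᴴ * R * A := by
    rw [Matrix.conjTranspose_nonsing_inv, ← Matrix.mul_inv_rev, hZA]
    refine Matrix.inv_eq_left_inv ?_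
    have : R * A * Aᴴ * A = R * A - A := by
      calc R * A * Aᴴ * A = R * A - R * (1 - A * Aᴴ) * A := by noncomm_ring
        _ = R * A - A := by rw [hR1, one_mul]
    calc (1 + Aᴴ * R * A) * (1 - Aᴴ * A)
        = 1 - Aᴴ * A + Aᴴ * (R * A) - Aᴴ * (R * A * Aᴴ * A) := by noncomm_ring
      _ = 1 := by rw [this]; noncomm_ring
  have hRA : A * Aᴴ * R = R - 1 := by
    have : (1 - A * Aᴴ) * R = 1 := Matrix.mul_nonsing_inv _ hRu
    rw [← this]; noncomm_ring
  have hRA' : R * A * Aᴴ = R - 1 := by rw [← hR1]; noncomm_ring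
  have e1 : g'ᴴ * g' = (g - Aᴴ * a)ᴴ * ((Z⁻¹)ᴴ * Z⁻¹) * (g - Aᴴ * a) := by
    rw [hg', Matrix.conjTranspose_mul]; noncomm_ring
  have e2 : f'ᴴ * f' = (a - A * g)ᴴ * ((U⁻¹)ᴴ * U⁻¹) * (a - A * g) := by
    rw [hf', Matrix.conjTranspose_mul]; noncomm_ring
  rw [e1, e2, hUR, hZT]
  simp only [Matrix.conjTranspose_sub, Matrix.conjTranspose_mul,
    Matrix.conjTranspose_conjTranspose]
  have x1 : A * (1 + Aᴴ * R * A) = R * A := by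
    rw [mul_add, mul_one, show A * (Aᴴ * R * A) = (A * Aᴴ * R) * A by noncomm_ring, hRA]
    noncomm_ring
  have x2 : (1 + Aᴴ * R * A) * Aᴴ = Aᴴ * R := by
    rw [add_mul, one_mul, show Aᴴ * R * A * Aᴴ = Aᴴ * (R * A * Aᴴ) by noncomm_ring, hRA']
    noncomm_ring
  calc (gᴴ - aᴴ * A) * (1 + Aᴴ * R * A) * (g - Aᴴ * a)
        - (aᴴ - gᴴ * Aᴴ) * R * (a - A * g)
      = gᴴ * (1 + Aᴴ * R * A) * g - gᴴ * ((1 + Aᴴ * R * A) * Aᴴ) * a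
        - aᴴ * (A * (1 + Aᴴ * R * A)) * g + aᴴ * (A * (1 + Aᴴ * R * A)) * Aᴴ * a
        - (aᴴ - gᴴ * Aᴴ) * R * (a - A * g) := by noncomm_ring
    _ = gᴴ * g - aᴴ * R * a + aᴴ * (R * A * Aᴴ) * a := by rw [x1, x2]; noncomm_ring
    _ = gᴴ * g - aᴴ * a := by rw [hRA']; noncomm_ring

theorem isUnit_of_mulVec_eq_zero {M : Mat p} (h : ∀ v : Fin p → ℂ, M *ᵥ v = 0 → v = 0) :
    IsUnit M := by
  rw [Matrix.isUnit_iff_isUnit_det, isUnit_iff_ne_zero]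
  intro h0
  obtain ⟨v, hv, hMv⟩ := Matrix.exists_mulVec_eq_zero_iff.2 h0
  exact hv (h v hMv)

theorem mulVec_eq_zero_of_isUnit {M : Mat p} (hM : IsUnit M) {v : Fin p → ℂ}
    (h : M *ᵥ v = 0) : v = 0 := by
  have := congrArg (M⁻¹ *ᵥ ·) h
  simpa [Matrix.mulVec_mulVec,
    Matrix.nonsing_inv_mul _ ((Matrix.isUnit_iff_isUnit_det _).1 hM)] using this

theorem mulVec_eq_zero_of_posSemidef_sub {f g : Mat p} (h : (gᴴ * g - fᴴ * f).PosSemidef)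
    {v : Fin p → ℂ} (hv : g *ᵥ v = 0) : f *ᵥ v = 0 := by
  have h1 := h.dotProduct_mulVec_nonneg v
  rw [Matrix.sub_mulVec, ← Matrix.mulVec_mulVec, hv, Matrix.mulVec_zero, zero_sub,
    dotProduct_neg, ← Matrix.mulVec_mulVec, Matrix.dotProduct_mulVec, ← Matrix.star_mulVec] at h1
  have h2 : star (f *ᵥ v) ⬝ᵥ (f *ᵥ v) = 0 :=
    le_antisymm (neg_nonneg.1 h1) (dotProduct_star_self_nonneg _)
  exact dotProduct_star_self_eq_zero.1 h2

theorem smul_conjTranspose_mul_smul (z : ℂ) (f : Mat p) :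
    (z • f)ᴴ * (z • f) = ((‖z‖ ^ 2 : ℝ) : ℂ) • (fᴴ * f) := by
  rw [Matrix.conjTranspose_smul, smul_mul_smul_comm, ← starRingEnd_apply, mul_comm,
    Complex.mul_conj, Complex.normSq_eq_norm_sq]

namespace IsSzegoPair

variable {B : (Mat p)[X] → (Mat p)[X] → Mat p} {φ ψ : ℕ → (Mat p)[X]}

/-- Each of the two polynomials is a constant `c` with `c * B 1 1 * cᴴ = 1`, so in both cases `cᴴ *
c` is the inverse of `B 1 1`. -/
theorem conjTranspose_mul_self_zero (hS : IsSzegoPair B φ ψ) (hB : IsToeplitzForm B) (z : ℂ) :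
    (evalMat (φ 0) z)ᴴ * evalMat (φ 0) z = (evalMat (ψ 0) z)ᴴ * evalMat (ψ 0) z := by
  have key : ∀ {P : (Mat p)[X]}, P.natDegree ≤ 0 → B P P = 1 →
      (evalMat P z)ᴴ * evalMat P z = (B 1 1)⁻¹ := by
    intro P hP h
    have hPC : P = C (P.coeff 0) * 1 := by rw [mul_one]; exact eq_C_of_natDegree_le_zero hP
    have he : evalMat P z = P.coeff 0 := by rw [hPC]; simp
    rw [hPC, hB.C_mul_left, hB.C_mul_right] at h
    rw [he]
    symm
    refine Matrix.inv_eq_left_inv ?_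
    rw [mul_assoc]
    exact mul_eq_one_comm.1 (by rw [mul_assoc]; exact h)
  rw [key (hS.left_deg 0) (hS.left_norm 0), key (hS.right_deg 0) (hS.right_norm 0)]

variable (hS : IsSzegoPair B φ ψ) (hB : IsToeplitzForm B) (hdef : ∀ P, B P P = 0 → P = 0)
include hS hB hdef

theorem eval_step (n : ℕ) (z : ℂ) :
    (evalMat (ψ (n + 1)) z)ᴴ * evalMat (ψ (n + 1)) z
      - (evalMat (φ (n + 1)) z)ᴴ * evalMat (φ (n + 1)) z
      = (evalMat (ψ n) z)ᴴ * evalMat (ψ n) z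
        - ((‖z‖ ^ 2 : ℝ) : ℂ) • ((evalMat (φ n) z)ᴴ * evalMat (φ n) z) := by
  obtain ⟨U, Z, h⟩ := hS.exists_recursion hB hdef n
  rw [szego_step_identity h.isUnit_left h.isUnit_right h.left_defect h.right_defect
    (h.left_eval z) (h.right_eval z), smul_conjTranspose_mul_smul]

/-- Each step adds `(1 - ‖z‖²) φₙᴴ φₙ` to the difference `ψₙᴴ ψₙ - φₙᴴ φₙ`, which therefore stays
positive semidefinite. Consequently a null vector of `ψₙ₊₁(z)` is one of `φₙ₊₁(z)`, and the
recursion carries it down to a null vector of `ψₙ(z)`. -/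
theorem isUnit_right_eval (n : ℕ) {z : ℂ} (hz : ‖z‖ ≤ 1) :
    IsUnit (evalMat (ψ n) z) ∧ ((evalMat (ψ n) z)ᴴ * evalMat (ψ n) z
      - (evalMat (φ n) z)ᴴ * evalMat (φ n) z).PosSemidef := by
  induction n with
  | zero =>
    refine ⟨?_, ?_⟩
    · rw [eq_C_of_natDegree_le_zero (hS.right_deg 0), evalMat_C]
      exact hS.isUnit_right hB 0
    · rw [hS.conjTranspose_mul_self_zero hB, sub_self]
      exact Matrix.PosSemidef.zero
  | succ n ih =>
    have hD : ((evalMat (ψ (n + 1)) z)ᴴ * evalMat (ψ (n + 1)) z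
        - (evalMat (φ (n + 1)) z)ᴴ * evalMat (φ (n + 1)) z).PosSemidef := by
      rw [hS.eval_step hB hdef]
      have h1 : (0 : ℂ) ≤ ((1 - ‖z‖ ^ 2 : ℝ) : ℂ) := by
        rw [Complex.zero_le_real]
        nlinarith [norm_nonneg z]
      have h2 := ih.2.add
        ((Matrix.posSemidef_conjTranspose_mul_self (evalMat (φ n) z)).smul h1)
      convert h2 using 1
      push_cast
      rw [sub_smul, one_smul]
      abel
    refine ⟨isUnit_of_mulVec_eq_zero fun v hv => ?_, hD⟩
    obtain ⟨U, Z, h⟩ := hS.exists_recursion hB hdef n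
    have hf := mulVec_eq_zero_of_posSemidef_sub hD hv
    have e1 := congrArg (· *ᵥ v) (h.left_eval z)
    have e2 := congrArg (· *ᵥ v) (h.right_eval z)
    simp only [Matrix.add_mulVec, ← Matrix.mulVec_mulVec, hf, hv, Matrix.mulVec_zero,
      zero_add] at e1 e2
    rw [e1] at e2
    -- On `v` the two recursions collapse to `ψₙ v = Aᴴ A ψₙ v`, and `1 - Aᴴ * A` is the invertible
    -- matrix `Z * Zᴴ`.
    have e3 : (Z * Zᴴ) *ᵥ (evalMat (ψ n) z *ᵥ v) = 0 := by
      rw [h.right_defect, Matrix.sub_mulVec, Matrix.one_mulVec, ← Matrix.mulVec_mulVec, ← e2,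
        sub_self]
    exact mulVec_eq_zero_of_isUnit ih.1 (mulVec_eq_zero_of_isUnit
      (h.isUnit_right.mul ((Matrix.isUnit_conjTranspose _).2 h.isUnit_right)) e3)

theorem isUnit_left_eval (n : ℕ) {z : ℂ} (hz : 1 ≤ ‖z‖) :
    IsUnit (evalMat (φ n) z) ∧ ((evalMat (φ n) z)ᴴ * evalMat (φ n) z
      - (evalMat (ψ n) z)ᴴ * evalMat (ψ n) z).PosSemidef := by
  induction n with
  | zero =>
    refine ⟨?_, ?_⟩
    · rw [eq_C_of_natDegree_le_zero (hS.left_deg 0), evalMat_C]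
      exact hS.isUnit_left hB 0
    · rw [hS.conjTranspose_mul_self_zero hB, sub_self]
      exact Matrix.PosSemidef.zero
  | succ n ih =>
    have hD : ((evalMat (φ (n + 1)) z)ᴴ * evalMat (φ (n + 1)) z
        - (evalMat (ψ (n + 1)) z)ᴴ * evalMat (ψ (n + 1)) z).PosSemidef := by
      rw [← neg_sub, hS.eval_step hB hdef]
      have h1 : (0 : ℂ) ≤ ((‖z‖ ^ 2 - 1 : ℝ) : ℂ) := by
        rw [Complex.zero_le_real]
        nlinarith [norm_nonneg z]
      have h2 := ih.2.add
        ((Matrix.posSemidef_conjTranspose_mul_self (evalMat (φ n) z)).smul h1)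
      convert h2 using 1
      push_cast
      rw [sub_smul, one_smul]
      abel
    refine ⟨isUnit_of_mulVec_eq_zero fun v hv => ?_, hD⟩
    obtain ⟨U, Z, h⟩ := hS.exists_recursion hB hdef n
    have hf := mulVec_eq_zero_of_posSemidef_sub hD hv
    have e1 := congrArg (· *ᵥ v) (h.left_eval z)
    have e2 := congrArg (· *ᵥ v) (h.right_eval z)
    simp only [Matrix.add_mulVec, ← Matrix.mulVec_mulVec, hf, hv, Matrix.mulVec_zero,
      zero_add] at e1 e2
    rw [e2] at e1
    have e3 : (U * Uᴴ) *ᵥ ((z • evalMat (φ n) z) *ᵥ v) = 0 := by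
      rw [h.left_defect, Matrix.sub_mulVec, Matrix.one_mulVec, ← Matrix.mulVec_mulVec, ← e1,
        sub_self]
    have e4 := mulVec_eq_zero_of_isUnit
      (h.isUnit_left.mul ((Matrix.isUnit_conjTranspose _).2 h.isUnit_left)) e3
    rw [Matrix.smul_mulVec, smul_eq_zero_iff_right
      (by rintro rfl; simp at hz; linarith)] at e4
    exact mulVec_eq_zero_of_isUnit ih.1 e4

theorem conjTranspose_mul_self_eq (n : ℕ) {z : ℂ} (hz : ‖z‖ = 1) :
    (evalMat (φ n) z)ᴴ * evalMat (φ n) z = (evalMat (ψ n) z)ᴴ * evalMat (ψ n) z := by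
  induction n with
  | zero => exact hS.conjTranspose_mul_self_zero hB z
  | succ n ih =>
    have := hS.eval_step hB hdef n z
    rw [hz, ih] at this
    simp only [one_pow, Complex.ofReal_one, one_smul, sub_self] at this
    exact (sub_eq_zero.1 this).symm

end IsSzegoPair

/-! ### Orthonormal sequences and Gram–Schmidt. -/

/-- A sequence of polynomials orthonormal with respect to a Toeplitz form. -/
structure IsOrthonormalSeq (B : (Mat p)[X] → (Mat p)[X] → Mat p) (φ : ℕ → (Mat p)[X]) :
    Prop where
  natDegree_le : ∀ n, (φ n).natDegree ≤ n
  inner_eq : ∀ m n, B (φ n) (φ m) = if m = n then 1 else 0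

namespace IsOrthonormalSeq

variable {B : (Mat p)[X] → (Mat p)[X] → Mat p} {φ : ℕ → (Mat p)[X]}

theorem orth (h : IsOrthonormalSeq B φ) (hB : IsToeplitzForm B) (n : ℕ) :
    ∀ j < n, B (φ n) (X ^ j) = 0 := by
  induction n using Nat.strong_induction_on with
  | _ n ih =>
    intro j hj
    refine hB.eq_zero_symm (functional_eq_zero_of_degree_lt (ℓ := fun P => B P (φ n)) (n := n)
      (φ := φ) (fun P Q => hB.add_left P Q _) (fun A P => hB.C_mul_left A P _)
      (fun k _ => h.natDegree_le k) (fun k hk => ?_) (fun k hk => ?_) ?_)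
    · exact hB.isUnit_lead (ih k hk) (h.natDegree_le k) (by simpa using h.inner_eq k k)
    · have := h.inner_eq n k
      rwa [if_neg (by omega)] at this
    · exact (degree_X_pow_le j).trans_lt (by exact_mod_cast hj)

end IsOrthonormalSeq

theorem exists_mul_mul_conjTranspose_eq_one {G : Mat p} (hG : G.PosDef) :
    ∃ D : Mat p, D * G * Dᴴ = 1 := by
  obtain ⟨S, hS, hGS⟩ : ∃ S : Mat p, IsUnit S ∧ G = Sᴴ * S := by
    open scoped MatrixOrder Matrix.Norms.L2Operator in
    exact CStarAlgebra.isStrictlyPositive_iff_eq_star_mul_self.1 hG.isStrictlyPositive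
  have hd := (Matrix.isUnit_iff_isUnit_det _).1 hS
  have hd' := (Matrix.isUnit_iff_isUnit_det _).1 ((Matrix.isUnit_conjTranspose _).2 hS)
  refine ⟨(Sᴴ)⁻¹, ?_⟩
  rw [hGS, ← mul_assoc, Matrix.nonsing_inv_mul _ hd', one_mul,
    Matrix.conjTranspose_nonsing_inv, Matrix.conjTranspose_conjTranspose,
    Matrix.mul_nonsing_inv _ hd]

theorem IsToeplitzForm.exists_orthonormal {B : (Mat p)[X] → (Mat p)[X] → Mat p}
    (hB : IsToeplitzForm B) (hpos : ∀ P, (B P P).PosSemidef) (hdef : ∀ P, B P P = 0 → P = 0) :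
    ∃ φ, IsOrthonormalSeq B φ := by
  have key : ∀ n : ℕ, ∃ q : (Mat p)[X], q.natDegree ≤ n ∧ (∀ j < n, B q (X ^ j) = 0) ∧
      B q q = 1 := by
    intro n
    induction n using Nat.strong_induction_on with
    | _ n ih =>
      choose! φ hdeg horth hnorm using ih
      set q : (Mat p)[X] := X ^ n - ∑ k ∈ Finset.range n, C (B (X ^ n) (φ k)) * φ k with hq
      have hsum : (∑ k ∈ Finset.range n, C (B (X ^ n) (φ k)) * φ k).degree < n := by
        rw [degree_lt_iff_coeff_zero]
        intro m hm
        rw [finsetSum_coeff]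
        refine Finset.sum_eq_zero fun k hk => ?_
        have hk := Finset.mem_range.1 hk
        exact coeff_eq_zero_of_natDegree_lt
          ((natDegree_C_mul_le_of_le _ (hdeg k hk)).trans_lt (by omega))
      have hlead : q.coeff n = 1 := by
        rw [hq, coeff_sub, coeff_X_pow_self, coeff_eq_zero_of_degree_lt hsum, sub_zero]
      have hqdeg : q.natDegree ≤ n := by
        refine natDegree_le_of_degree_lt_succ ((degree_sub_le _ _).trans_lt (max_lt ?_ ?_))
        · exact (degree_X_pow_le n).trans_lt (by exact_mod_cast n.lt_succ_self)
        · exact hsum.trans (by exact_mod_cast n.lt_succ_self)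
      have hlt : ∀ k l, k < n → l < n → k < l → B (φ k) (φ l) = 0 := fun k l hk hl hkl =>
        hB.eq_zero_symm (hB.eq_zero_of_degree_lt (horth l hl)
          (degree_le_natDegree.trans_lt (by exact_mod_cast (hdeg k hk).trans_lt hkl)))
      have hqφ : ∀ l < n, B q (φ l) = 0 := by
        intro l hl
        rw [hq, hB.sub_left, sub_eq_zero, ← hB.conj_symm (φ l) (∑ k ∈ _, _), hB.sum_right,
          Matrix.conjTranspose_sum, Finset.sum_eq_single l]
        · rw [hB.conj_symm, hB.C_mul_left, hnorm l hl, mul_one]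
        · intro k hk hkl
          have hk := Finset.mem_range.1 hk
          rw [hB.conj_symm, hB.C_mul_left]
          rcases lt_or_gt_of_ne hkl with h | h
          · rw [hlt k l hk hl h, mul_zero]
          · rw [hB.eq_zero_symm (hlt l k hl hk h), mul_zero]
        · intro h
          exact absurd (Finset.mem_range.2 hl) h
      have hqorth : ∀ j < n, B q (X ^ j) = 0 := by
        intro j hj
        refine hB.eq_zero_symm (functional_eq_zero_of_degree_lt (ℓ := fun P => B P q) (n := n)
          (φ := φ) (fun P Q => hB.add_left P Q _) (fun A P => hB.C_mul_left A P _)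
          hdeg (fun k hk => hB.isUnit_lead (horth k hk) (hdeg k hk) (hnorm k hk))
          (fun k hk => hB.eq_zero_symm (hqφ k hk)) ?_)
        exact (degree_X_pow_le j).trans_lt (by exact_mod_cast hj)
      have hG : (B q q).PosDef := by
        refine Matrix.PosDef.of_dotProduct_mulVec_pos (hpos q).1 fun v hv => ?_
        refine lt_of_le_of_ne ((hpos q).dotProduct_mulVec_nonneg v) fun h0 => hv ?_
        have h1 : B q q *ᵥ v = 0 :=
          ((hpos q).dotProduct_mulVec_zero_iff v).1 h0.symm
        -- Every row of `D` is the conjugate of the null vector `v`, so `C D * q` has norm zero.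
        -- Definiteness makes it vanish, and since `q` is monic so does `D`.
        set D : Mat p := Matrix.of fun _ j => star (v j) with hD
        have h2 : B (C D * q) (C D * q) = 0 := by
          rw [hB.C_mul_left, hB.C_mul_right]
          have : B q q * Dᴴ = 0 := by
            ext i j
            have := congrFun h1 i
            simpa [Matrix.mul_apply, Matrix.mulVec, dotProduct, hD] using this
          rw [this, mul_zero]
        have h3 := congrArg (fun P => coeff P n) (hdef _ h2)
        simp only [coeff_C_mul, hlead, mul_one, coeff_zero] at h3
        ext i
        simpa [hD] using congrFun (congrFun h3 i) i
      obtain ⟨D, hD⟩ := exists_mul_mul_conjTranspose_eq_one hG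
      refine ⟨C D * q, natDegree_C_mul_le_of_le D hqdeg, fun j hj => ?_, ?_⟩
      · rw [hB.C_mul_left, hqorth j hj, mul_zero]
      · rw [hB.C_mul_left, hB.C_mul_right, ← mul_assoc, hD]
  choose φ hdeg horth hnorm using key
  have hlt : ∀ k l, k < l → B (φ l) (φ k) = 0 := fun k l hkl =>
    hB.eq_zero_of_degree_lt (horth l)
      (degree_le_natDegree.trans_lt (by exact_mod_cast (hdeg k).trans_lt hkl))
  refine ⟨φ, hdeg, fun m n => ?_⟩
  rcases lt_trichotomy m n with h | rfl | h
  · rw [if_neg h.ne, hlt m n h]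
  · rw [if_pos rfl, hnorm]
  · rw [if_neg h.ne', hB.eq_zero_symm (hlt n m h)]

/-! ### Matrix functions on the circle and the forms defined by weights. -/

@[simp] theorem norm_zOf (θ : Torus) : ‖zOf θ‖ = 1 := Circle.norm_coe _

theorem zOf_ne_zero (θ : Torus) : zOf θ ≠ 0 := Circle.coe_ne_zero _

@[simp] theorem star_zOf_mul (θ : Torus) : star (zOf θ) * zOf θ = 1 := by
  rw [← starRingEnd_apply, mul_comm, Complex.mul_conj, Complex.normSq_eq_norm_sq, norm_zOf]
  simp

@[fun_prop] theorem continuous_zOf : Continuous zOf :=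
  continuous_subtype_val.comp AddCircle.continuous_toCircle

theorem continuous_evalMat (P : (Mat p)[X]) : Continuous (evalMat P) := by
  have : evalMat P = fun z => ∑ k ∈ Finset.range (P.natDegree + 1), z ^ k • P.coeff k :=
    funext fun z => evalMat_eq_sum_range le_rfl z
  rw [this]
  fun_prop

theorem continuous_evalMat_zOf (P : (Mat p)[X]) : Continuous fun θ => evalMat P (zOf θ) :=
  (continuous_evalMat P).comp continuous_zOf

/-- Entrywise integrability of a matrix-valued function. -/
def MatIntegrable (μ : Measure Torus) (F : Torus → Mat p) : Prop :=
  ∀ i j, Integrable (fun θ => F θ i j) μ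

/-- The entrywise integral of a matrix-valued function. -/
def matInt (μ : Measure Torus) (F : Torus → Mat p) : Mat p :=
  Matrix.of fun i j => ∫ θ, F θ i j ∂μ

section

variable {μ : Measure Torus} {F G : Torus → Mat p}

theorem exists_bound_of_continuous {f : Torus → Mat p} (hf : Continuous f) (i j : Fin p) :
    ∃ c, ∀ θ, ‖f θ i j‖ ≤ c := by
  obtain ⟨c, hc⟩ := isCompact_univ.exists_bound_of_continuousOn
    (f := fun θ => f θ i j) (hf.matrix_elem i j).continuousOn
  exact ⟨c, fun θ => hc θ trivial⟩

theorem MatIntegrable.sub (hF : MatIntegrable μ F) (hG : MatIntegrable μ G) :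
    MatIntegrable μ fun θ => F θ - G θ := fun i j => (hF i j).sub (hG i j)

theorem MatIntegrable.continuous_mul (hF : MatIntegrable μ F) {f : Torus → Mat p}
    (hf : Continuous f) : MatIntegrable μ fun θ => f θ * F θ := by
  intro i j
  simp only [Matrix.mul_apply]
  refine integrable_finsetSum _ fun k _ => ?_
  obtain ⟨c, hc⟩ := exists_bound_of_continuous hf i k
  exact (hF k j).bdd_mul (hf.matrix_elem i k).aestronglyMeasurable (Eventually.of_forall hc)

theorem MatIntegrable.mul_continuous (hF : MatIntegrable μ F) {f : Torus → Mat p}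
    (hf : Continuous f) : MatIntegrable μ fun θ => F θ * f θ := by
  intro i j
  simp only [Matrix.mul_apply]
  refine integrable_finsetSum _ fun k _ => ?_
  obtain ⟨c, hc⟩ := exists_bound_of_continuous hf k j
  exact (hF i k).mul_bdd (hf.matrix_elem k j).aestronglyMeasurable (Eventually.of_forall hc)

theorem MatIntegrable.trace (hF : MatIntegrable μ F) :
    Integrable (fun θ => (F θ).trace) μ :=
  integrable_finsetSum _ fun i _ => hF i i

theorem matIntegrable_of_continuous [IsFiniteMeasure μ] (hF : Continuous F) :
    MatIntegrable μ F := by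
  intro i j
  obtain ⟨c, hc⟩ := exists_bound_of_continuous hF i j
  exact Integrable.of_bound (hF.matrix_elem i j).aestronglyMeasurable c (Eventually.of_forall hc)

theorem matInt_add (hF : MatIntegrable μ F) (hG : MatIntegrable μ G) :
    matInt μ (fun θ => F θ + G θ) = matInt μ F + matInt μ G := by
  ext i j
  exact integral_add (hF i j) (hG i j)

theorem matInt_const_mul (hF : MatIntegrable μ F) (A : Mat p) :
    matInt μ (fun θ => A * F θ) = A * matInt μ F := by
  ext i j
  simp only [matInt, Matrix.of_apply, Matrix.mul_apply]
  rw [integral_finsetSum _ fun k _ => (hF k j).const_mul (A i k)]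
  exact Finset.sum_congr rfl fun k _ => integral_const_mul _ _

theorem matInt_conjTranspose : (matInt μ F)ᴴ = matInt μ fun θ => (F θ)ᴴ := by
  ext i j
  exact (integral_conj (f := fun θ => F θ j i)).symm

theorem trace_matInt (hF : MatIntegrable μ F) :
    (matInt μ F).trace = ∫ θ, (F θ).trace ∂μ :=
  (integral_finsetSum _ fun i _ => hF i i).symm

theorem matInt_posSemidef (hF : MatIntegrable μ F) (hpos : ∀ θ, (F θ).PosSemidef) :
    (matInt μ F).PosSemidef := by
  refine Matrix.PosSemidef.of_dotProduct_mulVec_nonneg ?_ fun v => ?_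
  · rw [Matrix.IsHermitian, matInt_conjTranspose]
    exact congrArg _ (funext fun θ => (hpos θ).1)
  · have h : star v ⬝ᵥ matInt μ F *ᵥ v = ∫ θ, star v ⬝ᵥ F θ *ᵥ v ∂μ := by
      simp only [dotProduct, Matrix.mulVec, matInt, Matrix.of_apply, Finset.mul_sum]
      rw [integral_finsetSum _ fun i _ => integrable_finsetSum _ fun j _ =>
        ((hF i j).mul_const _).const_mul _]
      refine Finset.sum_congr rfl fun i _ => ?_
      rw [integral_finsetSum _ fun j _ => ((hF i j).mul_const _).const_mul _]
      refine Finset.sum_congr rfl fun j _ => ?_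
      rw [integral_const_mul, integral_mul_const]
    rw [h]
    exact integral_nonneg fun θ => (hpos θ).dotProduct_mulVec_nonneg v

end

/-- The sesquilinear form `∫ P(z) M(θ) Q(z)^* dμ(θ)` of a matrix weight. -/
def weightForm (μ : Measure Torus) (M : Torus → Mat p) (P Q : (Mat p)[X]) : Mat p :=
  matInt μ fun θ => evalMat P (zOf θ) * M θ * (evalMat Q (zOf θ))ᴴ

variable {μ : Measure Torus} {M : Torus → Mat p}

theorem MatIntegrable.weight (hM : MatIntegrable μ M) (P Q : (Mat p)[X]) :
    MatIntegrable μ fun θ => evalMat P (zOf θ) * M θ * (evalMat Q (zOf θ))ᴴ :=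
  (hM.continuous_mul (continuous_evalMat_zOf P)).mul_continuous
    (continuous_evalMat_zOf Q).matrix_conjTranspose

theorem isToeplitzForm_weightForm (hM : MatIntegrable μ M) (hherm : ∀ θ, (M θ).IsHermitian) :
    IsToeplitzForm (weightForm μ M) where
  add_left P Q R := by
    rw [weightForm, weightForm, weightForm, ← matInt_add (hM.weight P R) (hM.weight Q R)]
    simp only [evalMat_add, add_mul]
  C_mul_left A P R := by
    rw [weightForm, weightForm, ← matInt_const_mul (hM.weight P R)]
    simp only [evalMat_C_mul, mul_assoc]
  conj_symm P Q := by
    rw [weightForm, weightForm, matInt_conjTranspose]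
    simp only [Matrix.conjTranspose_mul, Matrix.conjTranspose_conjTranspose, (hherm _).eq,
      mul_assoc]
  X_mul P Q := by
    rw [weightForm, weightForm]
    congr 1
    funext θ
    rw [evalMat_X_mul, evalMat_X_mul, Matrix.conjTranspose_smul, smul_mul_assoc, smul_mul_smul_comm,
      mul_comm (zOf θ), star_zOf_mul, one_smul]

theorem weightForm_posSemidef (hM : MatIntegrable μ M) (hpos : ∀ θ, (M θ).PosSemidef)
    (P : (Mat p)[X]) : (weightForm μ M P P).PosSemidef :=
  matInt_posSemidef (hM.weight P P) fun θ => (hpos θ).mul_mul_conjTranspose_same _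

/-! ### Mean values of analytic matrix functions, and reversed polynomials. -/

/-- The mean value property on the unit circle. -/
theorem integral_zOf {f : ℂ → ℂ} (hf : ∀ z, ‖z‖ ≤ 1 → DifferentiableAt ℂ f z) :
    ∫ θ, f (zOf θ) ∂leb = f 0 := by
  have hd : DiffContOnCl ℂ f (Metric.ball 0 |1|) := by
    refine (DifferentiableOn.mono (t := Metric.closedBall 0 1) (fun z hz => ?_) ?_).diffContOnCl
    · exact (hf z (by simpa using hz)).differentiableWithinAt
    · rw [abs_one, closure_ball _ one_ne_zero]
  rw [← hd.circleAverage, Real.circleAverage, AddCircle.integral_haarAddCircle,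
    ← AddCircle.intervalIntegral_preimage (2 * Real.pi) 0]
  simp only [zero_add]
  congr 1
  refine intervalIntegral.integral_congr fun x _ => ?_
  have : zOf (x : Torus) = circleMap 0 1 x := by
    simp [zOf, AddCircle.toCircle_apply_mk, circleMap]
  rw [this]

theorem matInt_zOf {f : ℂ → Mat p} (hf : ∀ z, ‖z‖ ≤ 1 → ∀ i j, DifferentiableAt ℂ (f · i j) z) :
    matInt leb (fun θ => f (zOf θ)) = f 0 := by
  ext i j
  exact integral_zOf fun z hz => hf z hz i j

/-- The reversed polynomial `zⁿ P(1 / z̄)^*`. -/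
def conjReverse (n : ℕ) (P : (Mat p)[X]) : (Mat p)[X] :=
  ∑ k ∈ Finset.range (n + 1), C ((P.coeff (n - k))ᴴ) * X ^ k

theorem coeff_conjReverse (n : ℕ) (P : (Mat p)[X]) {k : ℕ} (hk : k ≤ n) :
    (conjReverse n P).coeff k = (P.coeff (n - k))ᴴ := by
  rw [conjReverse, finsetSum_coeff, Finset.sum_eq_single k]
  · simp
  · intro j _ hj
    rw [coeff_C_mul_X_pow, if_neg hj.symm]
  · intro h
    exact absurd (Finset.mem_range.2 (by omega)) h

theorem natDegree_conjReverse_le (n : ℕ) (P : (Mat p)[X]) : (conjReverse n P).natDegree ≤ n := by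
  refine natDegree_sum_le_of_forall_le _ _ fun k hk => ?_
  exact (natDegree_C_mul_X_pow_le _ _).trans (by simpa [Nat.lt_succ_iff] using hk)

theorem evalMat_conjReverse {n : ℕ} {P : (Mat p)[X]} (hP : P.natDegree ≤ n) {z : ℂ} (hz : z ≠ 0) :
    evalMat (conjReverse n P) z = z ^ n • (evalMat P (star z)⁻¹)ᴴ := by
  rw [conjReverse, evalMat_sum, evalMat_eq_sum_range hP, Matrix.conjTranspose_sum,
    Finset.smul_sum, ← Finset.sum_range_reflect]
  refine Finset.sum_congr rfl fun k hk => ?_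
  have hk : k ≤ n := by simpa [Nat.lt_succ_iff] using hk
  have h1 : n + 1 - 1 - k = n - k := by omega
  rw [h1, evalMat_C_mul, evalMat_X_pow, mul_smul_comm, mul_one, Matrix.conjTranspose_smul,
    smul_smul, Nat.sub_sub_self hk, star_pow, star_inv₀, star_star]
  congr 1
  rw [inv_pow, pow_sub₀ z hz hk]

theorem evalMat_conjReverse_zOf {n : ℕ} {P : (Mat p)[X]} (hP : P.natDegree ≤ n) (θ : Torus) :
    evalMat (conjReverse n P) (zOf θ) = zOf θ ^ n • (evalMat P (zOf θ))ᴴ := by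
  rw [evalMat_conjReverse hP (zOf_ne_zero θ), inv_eq_of_mul_eq_one_right (star_zOf_mul θ)]

theorem continuous_inv_of_isUnit {f : Torus → Mat p} (hf : Continuous f)
    (hu : ∀ θ, IsUnit (f θ)) : Continuous fun θ => (f θ)⁻¹ := by
  simp only [Matrix.inv_def, Ring.inverse_eq_inv']
  exact (hf.matrix_det.inv₀ fun θ =>
    ((Matrix.isUnit_iff_isUnit_det _).1 (hu θ)).ne_zero).smul hf.matrix_adjugate

theorem differentiable_evalMat_apply (P : (Mat p)[X]) (i j : Fin p) :
    Differentiable ℂ fun z => evalMat P z i j := by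
  have : (fun z => evalMat P z i j)
      = fun z => ∑ k ∈ Finset.range (P.natDegree + 1), z ^ k * P.coeff k i j := by
    funext z
    rw [evalMat_eq_sum_range le_rfl, Matrix.sum_apply]
    rfl
  rw [this]
  fun_prop

theorem differentiableAt_det {f : ℂ → Mat p} {z : ℂ}
    (hf : ∀ i j, DifferentiableAt ℂ (fun w => f w i j) z) :
    DifferentiableAt ℂ (fun w => (f w).det) z := by
  simp only [Matrix.det_apply]
  refine DifferentiableAt.fun_sum fun σ _ => DifferentiableAt.const_smul ?_ _
  exact DifferentiableAt.fun_finsetProd fun i _ => hf _ _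

theorem differentiableAt_inv_apply {f : ℂ → Mat p} {z : ℂ}
    (hf : ∀ i j, DifferentiableAt ℂ (fun w => f w i j) z) (hu : IsUnit (f z)) (i j : Fin p) :
    DifferentiableAt ℂ (fun w => (f w)⁻¹ i j) z := by
  simp only [Matrix.inv_def, Ring.inverse_eq_inv', Matrix.smul_apply, smul_eq_mul,
    Matrix.adjugate_apply]
  refine ((differentiableAt_det hf).fun_inv ((Matrix.isUnit_iff_isUnit_det _).1 hu).ne_zero).mul
    (differentiableAt_det fun k l => ?_)
  by_cases hkj : k = j
  · subst hkj
    simp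
  · simpa [Matrix.updateRow_ne hkj] using hf k l

/-- The integrand is the boundary value of a function that is holomorphic at every point of the
closed disc, so its mean is its value at the origin. -/
theorem matInt_evalMat_mul_inv {P G : (Mat p)[X]} (hG : ∀ z, ‖z‖ ≤ 1 → IsUnit (evalMat G z)) :
    matInt leb (fun θ => evalMat P (zOf θ) * (evalMat G (zOf θ))⁻¹)
      = P.coeff 0 * (G.coeff 0)⁻¹ := by
  rw [← evalMat_at_zero P, ← evalMat_at_zero G]
  refine matInt_zOf (f := fun z => evalMat P z * (evalMat G z)⁻¹) fun z hz i j => ?_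
  simp only [Matrix.mul_apply]
  exact DifferentiableAt.fun_sum fun k _ => (differentiable_evalMat_apply P i k z).mul
    (differentiableAt_inv_apply (fun a b => differentiable_evalMat_apply G a b z) (hG z hz) k j)

/-! ### The Bernstein–Szegő weight and its moments. -/

theorem IsToeplitzForm.eq_of_orthonormal {B B' : (Mat p)[X] → (Mat p)[X] → Mat p}
    (hB : IsToeplitzForm B) (hB' : IsToeplitzForm B') {φ : ℕ → (Mat p)[X]} {n : ℕ}
    (hdeg : ∀ k < n, (φ k).natDegree ≤ k)
    (horth : ∀ k < n, ∀ j < k, B (φ k) (X ^ j) = 0) (hnorm : ∀ k < n, B (φ k) (φ k) = 1)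
    (horth' : ∀ k < n, ∀ j < k, B' (φ k) (X ^ j) = 0) (hnorm' : ∀ k < n, B' (φ k) (φ k) = 1)
    {P : (Mat p)[X]} (hP : P.degree < n) : B' P P = B P P := by
  have hunit : ∀ k < n, IsUnit ((φ k).coeff k) := fun k hk =>
    hB.isUnit_lead (horth k hk) (hdeg k hk) (hnorm k hk)
  have hlt : ∀ k l, l < n → k < l → (φ k).degree < l := fun k l hl hkl =>
    degree_le_natDegree.trans_lt (by exact_mod_cast (hdeg k (hkl.trans hl)).trans_lt hkl)
  have hφ : ∀ k < n, ∀ l < n, B' (φ k) (φ l) = B (φ k) (φ l) := by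
    intro k hk l hl
    rcases lt_trichotomy k l with h | rfl | h
    · rw [hB.eq_zero_symm (hB.eq_zero_of_degree_lt (horth l hl) (hlt k l hl h)),
        hB'.eq_zero_symm (hB'.eq_zero_of_degree_lt (horth' l hl) (hlt k l hl h))]
    · rw [hnorm k hk, hnorm' k hk]
    · rw [hB.eq_zero_of_degree_lt (horth k hk) (hlt l k hk h),
        hB'.eq_zero_of_degree_lt (horth' k hk) (hlt l k hk h)]
  have main : ∀ R : (Mat p)[X], (∀ k < n, B' (φ k) R = B (φ k) R) → B' P R = B P R := by
    intro R hR
    refine sub_eq_zero.1 (functional_eq_zero_of_degree_lt (ℓ := fun S => B' S R - B S R)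
      (fun S T => ?_) (fun A S => ?_) hdeg hunit (fun k hk => sub_eq_zero.2 (hR k hk)) hP)
    · simp only [hB.add_left, hB'.add_left]; abel
    · simp only [hB.C_mul_left, hB'.C_mul_left, mul_sub]
  refine main P fun k hk => ?_
  rw [← hB.conj_symm, ← hB'.conj_symm, main (φ k) fun l hl => hφ l hl k hk]

/-- The pair at level `n` is orthonormal in the sense of a Szegő pair. -/
structure IsSzegoPairAt (B : (Mat p)[X] → (Mat p)[X] → Mat p) (φ ψ : ℕ → (Mat p)[X]) (n : ℕ) :
    Prop where
  left_orth : ∀ j < n, B (φ n) (X ^ j) = 0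
  right_orth : ∀ j < n, B (ψ n) (X * X ^ j) = 0
  left_norm : B (φ n) (φ n) = 1
  right_norm : B (ψ n) (ψ n) = 1

/-- The recursion can be run downwards with respect to any Toeplitz form, since it is an algebraic
relation between the polynomials. Orthonormality at level `n + 1` alone thus determines it at level
`n`. -/
theorem IsRecursion.isSzegoPairAt {B : (Mat p)[X] → (Mat p)[X] → Mat p} (hB : IsToeplitzForm B)
    {φ ψ : ℕ → (Mat p)[X]} {n : ℕ} {U A Z : Mat p} (h : IsRecursion φ ψ n U A Z)
    (hφ : (φ n).natDegree ≤ n) (hψ : (ψ n).natDegree ≤ n) (hS : IsSzegoPairAt B φ ψ (n + 1)) :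
    IsSzegoPairAt B φ ψ n := by
  have hu : IsUnit (U * Uᴴ) :=
    h.isUnit_left.mul ((Matrix.isUnit_conjTranspose _).2 h.isUnit_left)
  -- Eliminating `ψ n` between the two recursions gives `(1 - A Aᴴ) zφₙ = U φₙ₊₁ + A Z ψₙ₊₁`.
  have key : ∀ P, U * Uᴴ * B (X * φ n) P = U * B (φ (n + 1)) P + A * (Z * B (ψ (n + 1)) P) := by
    intro P
    have h1 := congrArg (B · P) h.left
    have h2 := congrArg (B · P) h.right
    simp only [hB.add_left, hB.C_mul_left] at h1 h2
    rw [h.left_defect, sub_mul, one_mul, sub_eq_iff_eq_add]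
    conv_lhs => rw [h1, h2]
    noncomm_ring
  have hlo : ∀ j < n, B (φ n) (X ^ j) = 0 := by
    intro j hj
    have h1 := key (X * X ^ j)
    rw [hS.right_orth j (by omega), ← pow_succ', hS.left_orth (j + 1) (by omega), pow_succ',
      hB.X_mul] at h1
    simp only [mul_zero, add_zero] at h1
    exact hu.mul_right_eq_zero.1 h1
  have hro : ∀ j < n, B (ψ n) (X * X ^ j) = 0 := by
    intro j hj
    rw [h.right, hB.add_left, hB.C_mul_left, hB.C_mul_left, hB.X_mul, hlo j hj,
      hS.right_orth j (by omega)]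
    simp
  have h2 : B (ψ (n + 1)) (X * φ n) = 0 :=
    hB.right_apply_X_mul hS.right_orth (degree_lt_succ_of_natDegree_le hφ)
  have hln : B (φ n) (φ n) = 1 := by
    have h1 : B (φ (n + 1)) (X * φ n) = Uᴴ := by
      rw [h.left, hB.add_right, hB.C_mul_right, hB.C_mul_right, hS.left_norm,
        hB.eq_zero_of_degree_lt hS.left_orth (degree_lt_succ_of_natDegree_le hψ)]
      simp
    have h3 := key (X * φ n)
    rw [h1, h2, hB.X_mul] at h3
    simp only [mul_zero, add_zero] at h3
    exact hu.mul_left_cancel (by rw [h3, mul_one])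
  refine ⟨hlo, hro, hln, ?_⟩
  rw [h.right]
  simp only [hB.add_left, hB.add_right, hB.C_mul_left, hB.C_mul_right, hS.right_norm, h2,
    hB.eq_zero_symm h2, hB.X_mul, hln, mul_zero, zero_mul, add_zero, zero_add, one_mul,
    Matrix.conjTranspose_conjTranspose, h.right_defect]
  abel

/-- The Bernstein–Szegő weight `(ψₙ^* ψₙ)⁻¹`. -/
def bernsteinSzego (ψ : ℕ → (Mat p)[X]) (n : ℕ) (θ : Torus) : Mat p :=
  ((evalMat (ψ n) (zOf θ))ᴴ * evalMat (ψ n) (zOf θ))⁻¹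

theorem mul_inv_conjTranspose_mul_self {g : Mat p} (hg : IsUnit g) (S : Mat p) :
    g * (gᴴ * g)⁻¹ * Sᴴ = (S * g⁻¹)ᴴ := by
  rw [Matrix.mul_inv_rev, ← mul_assoc,
    Matrix.mul_nonsing_inv _ ((Matrix.isUnit_iff_isUnit_det _).1 hg), one_mul,
    Matrix.conjTranspose_mul, Matrix.conjTranspose_nonsing_inv]

namespace IsSzegoPair

variable {B : (Mat p)[X] → (Mat p)[X] → Mat p} {φ ψ : ℕ → (Mat p)[X]}
  (hS : IsSzegoPair B φ ψ) (hB : IsToeplitzForm B) (hdef : ∀ P, B P P = 0 → P = 0)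
include hS hB hdef

theorem isUnit_right_zOf (n : ℕ) (θ : Torus) : IsUnit (evalMat (ψ n) (zOf θ)) :=
  (hS.isUnit_right_eval hB hdef n (norm_zOf θ).le).1

theorem isUnit_left_zOf (n : ℕ) (θ : Torus) : IsUnit (evalMat (φ n) (zOf θ)) :=
  (hS.isUnit_left_eval hB hdef n (norm_zOf θ).ge).1

theorem continuous_bernsteinSzego (n : ℕ) : Continuous (bernsteinSzego ψ n) :=
  continuous_inv_of_isUnit
    ((continuous_evalMat_zOf (ψ n)).matrix_conjTranspose.mul (continuous_evalMat_zOf (ψ n)))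
    fun θ => ((Matrix.isUnit_conjTranspose _).2 (hS.isUnit_right_zOf hB hdef n θ)).mul
      (hS.isUnit_right_zOf hB hdef n θ)

theorem isToeplitzForm_bernsteinSzego (n : ℕ) :
    IsToeplitzForm (weightForm leb (bernsteinSzego ψ n)) :=
  isToeplitzForm_weightForm
    (matIntegrable_of_continuous (hS.continuous_bernsteinSzego hB hdef n))
    fun _ => (Matrix.posSemidef_conjTranspose_mul_self _).inv.1

/-- The weight cancels `ψ n` and leaves the adjoint of `P ψₙ⁻¹`, which is analytic on the disc. -/
theorem right_weightForm (n : ℕ) (P : (Mat p)[X]) :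
    weightForm leb (bernsteinSzego ψ n) (ψ n) P = (P.coeff 0 * ((ψ n).coeff 0)⁻¹)ᴴ := by
  rw [← matInt_evalMat_mul_inv fun z hz => (hS.isUnit_right_eval hB hdef n hz).1,
    matInt_conjTranspose, weightForm]
  congr 1
  funext θ
  exact mul_inv_conjTranspose_mul_self (hS.isUnit_right_zOf hB hdef n θ) _

theorem isUnit_conjReverse_eval (n : ℕ) {z : ℂ} (hz : ‖z‖ ≤ 1) :
    IsUnit (evalMat (conjReverse n (φ n)) z) := by
  rcases eq_or_ne z 0 with rfl | h0
  · rw [evalMat_at_zero, coeff_conjReverse n _ (Nat.zero_le n), Nat.sub_zero]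
    exact (Matrix.isUnit_conjTranspose _).2 (hS.isUnit_left hB n)
  · rw [evalMat_conjReverse (hS.left_deg n) h0]
    have h1 : IsUnit (evalMat (φ n) (star z)⁻¹) := by
      refine (hS.isUnit_left_eval hB hdef n ?_).1
      rw [norm_inv, norm_star]
      exact (one_le_inv₀ (norm_pos_iff.2 h0)).2 hz
    exact ((Matrix.isUnit_conjTranspose _).2 h1).smul (Units.mk0 (z ^ n) (pow_ne_zero n h0))

/-- On the circle the weight is also `(φₙᴴ φₙ)⁻¹`, so the integrand is `z⁻ʲ (φₙᴴ)⁻¹`. In terms of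
the reversed polynomial this equals `zⁿ⁻ʲ` times the inverse of `conjReverse n (φ n)`, which is
analytic on the disc and vanishes at `0`. -/
theorem left_weightForm (n : ℕ) {j : ℕ} (hj : j < n) :
    weightForm leb (bernsteinSzego ψ n) (φ n) (X ^ j) = 0 := by
  have h := matInt_evalMat_mul_inv (P := X ^ (n - j))
    fun z hz => hS.isUnit_conjReverse_eval hB hdef n hz
  rw [coeff_X_pow, if_neg (by omega), zero_mul] at h
  rw [← h, weightForm]
  congr 1
  funext θ
  have hz := zOf_ne_zero θ
  rw [bernsteinSzego, ← hS.conjTranspose_mul_self_eq hB hdef n (norm_zOf θ),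
    mul_inv_conjTranspose_mul_self (hS.isUnit_left_zOf hB hdef n θ),
    evalMat_conjReverse_zOf (hS.left_deg n), evalMat_X_pow, evalMat_X_pow, smul_mul_assoc,
    smul_mul_assoc, one_mul, one_mul, Matrix.conjTranspose_smul, Matrix.conjTranspose_nonsing_inv]
  have hdet := (Matrix.isUnit_iff_isUnit_det _).1
    ((Matrix.isUnit_conjTranspose _).2 (hS.isUnit_left_zOf hB hdef n θ))
  have h2 : (zOf θ ^ n • (evalMat (φ n) (zOf θ))ᴴ)⁻¹
      = (zOf θ ^ n)⁻¹ • ((evalMat (φ n) (zOf θ))ᴴ)⁻¹ := by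
    refine Matrix.inv_eq_left_inv ?_
    rw [smul_mul_smul_comm, inv_mul_cancel₀ (pow_ne_zero n hz),
      Matrix.nonsing_inv_mul _ hdet, one_smul]
  rw [h2, smul_smul]
  congr 1
  rw [star_pow, eq_inv_of_mul_eq_one_left (star_zOf_mul θ), pow_sub₀ _ hz hj.le, inv_pow,
    mul_right_comm, mul_inv_cancel₀ (pow_ne_zero n hz), one_mul]

theorem isSzegoPairAt_weightForm (n : ℕ) {k : ℕ} (hk : k ≤ n) :
    IsSzegoPairAt (weightForm leb (bernsteinSzego ψ n)) φ ψ k := by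
  induction hk using Nat.decreasingInduction with
  | self =>
    refine ⟨fun j hj => hS.left_weightForm hB hdef n hj, fun j hj => ?_, ?_, ?_⟩
    · rw [hS.right_weightForm hB hdef, coeff_X_mul_zero, zero_mul, Matrix.conjTranspose_zero]
    · have : (fun θ => evalMat (φ n) (zOf θ) * bernsteinSzego ψ n θ * (evalMat (φ n) (zOf θ))ᴴ)
          = fun _ => (1 : Mat p) := by
        funext θ
        rw [bernsteinSzego, ← hS.conjTranspose_mul_self_eq hB hdef n (norm_zOf θ),
          mul_inv_conjTranspose_mul_self (hS.isUnit_left_zOf hB hdef n θ),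
          Matrix.mul_nonsing_inv _ ((Matrix.isUnit_iff_isUnit_det _).1
            (hS.isUnit_left_zOf hB hdef n θ)), Matrix.conjTranspose_one]
      rw [weightForm, this]
      ext i j
      simp [matInt]
    · rw [hS.right_weightForm hB hdef, Matrix.mul_nonsing_inv _
        ((Matrix.isUnit_iff_isUnit_det _).1 (hS.isUnit_right hB n)), Matrix.conjTranspose_one]
  | of_succ k hk ih =>
    obtain ⟨U, Z, h⟩ := hS.exists_recursion hB hdef k
    exact h.isSzegoPairAt (hS.isToeplitzForm_bernsteinSzego hB hdef n) (hS.left_deg k)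
      (hS.right_deg k) ih

/-- The Bernstein–Szegő approximation has the same moments up to order `n`. -/
theorem weightForm_eq {n : ℕ} {P : (Mat p)[X]} (hP : P.natDegree ≤ n) :
    weightForm leb (bernsteinSzego ψ n) P P = B P P :=
  hB.eq_of_orthonormal (hS.isToeplitzForm_bernsteinSzego hB hdef n) (n := n + 1)
    (fun k _ => hS.left_deg k) (fun k _ => hS.left_orth k) (fun k _ => hS.left_norm k)
    (fun _ hk => (hS.isSzegoPairAt_weightForm hB hdef n (Nat.lt_succ_iff.1 hk)).left_orth)
    (fun _ hk => (hS.isSzegoPairAt_weightForm hB hdef n (Nat.lt_succ_iff.1 hk)).left_norm)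
    (degree_lt_succ_of_natDegree_le hP)

end IsSzegoPair

/-! ### Reduction of a matrix measure to a positive density. -/

theorem complexMeasure_integral_eq {c : ComplexMeasure Torus} {μ : Measure Torus} {m : Torus → ℂ}
    (hm : Integrable m μ) (hc : ∀ E, MeasurableSet E → c E = ∫ θ in E, m θ ∂μ)
    {f : Torus → ℂ} (hf : Continuous f) :
    c.integral f (ContinuousLinearMap.mul ℝ ℂ) = ∫ θ, f θ * m θ ∂μ := by
  have hcm : c = μ.withDensityᵥ m := by
    ext E hE : 1
    rw [hc E hE, withDensityᵥ_apply hm hE]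
  have hvar : c.variation = μ.withDensity fun x => ‖m x‖ₑ := by
    rw [hcm, Measure.variation_withDensityᵥ hm]
  have hfin : IsFiniteMeasure c.variation := by
    rw [hvar]
    exact ⟨by simpa using! hm.2⟩
  have hsimple : ∀ g : SimpleFunc Torus ℂ,
      c.integral g (ContinuousLinearMap.mul ℝ ℂ) = ∫ θ, g θ * m θ ∂μ := by
    intro g
    induction g using SimpleFunc.induction with
    | @const a s hs =>
      have h1 : c.integral (s.indicator fun _ => a) (ContinuousLinearMap.mul ℝ ℂ) = a * c s := by
        rw [VectorMeasure.integral_eq_setToFun, setToFun_indicator_const _ hs (measure_ne_top _ _)]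
        rfl
      have h2 : ∀ θ, s.indicator (fun _ => a) θ * m θ = s.indicator (fun x => a * m x) θ := by
        intro θ
        by_cases h : θ ∈ s <;> simp [h]
      have h3 : (⇑(SimpleFunc.piecewise s hs (SimpleFunc.const Torus a) (SimpleFunc.const Torus 0)) :
          Torus → ℂ) = s.indicator fun _ => a := by
        funext θ
        by_cases h : θ ∈ s <;> simp [SimpleFunc.piecewise_apply, h]
      simp only [h3, h1, hc s hs, h2]
      rw [integral_indicator hs, integral_const_mul]
    | @add g h _ hg hh =>
      have hint : ∀ k : SimpleFunc Torus ℂ, Integrable (fun θ => k θ * m θ) μ := fun k => by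
        obtain ⟨C, hC⟩ := k.exists_forall_norm_le
        exact hm.bdd_mul k.measurable.aestronglyMeasurable (Eventually.of_forall hC)
      have hint' : ∀ k : SimpleFunc Torus ℂ, c.Integrable k := fun k =>
        SimpleFunc.integrable_of_isFiniteMeasure k
      rw [SimpleFunc.coe_add, VectorMeasure.integral_add (hint' g) (hint' h), hg, hh,
        ← integral_add (hint g) (hint h)]
      simp only [Pi.add_apply, add_mul]
  obtain ⟨C, hC⟩ := isCompact_univ.exists_bound_of_continuousOn hf.continuousOn
  have hfs : StronglyMeasurable f := hf.stronglyMeasurable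
  have hlim : ∀ θ, Tendsto (fun n => hfs.approxBounded C n θ) atTop (𝓝 (f θ)) := fun θ =>
    hfs.tendsto_approxBounded_of_norm_le (hC θ trivial)
  have hC0 : 0 ≤ C := (norm_nonneg _).trans (hC 0 trivial)
  have hbd : ∀ n θ, ‖hfs.approxBounded C n θ‖ ≤ C := fun n θ =>
    hfs.norm_approxBounded_le hC0 n θ
  have t1 : Tendsto (fun n => c.integral (hfs.approxBounded C n) (ContinuousLinearMap.mul ℝ ℂ))
      atTop (𝓝 (c.integral f (ContinuousLinearMap.mul ℝ ℂ))) :=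
    VectorMeasure.tendsto_integral_filter_of_norm_le_const
      (Eventually.of_forall fun n => (hfs.approxBounded C n).measurable.aestronglyMeasurable)
      ⟨C, Eventually.of_forall fun n => Eventually.of_forall (hbd n)⟩ (Eventually.of_forall hlim)
  have t2 : Tendsto (fun n => ∫ θ, hfs.approxBounded C n θ * m θ ∂μ) atTop
      (𝓝 (∫ θ, f θ * m θ ∂μ)) := by
    refine tendsto_integral_of_dominated_convergence (fun θ => C * ‖m θ‖)
      (fun n => (hfs.approxBounded C n).measurable.aestronglyMeasurable.mul hm.1)
      (hm.norm.const_mul C) (fun n => Eventually.of_forall fun θ => ?_)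
      (Eventually.of_forall fun θ => (hlim θ).mul_const _)
    rw [norm_mul]
    exact mul_le_mul_of_nonneg_right (hbd n θ) (norm_nonneg _)
  simp only [hsimple] at t1
  exact tendsto_nhds_unique t1 t2

theorem ae_nonneg_of_setIntegral_nonneg {μ : Measure Torus} {f : Torus → ℂ} (hf : Integrable f μ)
    (h : ∀ E, MeasurableSet E → 0 ≤ ∫ θ in E, f θ ∂μ) : ∀ᵐ θ ∂μ, 0 ≤ f θ := by
  have hre : ∀ E, MeasurableSet E → ∫ θ in E, (f θ).re ∂μ = (∫ θ in E, f θ ∂μ).re := fun E _ =>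
    integral_re hf.integrableOn
  have him : ∀ E, MeasurableSet E → ∫ θ in E, (f θ).im ∂μ = (∫ θ in E, f θ ∂μ).im := fun E _ =>
    integral_im hf.integrableOn
  have h1 := ae_nonneg_of_forall_setIntegral_nonneg (f := fun θ => (f θ).re) hf.re
    fun E hE _ => by rw [hre E hE]; exact (Complex.le_def.1 (h E hE)).1
  have h2 := Integrable.ae_eq_zero_of_forall_setIntegral_eq_zero (f := fun θ => (f θ).im) hf.im
    fun E hE _ => by rw [him E hE]; exact (Complex.le_def.1 (h E hE)).2.symm
  filter_upwards [h1, h2] with θ h1 h2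
  exact Complex.le_def.2 ⟨h1, h2.symm⟩

theorem setIntegral_dotProduct_mulVec {μ : Measure Torus} {F : Torus → Mat p}
    (hF : MatIntegrable μ F) (E : Set Torus) (v : Fin p → ℂ) :
    ∫ θ in E, star v ⬝ᵥ F θ *ᵥ v ∂μ
      = star v ⬝ᵥ (Matrix.of fun i j => ∫ θ in E, F θ i j ∂μ) *ᵥ v := by
  have hF' := fun i j => (hF i j).integrableOn (s := E)
  simp only [dotProduct, Matrix.mulVec, Matrix.of_apply, Finset.mul_sum]
  rw [integral_finsetSum _ fun i _ => integrable_finsetSum _ fun j _ =>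
    ((hF' i j).mul_const _).const_mul _]
  refine Finset.sum_congr rfl fun i _ => ?_
  rw [integral_finsetSum _ fun j _ => ((hF' i j).mul_const _).const_mul _]
  refine Finset.sum_congr rfl fun j _ => ?_
  rw [integral_const_mul, integral_mul_const]

theorem integrable_dotProduct_mulVec {μ : Measure Torus} {F : Torus → Mat p}
    (hF : MatIntegrable μ F) (v : Fin p → ℂ) :
    Integrable (fun θ => star v ⬝ᵥ F θ *ᵥ v) μ := by
  simp only [dotProduct, Matrix.mulVec, Finset.mul_sum]
  exact integrable_finsetSum _ fun i _ => integrable_finsetSum _ fun j _ =>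
    ((hF i j).mul_const _).const_mul _

/-- Positivity is tested on a countable dense set of vectors, which gives one null set for all of
them; closedness of the inequality does the rest. -/
theorem ae_posSemidef {μ : Measure Torus} {F : Torus → Mat p} (hF : MatIntegrable μ F)
    (h : ∀ E, MeasurableSet E → (Matrix.of fun i j => ∫ θ in E, F θ i j ∂μ).PosSemidef) :
    ∀ᵐ θ ∂μ, (F θ).PosSemidef := by
  have hherm : ∀ᵐ θ ∂μ, ∀ i j, star (F θ j i) = F θ i j := by
    refine ae_all_iff.2 fun i => ae_all_iff.2 fun j => ?_
    refine Integrable.ae_eq_of_forall_setIntegral_eq (fun θ => star (F θ j i))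
      (fun θ => F θ i j) ?_ (hF i j) fun E hE _ => ?_
    · exact (Complex.conjLIE.toContinuousLinearEquiv.toContinuousLinearMap).integrable_comp (hF j i)
    · exact integral_conj.trans (congrFun (congrFun (h E hE).1 i) j)
  have hv : ∀ᵐ θ ∂μ, ∀ n, 0 ≤ star (TopologicalSpace.denseSeq (Fin p → ℂ) n) ⬝ᵥ
      F θ *ᵥ (TopologicalSpace.denseSeq (Fin p → ℂ) n) := by
    refine ae_all_iff.2 fun n => ae_nonneg_of_setIntegral_nonneg
      (integrable_dotProduct_mulVec hF _) fun E hE => ?_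
    rw [setIntegral_dotProduct_mulVec hF]
    exact (h E hE).dotProduct_mulVec_nonneg _
  filter_upwards [hherm, hv] with θ h1 h2
  refine Matrix.PosSemidef.of_dotProduct_mulVec_nonneg ?_ fun v => ?_
  · ext i j
    exact h1 i j
  · have hcl : IsClosed {v : Fin p → ℂ | 0 ≤ star v ⬝ᵥ F θ *ᵥ v} := by
      refine isClosed_le continuous_const ?_
      fun_prop
    have : Set.range (TopologicalSpace.denseSeq (Fin p → ℂ)) ⊆
        {v : Fin p → ℂ | 0 ≤ star v ⬝ᵥ F θ *ᵥ v} := by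
      rintro _ ⟨n, rfl⟩
      exact h2 n
    exact hcl.closure_subset_iff.2 this (TopologicalSpace.denseRange_denseSeq _ v)

/-- `M` is a positive density with respect to a finite measure `μ` that agrees with the normalized
Lebesgue measure off a Lebesgue null set `N`. -/
structure IsDensity (μ : Measure Torus) (N : Set Torus) (M : Torus → Mat p) : Prop where
  finite : IsFiniteMeasure μ
  measurableSet : MeasurableSet N
  leb_eq : leb = μ.restrict Nᶜ
  integrable : MatIntegrable μ M
  posSemidef : ∀ θ, (M θ).PosSemidef
  posDef : ∀ᵐ θ ∂leb, (M θ).PosDef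

theorem ComplexMeasure.eq_setIntegral_rnDeriv {c : ComplexMeasure Torus} {ν : Measure Torus}
    [IsFiniteMeasure ν] (h : ∀ E, MeasurableSet E → ν E = 0 → c E = 0) {E : Set Torus}
    (hE : MeasurableSet E) : c E = ∫ θ in E, c.rnDeriv ν θ ∂ν := by
  have hac : ∀ E, MeasurableSet E → ν.toENNRealVectorMeasure E = 0 → c E = 0 := by
    intro E hE h0
    rw [Measure.toENNRealVectorMeasure_apply_measurable hE] at h0
    exact h E hE h0
  have hr : ν.withDensityᵥ (c.re.rnDeriv ν) = c.re :=
    SignedMeasure.withDensityᵥ_rnDeriv_eq _ _ (VectorMeasure.AbsolutelyContinuous.mk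
      fun E hE h0 => congrArg Complex.re (hac E hE h0))
  have hi : ν.withDensityᵥ (c.im.rnDeriv ν) = c.im :=
    SignedMeasure.withDensityᵥ_rnDeriv_eq _ _ (VectorMeasure.AbsolutelyContinuous.mk
      fun E hE h0 => congrArg Complex.im (hac E hE h0))
  have hint := (c.integrable_rnDeriv ν).integrableOn (s := E)
  apply Complex.ext
  · refine Eq.trans ?_ (integral_re hint)
    have := congrArg (fun s : SignedMeasure Torus => s E) hr
    simp only [withDensityᵥ_apply (SignedMeasure.integrable_rnDeriv _ _) hE] at this
    exact this.symm
  · refine Eq.trans ?_ (integral_im hint)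
    have := congrArg (fun s : SignedMeasure Torus => s E) hi
    simp only [withDensityᵥ_apply (SignedMeasure.integrable_rnDeriv _ _) hE] at this
    exact this.symm

theorem exists_density {ρ : MatrixMeasure p} (hρ : ∀ E : Set Torus, (ρ E).PosSemidef)
    {ρ' : Torus → Mat p} {ρs : MatrixMeasure p} (hdec : IsLebesgueDecomposition ρ ρ' ρs)
    (hdet : ∀ᵐ θ ∂leb, 0 < (ρ' θ).det) :
    ∃ μ N M, IsDensity (p := p) μ N M ∧
      ∀ E, MeasurableSet E → ρ E = Matrix.of fun i j => ∫ θ in E, M θ i j ∂μ := by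
  classical
  obtain ⟨s, hs, hs1, hs2⟩ := hdec.singular
  -- A finite scalar measure dominating every entry of the singular part. It is then restricted to
  -- `sᶜ`, the Lebesgue null set that carries `ρs`.
  set V : Measure Torus := ∑ i, ∑ j, ((ComplexMeasure.re (entry ρs i j)).totalVariation
    + (ComplexMeasure.im (entry ρs i j)).totalVariation) with hV
  set ν : Measure Torus := V.restrict sᶜ with hν
  have hVfin : IsFiniteMeasure V := by
    rw [hV]; infer_instance
  have hsc : leb sᶜ = 0 := by
    have := hs2 sᶜ le_rfl
    rwa [Measure.toENNRealVectorMeasure_apply_measurable hs.compl] at this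
  have hνs : ν s = 0 := by
    rw [hν, Measure.restrict_apply hs, Set.inter_compl_self, measure_empty]
  have hac : ∀ i j, ∀ E, MeasurableSet E → ν E = 0 → entry ρs i j E = 0 := by
    intro i j E hE h0
    rw [hν, Measure.restrict_apply hE, hV] at h0
    have h1 : ((ComplexMeasure.re (entry ρs i j)).totalVariation
        + (ComplexMeasure.im (entry ρs i j)).totalVariation) (E ∩ sᶜ) = 0 := by
      simp only [Measure.finsetSum_apply, Finset.sum_eq_zero_iff] at h0
      exact h0 i (Finset.mem_univ _) j (Finset.mem_univ _)
    rw [Measure.add_apply, add_eq_zero] at h1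
    have h2 : entry ρs i j (E ∩ sᶜ) = 0 :=
      Complex.ext (SignedMeasure.null_of_totalVariation_zero _ h1.1)
        (SignedMeasure.null_of_totalVariation_zero _ h1.2)
    have h3 : entry ρs i j (E ∩ s) = 0 := by
      rw [entry_apply, hs1 _ Set.inter_subset_right]
      rfl
    have h4 := VectorMeasure.of_union (v := entry ρs i j)
      (Set.disjoint_left.2 fun x (hx : x ∈ E ∩ s) (hx' : x ∈ E ∩ sᶜ) => hx'.2 hx.2)
      (hE.inter hs) (hE.inter hs.compl)
    rwa [Set.inter_union_compl, h2, h3, add_zero] at h4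
  set M₀ : Torus → Mat p := fun θ => if θ ∈ s then ρ' θ else
    Matrix.of fun i j => (entry ρs i j).rnDeriv ν θ with hM₀
  have hlebae : ∀ᵐ θ ∂leb, θ ∈ s := by
    rw [ae_iff]; exact hsc
  have hνae : ∀ᵐ θ ∂ν, θ ∉ s := by
    rw [ae_iff]; simpa using hνs
  have e1 : ∀ i j, (fun θ => M₀ θ i j) =ᵐ[leb] fun θ => ρ' θ i j := fun i j => by
    filter_upwards [hlebae] with θ hθ
    simp [hM₀, hθ]
  have e2 : ∀ i j, (fun θ => M₀ θ i j) =ᵐ[ν] (entry ρs i j).rnDeriv ν := fun i j => by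
    filter_upwards [hνae] with θ hθ
    simp [hM₀, hθ]
  have i1 : ∀ i j, Integrable (fun θ => M₀ θ i j) leb := fun i j =>
    (hdec.integrable i j).congr (e1 i j).symm
  have i2 : ∀ i j, Integrable (fun θ => M₀ θ i j) ν := fun i j =>
    (ComplexMeasure.integrable_rnDeriv _ _).congr (e2 i j).symm
  have hint : MatIntegrable (leb + ν) M₀ := fun i j => (i1 i j).add_measure (i2 i j)
  have hval : ∀ E, MeasurableSet E →
      ρ E = Matrix.of fun i j => ∫ θ in E, M₀ θ i j ∂(leb + ν) := by
    intro E hE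
    rw [hdec.eq_add E hE]
    ext i j
    rw [Matrix.add_apply, Matrix.of_apply, Matrix.of_apply, Measure.restrict_add,
      integral_add_measure (i1 i j).integrableOn (i2 i j).integrableOn,
      integral_congr_ae (ae_restrict_of_ae (e1 i j)), integral_congr_ae (ae_restrict_of_ae (e2 i j)),
      ← ComplexMeasure.eq_setIntegral_rnDeriv (hac i j) hE, entry_apply]
  have hpsd : ∀ᵐ θ ∂(leb + ν), (M₀ θ).PosSemidef :=
    ae_posSemidef hint fun E hE => by rw [← hval E hE]; exact hρ E
  -- Changing the density on a null set makes it positive semidefinite at every point.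
  set M : Torus → Mat p := fun θ => if (M₀ θ).PosSemidef then M₀ θ else 0 with hM
  have hMae : ∀ᵐ θ ∂(leb + ν), M θ = M₀ θ := by
    filter_upwards [hpsd] with θ hθ
    simp [hM, hθ]
  have hleb : leb = (leb + ν).restrict sᶜᶜ := by
    rw [compl_compl, Measure.restrict_add, Measure.restrict_eq_self_of_ae_mem hlebae,
      Measure.restrict_eq_zero.2 hνs, add_zero]
  refine ⟨leb + ν, sᶜ, M, ⟨inferInstance, hs.compl, hleb, fun i j => ?_, fun θ => ?_, ?_⟩, ?_⟩
  · exact (hint i j).congr (hMae.mono fun θ h => (congrFun (congrFun h i) j).symm)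
  · by_cases h : (M₀ θ).PosSemidef
    · simp [hM, h]
    · simp [hM, h, Matrix.PosSemidef.zero]
  · have h1 : ∀ᵐ θ ∂leb, (M₀ θ).PosSemidef := (ae_add_measure_iff.1 hpsd).1
    have h2 : ∀ᵐ θ ∂leb, M θ = M₀ θ := (ae_add_measure_iff.1 hMae).1
    filter_upwards [h1, h2, hdet, hlebae] with θ h1 h2 h3 h4
    have h5 : M₀ θ = ρ' θ := by simp [hM₀, h4]
    rw [h2]
    rw [h1.posDef_iff_isUnit, Matrix.isUnit_iff_isUnit_det, h5]
    exact isUnit_iff_ne_zero.2 h3.ne'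
  · intro E hE
    rw [hval E hE]
    ext i j
    exact integral_congr_ae (ae_restrict_of_ae (hMae.mono fun θ h => (congrFun (congrFun h i) j).symm))

theorem matrixIntegral_eq {ρ : MatrixMeasure p} {μ : Measure Torus} {M : Torus → Mat p}
    (hM : MatIntegrable μ M)
    (hρ : ∀ E, MeasurableSet E → ρ E = Matrix.of fun i j => ∫ θ in E, M θ i j ∂μ)
    {F G : Torus → Mat p} (hF : Continuous F) (hG : Continuous G) :
    matrixIntegral ρ F G = matInt μ fun θ => F θ * M θ * G θ := by
  ext i j
  have h : ∀ θ, (F θ * M θ * G θ) i j = ∑ k, ∑ l, F θ i k * G θ l j * M θ k l := by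
    intro θ
    simp only [Matrix.mul_apply, Finset.sum_mul]
    rw [Finset.sum_comm]
    exact Finset.sum_congr rfl fun k _ => Finset.sum_congr rfl fun l _ => by ring
  have hc : ∀ k l, Continuous fun θ => F θ i k * G θ l j := fun k l =>
    (hF.matrix_elem i k).mul (hG.matrix_elem l j)
  have hint : ∀ k l, Integrable (fun θ => F θ i k * G θ l j * M θ k l) μ := fun k l => by
    obtain ⟨C, hC⟩ := isCompact_univ.exists_bound_of_continuousOn (hc k l).continuousOn
    exact (hM k l).bdd_mul (hc k l).aestronglyMeasurable
      (Eventually.of_forall fun θ => hC θ trivial)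
  simp only [matrixIntegral, matInt, Matrix.of_apply, h]
  rw [integral_finsetSum _ fun k _ => integrable_finsetSum _ fun l _ => hint k l]
  refine Finset.sum_congr rfl fun k _ => ?_
  rw [integral_finsetSum _ fun l _ => hint k l]
  refine Finset.sum_congr rfl fun l _ => ?_
  exact complexMeasure_integral_eq (hM k l)
    (fun E hE => by rw [entry_apply, hρ E hE, Matrix.of_apply]) (hc k l)

/-! ### Trace and determinant inequalities for positive semidefinite matrices. -/

theorem norm_sub_smul_one_apply_le {A : Mat p} (hA : A.IsHermitian) (c : ℝ) (k j : Fin p) :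
    ‖(A - (c : ℂ) • (1 : Mat p)) k j‖ ≤ ∑ i, |hA.eigenvalues i - c| := by
  set U : Mat p := (hA.eigenvectorUnitary : Mat p) with hU
  have hUU : U * Uᴴ = 1 := Unitary.mul_star_self_of_mem hA.eigenvectorUnitary.2
  have hUe : ∀ i j, ‖U i j‖ ≤ 1 := fun i j =>
    norm_apply_le_one_of_mul_conjTranspose (A := 0) (by simpa using hUU) i j
  have hspec : A = U * Matrix.diagonal (fun i => ((hA.eigenvalues i : ℝ) : ℂ)) * Uᴴ := by
    conv_lhs => rw [hA.spectral_theorem, Unitary.conjStarAlgAut_apply]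
    rfl
  have h : A - (c : ℂ) • (1 : Mat p)
      = U * Matrix.diagonal (fun i => ((hA.eigenvalues i - c : ℝ) : ℂ)) * Uᴴ := by
    have : Matrix.diagonal (fun i => ((hA.eigenvalues i - c : ℝ) : ℂ))
        = Matrix.diagonal (fun i => ((hA.eigenvalues i : ℝ) : ℂ)) - (c : ℂ) • (1 : Mat p) := by
      rw [Matrix.smul_one_eq_diagonal, Matrix.diagonal_sub]
      simp
    rw [this, mul_sub, sub_mul, ← hspec, mul_smul_comm, mul_one, smul_mul_assoc, hUU]
  rw [h, Matrix.mul_apply]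
  refine (norm_sum_le _ _).trans (Finset.sum_le_sum fun i _ => ?_)
  rw [Matrix.mul_diagonal, Matrix.conjTranspose_apply, norm_mul, norm_mul, norm_star,
    Complex.norm_real, Real.norm_eq_abs]
  calc ‖U k i‖ * |hA.eigenvalues i - c| * ‖U j i‖ ≤ 1 * |hA.eigenvalues i - c| * 1 := by
        gcongr <;> apply hUe
    _ = _ := by ring

theorem trace_re_eq_sum_eigenvalues {A : Mat p} (hA : A.IsHermitian) :
    A.trace.re = ∑ i, hA.eigenvalues i := by
  rw [hA.trace_eq_sum_eigenvalues]
  simp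

theorem norm_det_eq_prod_eigenvalues {A : Mat p} (hA : A.PosSemidef) :
    ‖A.det‖ = ∏ i, hA.1.eigenvalues i := by
  rw [hA.1.det_eq_prod_eigenvalues, norm_prod]
  refine Finset.prod_congr rfl fun i _ => ?_
  simpa using hA.eigenvalues_nonneg i

theorem norm_apply_le_trace {A : Mat p} (hA : A.PosSemidef) (k j : Fin p) :
    ‖A k j‖ ≤ A.trace.re := by
  have := norm_sub_smul_one_apply_le hA.1 0 k j
  simp only [Complex.ofReal_zero, zero_smul, sub_zero] at this
  rw [trace_re_eq_sum_eigenvalues hA.1]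
  exact this.trans_eq (Finset.sum_congr rfl fun i _ => abs_of_nonneg (hA.eigenvalues_nonneg i))

theorem trace_re_nonneg {A : Mat p} (hA : A.PosSemidef) : 0 ≤ A.trace.re :=
  (Complex.le_def.1 hA.trace_nonneg).1

theorem card_mul_prod_rpow_le_sum (hp : 0 < p) {w : Fin p → ℝ} (hw : ∀ i, 0 ≤ w i) :
    p * (∏ i, w i) ^ (1 / (p : ℝ)) ≤ ∑ i, w i := by
  have hp' : (0 : ℝ) < p := by exact_mod_cast hp
  have := Real.geom_mean_le_arith_mean Finset.univ (fun _ => 1) w (fun _ _ => zero_le_one)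
    (by simpa using hp) (fun i _ => hw i)
  simp only [Real.rpow_one, Finset.sum_const, Finset.card_univ, Fintype.card_fin, nsmul_eq_mul,
    mul_one, one_mul] at this
  rw [le_div_iff₀ hp', mul_comm] at this
  rwa [one_div]

theorem card_mul_det_rpow_le_trace (hp : 0 < p) {A : Mat p} (hA : A.PosSemidef) :
    p * ‖A.det‖ ^ (1 / (p : ℝ)) ≤ A.trace.re := by
  rw [norm_det_eq_prod_eigenvalues hA, trace_re_eq_sum_eigenvalues hA.1]
  exact card_mul_prod_rpow_le_sum hp hA.eigenvalues_nonneg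

theorem card_mul_sq_rpow_le_trace (hp : 0 < p) {A : Mat p} (hA : A.PosSemidef) :
    p * (‖A.det‖ ^ (1 / (2 * p : ℝ))) ^ 2 ≤ A.trace.re := by
  refine le_trans (le_of_eq ?_) (card_mul_det_rpow_le_trace hp hA)
  rw [← Real.rpow_natCast, ← Real.rpow_mul (norm_nonneg _)]
  congr 2
  push_cast
  field_simp

theorem card_mul_det_rpow_le_sum_sqrt (hp : 0 < p) {A : Mat p} (hA : A.PosSemidef) :
    p * ‖A.det‖ ^ (1 / (2 * p : ℝ)) ≤ ∑ i, √(hA.1.eigenvalues i) := by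
  refine le_trans (le_of_eq ?_) (card_mul_prod_rpow_le_sum hp fun i => Real.sqrt_nonneg _)
  rw [← Real.sqrt_prod _ fun i _ => hA.eigenvalues_nonneg i, ← norm_det_eq_prod_eigenvalues hA,
    Real.sqrt_eq_rpow, ← Real.rpow_mul (norm_nonneg _)]
  congr 2
  field_simp

/-- With `s = |√x - 1|` one has `|x - 1| ≤ s² + 2s`, and Young's inequality `2s ≤ s²/η + η` trades
the linear term for a square and a small constant. -/
theorem abs_sub_one_le {η x : ℝ} (hη : 0 < η) (hx : 0 ≤ x) :
    |x - 1| ≤ (1 + 1 / η) * (√x - 1) ^ 2 + η := by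
  set s := |√x - 1| with hs
  have hx2 : x - 1 = (√x - 1) * (√x - 1) + 2 * (√x - 1) := by
    nlinarith [Real.sq_sqrt hx]
  have h1 : |x - 1| ≤ s ^ 2 + 2 * s := by
    rw [hx2]
    refine (abs_add_le _ _).trans_eq ?_
    rw [abs_mul, abs_mul, abs_two, hs]
    ring
  have h2 : 2 * s ≤ 1 / η * s ^ 2 + η := by
    have : 1 / η * s ^ 2 + η - 2 * s = 1 / η * (s - η) ^ 2 := by
      field_simp
      ring
    have := mul_nonneg (one_div_nonneg.2 hη.le) (sq_nonneg (s - η))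
    linarith
  rw [← sq_abs (√x - 1), ← hs]
  linarith

/-- A positive semidefinite matrix whose trace is not much larger than a suitable power of its
determinant is close to the identity. -/
theorem norm_sub_one_apply_le (hp : 0 < p) {A : Mat p} (hA : A.PosSemidef) {η : ℝ} (hη : 0 < η)
    (k j : Fin p) :
    ‖(A - 1) k j‖
      ≤ (1 + 1 / η) * (A.trace.re - 2 * p * ‖A.det‖ ^ (1 / (2 * p : ℝ)) + p) + η * p := by
  have h1 := norm_sub_smul_one_apply_le hA.1 1 k j
  rw [Complex.ofReal_one, one_smul] at h1
  have h2 : ∑ i, |hA.1.eigenvalues i - 1|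
      ≤ ∑ i, ((1 + 1 / η) * (√(hA.1.eigenvalues i) - 1) ^ 2 + η) :=
    Finset.sum_le_sum fun i _ => abs_sub_one_le hη (hA.eigenvalues_nonneg i)
  -- The square expands into the trace and the sum of the roots of the eigenvalues; the mean
  -- inequality bounds that sum below by the determinant.
  have h3 : ∑ i, (√(hA.1.eigenvalues i) - 1) ^ 2
      = A.trace.re - 2 * ∑ i, √(hA.1.eigenvalues i) + p := by
    rw [trace_re_eq_sum_eigenvalues hA.1, Finset.mul_sum, ← Finset.sum_sub_distrib]
    have : (p : ℝ) = ∑ _i : Fin p, (1 : ℝ) := by simp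
    rw [this, ← Finset.sum_add_distrib]
    refine Finset.sum_congr rfl fun i _ => ?_
    nlinarith [Real.sq_sqrt (hA.eigenvalues_nonneg i)]
  have h4 := card_mul_det_rpow_le_sum_sqrt hp hA
  rw [Finset.sum_add_distrib, ← Finset.mul_sum, h3] at h2
  simp only [Finset.sum_const, Finset.card_univ, Fintype.card_fin, nsmul_eq_mul] at h2
  refine h1.trans (h2.trans ?_)
  have h5 : 0 ≤ 1 + 1 / η := by positivity
  have h6 := mul_le_mul_of_nonneg_left h4 h5
  nlinarith

theorem card_mul_det_rpow_le_trace_mul_conjTranspose (hp : 0 < p) (T : Mat p) :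
    p * ‖T.det‖ ^ (2 / (p : ℝ)) ≤ (T * Tᴴ).trace.re := by
  refine le_trans (le_of_eq ?_)
    (card_mul_det_rpow_le_trace hp (Matrix.posSemidef_self_mul_conjTranspose T))
  rw [Matrix.det_mul, Matrix.det_conjTranspose, norm_mul, norm_star, ← sq, ← Real.rpow_natCast,
    ← Real.rpow_mul (norm_nonneg _)]
  congr 2
  push_cast
  ring

/-- The mean inequality with weights `2/3` and `1/3`. It will be applied with `x = det F` and `y =
|det (S ψₙ⁻¹)|`, for which `x y² = det M |det S|²` no longer involves `ψₙ`. -/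
theorem three_mul_rpow_le (hp : 0 < p) {x y : ℝ} (hx : 0 ≤ x) (hy : 0 ≤ y) :
    3 * (x * y ^ 2) ^ (1 / (3 * p : ℝ)) ≤ 2 * x ^ (1 / (2 * p : ℝ)) + y ^ (2 / (p : ℝ)) := by
  have h := Real.geom_mean_le_arith_mean2_weighted (w₁ := 2 / 3) (w₂ := 1 / 3) (by norm_num)
    (by norm_num) (Real.rpow_nonneg hx (1 / (2 * p : ℝ))) (Real.rpow_nonneg hy (2 / (p : ℝ)))
    (by norm_num)
  have hp' : (p : ℝ) ≠ 0 := by exact_mod_cast hp.ne'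
  have h2 : (x * y ^ 2) ^ (1 / (3 * p : ℝ))
      = (x ^ (1 / (2 * p : ℝ))) ^ (2 / 3 : ℝ) * (y ^ (2 / (p : ℝ))) ^ (1 / 3 : ℝ) := by
    rw [Real.mul_rpow hx (by positivity), ← Real.rpow_natCast, ← Real.rpow_mul hx,
      ← Real.rpow_mul hy, ← Real.rpow_mul hy]
    congr 2 <;> · push_cast; field_simp
  rw [h2]
  linarith

/-- The hypothesis makes `f * g⁻¹` unitary. -/
theorem norm_mul_inv_apply_le_one {f g : Mat p} (hg : IsUnit g) (h : fᴴ * f = gᴴ * g)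
    (k j : Fin p) : ‖(f * g⁻¹) k j‖ ≤ 1 := by
  refine norm_apply_le_one_of_mul_conjTranspose (A := 0) ?_ k j
  have hd := (Matrix.isUnit_iff_isUnit_det g).1 hg
  have hd' := (Matrix.isUnit_iff_isUnit_det _).1 ((Matrix.isUnit_conjTranspose g).2 hg)
  rw [zero_mul, sub_zero]
  refine mul_eq_one_comm.1 ?_
  rw [Matrix.conjTranspose_mul, mul_assoc, ← mul_assoc fᴴ, h, Matrix.conjTranspose_nonsing_inv,
    mul_assoc, Matrix.mul_nonsing_inv _ hd, mul_one, Matrix.nonsing_inv_mul _ hd']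

/-! ### The entropy functional and its bounded near-maximizers. -/

theorem aestronglyMeasurable_of_entries {μ : Measure Torus} {F : Torus → Mat p}
    (hF : ∀ i j, AEStronglyMeasurable (fun θ => F θ i j) μ) : AEStronglyMeasurable F μ := by
  have h : AEMeasurable (β := Fin p → Fin p → ℂ) F μ :=
    aemeasurable_pi_iff.2 fun i => aemeasurable_pi_iff.2 fun j => (hF i j).aemeasurable
  exact h.aestronglyMeasurable

theorem MatIntegrable.aestronglyMeasurable {μ : Measure Torus} {F : Torus → Mat p}
    (hF : MatIntegrable μ F) : AEStronglyMeasurable F μ :=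
  aestronglyMeasurable_of_entries fun i j => (hF i j).1

/-- The integrand of the entropy functional `S ↦ 3p ∫ (det M |det S|²)^(1/3p) - tr ∫ S M S^*`, with
the determinant taken off the set `N`. -/
def entropyIntegrand (N : Set Torus) (M : Torus → Mat p) (S : Mat p) (θ : Torus) : ℝ :=
  Nᶜ.indicator (fun θ => 3 * p * (‖(M θ).det‖ * ‖S.det‖ ^ 2) ^ (1 / (3 * p : ℝ))) θ
    - (S * M θ * Sᴴ).trace.re

theorem norm_det_le {S : Mat p} {C : ℝ} (hS : ∀ i j, ‖S i j‖ ≤ C) :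
    ‖S.det‖ ≤ p.factorial * C ^ p := by
  have := Matrix.det_le (A := S) (abv := IsAbsoluteValue.toAbsoluteValue (norm : ℂ → ℝ)) hS
  simpa [nsmul_eq_mul] using this

theorem rpow_det_le_one_add_trace (hp : 0 < p) {A : Mat p} (hA : A.PosSemidef) :
    ‖A.det‖ ^ (1 / (3 * p : ℝ)) ≤ 1 + A.trace.re := by
  have h := card_mul_det_rpow_le_trace hp hA
  have h1 : (1 : ℝ) ≤ p := by exact_mod_cast hp
  have h0 : 0 ≤ ‖A.det‖ ^ (1 / (p : ℝ)) := by positivity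
  have h2 : ‖A.det‖ ^ (1 / (p : ℝ)) ≤ A.trace.re := le_trans (by nlinarith) h
  rcases le_total ‖A.det‖ 1 with hd | hd
  · have := Real.rpow_le_one (norm_nonneg A.det) hd (by positivity : 0 ≤ 1 / (3 * p : ℝ))
    linarith [trace_re_nonneg hA]
  · have := Real.rpow_le_rpow_of_exponent_le hd
      (one_div_le_one_div_of_le (by linarith) (by linarith) : 1 / (3 * p : ℝ) ≤ 1 / (p : ℝ))
    linarith

theorem norm_mul_mul_conjTranspose_apply_le {S A : Mat p} {C : ℝ} (hS : ∀ i j, ‖S i j‖ ≤ C)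
    (hA : A.PosSemidef) (i j : Fin p) :
    ‖(S * A * Sᴴ) i j‖ ≤ p * (p * (C * A.trace.re * C)) := by
  have hC : 0 ≤ C := (norm_nonneg _).trans (hS i i)
  have ht := trace_re_nonneg hA
  rw [Matrix.mul_apply]
  refine (norm_sum_le_of_le _ (f := fun k => (S * A) i k * Sᴴ k j)
    (n := fun _ => p * (C * A.trace.re * C)) fun k _ => ?_).trans_eq (by simp)
  rw [Matrix.mul_apply, Finset.sum_mul]
  refine (norm_sum_le_of_le _ (n := fun _ => C * A.trace.re * C) fun l _ => ?_).trans_eq (by simp)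
  rw [norm_mul, norm_mul, Matrix.conjTranspose_apply, norm_star]
  gcongr
  · exact hS i l
  · exact norm_apply_le_trace hA l k
  · exact hS j k

/-- The constant depends only on `p` and `C`, so `K (1 + tr M)` dominates the integrands of any
uniformly bounded family of `S`. -/
theorem exists_entropyIntegrand_bound (hp : 0 < p) (C : ℝ) :
    ∃ K : ℝ, ∀ (N : Set Torus) (M : Torus → Mat p) (S : Mat p) (θ : Torus),
      (M θ).PosSemidef → (∀ i j, ‖S i j‖ ≤ C) →
        ‖entropyIntegrand N M S θ‖ ≤ K * (1 + (M θ).trace.re) := by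
  set D : ℝ := ((p.factorial * C ^ p) ^ 2) ^ (1 / (3 * p : ℝ)) with hD
  refine ⟨3 * p * D + p * (p * (p * (C * C))), fun N M S θ hM hS => ?_⟩
  have hC : 0 ≤ C := (norm_nonneg _).trans (hS ⟨0, hp⟩ ⟨0, hp⟩)
  have ht := trace_re_nonneg hM
  have h1 : (‖(M θ).det‖ * ‖S.det‖ ^ 2) ^ (1 / (3 * p : ℝ)) ≤ (1 + (M θ).trace.re) * D := by
    rw [Real.mul_rpow (norm_nonneg _) (by positivity)]
    exact mul_le_mul (rpow_det_le_one_add_trace hp hM)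
      (Real.rpow_le_rpow (by positivity) (pow_le_pow_left₀ (norm_nonneg _) (norm_det_le hS) 2)
        (by positivity)) (by positivity) (by positivity)
  have h2 : |(S * M θ * Sᴴ).trace.re| ≤ p * (p * (p * (C * (M θ).trace.re * C))) := by
    refine (Complex.abs_re_le_norm _).trans ((norm_sum_le_of_le _ (n := fun _ =>
      (p * (p * (C * (M θ).trace.re * C)) : ℝ)) fun i _ => ?_).trans_eq (by simp))
    exact norm_mul_mul_conjTranspose_apply_le hS hM i i
  have h3 : ‖Nᶜ.indicator (fun θ => 3 * p * (‖(M θ).det‖ * ‖S.det‖ ^ 2) ^ (1 / (3 * p : ℝ))) θ‖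
      ≤ 3 * p * ((1 + (M θ).trace.re) * D) := by
    refine (norm_indicator_le_norm_self _ _).trans ?_
    rw [Real.norm_of_nonneg (by positivity)]
    gcongr
  refine (norm_sub_le _ _).trans ((add_le_add h3 h2).trans ?_)
  have : 0 ≤ (p : ℝ) * (p * (p * (C * C))) := by positivity
  nlinarith

theorem continuous_entropyIntegrand (N : Set Torus) (M : Torus → Mat p) (θ : Torus) :
    Continuous fun S => entropyIntegrand N M S θ := by
  unfold entropyIntegrand
  refine .sub ?_ (by fun_prop)
  by_cases h : θ ∈ Nᶜ
  · simp only [Set.indicator_of_mem h]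
    refine continuous_const.mul (Continuous.rpow_const (by fun_prop) fun _ => Or.inr (by positivity))
  · simp only [Set.indicator_of_notMem h]
    fun_prop

theorem aestronglyMeasurable_entropyIntegrand {μ : Measure Torus} {N : Set Torus}
    (hN : MeasurableSet N) {M S : Torus → Mat p} (hM : AEStronglyMeasurable M μ)
    (hS : AEStronglyMeasurable S μ) :
    AEStronglyMeasurable (fun θ => entropyIntegrand N M (S θ) θ) μ := by
  have h := hM.prodMk hS
  have h1 : Continuous fun q : Mat p × Mat p =>
      3 * p * (‖q.1.det‖ * ‖q.2.det‖ ^ 2) ^ (1 / (3 * p : ℝ)) :=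
    continuous_const.mul (Continuous.rpow_const (by fun_prop) fun _ => Or.inr (by positivity))
  have h2 : Continuous fun q : Mat p × Mat p => (q.2 * q.1 * q.2ᴴ).trace.re := by fun_prop
  have h3 := (h1.comp_aestronglyMeasurable h).indicator hN.compl
  have h4 := h2.comp_aestronglyMeasurable h
  refine (h3.sub h4).congr (Eventually.of_forall fun θ => ?_)
  rfl

section

variable {μ : Measure Torus} {N : Set Torus} {M : Torus → Mat p}

theorem IsDensity.aestronglyMeasurable_entropy (hd : IsDensity μ N M) {S : Torus → Mat p}
    (hS : AEStronglyMeasurable S μ) :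
    AEStronglyMeasurable (fun θ => entropyIntegrand N M (S θ) θ) μ :=
  aestronglyMeasurable_entropyIntegrand hd.measurableSet hd.integrable.aestronglyMeasurable hS

theorem IsDensity.integrable_trace (hd : IsDensity μ N M) :
    Integrable (fun θ => (M θ).trace.re) μ := hd.integrable.trace.re

theorem IsDensity.integrable_entropy (hd : IsDensity μ N M) (hp : 0 < p) {S : Torus → Mat p}
    (hS : AEStronglyMeasurable S μ) {C : ℝ} (hC : ∀ θ i j, ‖S θ i j‖ ≤ C) :
    Integrable (fun θ => entropyIntegrand N M (S θ) θ) μ := by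
  have := hd.finite
  obtain ⟨K, hK⟩ := exists_entropyIntegrand_bound hp C
  exact Integrable.mono' (((integrable_const 1).add hd.integrable_trace).const_mul K)
    (hd.aestronglyMeasurable_entropy hS)
    (Eventually.of_forall fun θ => hK N M _ θ (hd.posSemidef θ) (hC θ))

theorem IsDensity.tendsto_entropy (hd : IsDensity μ N M) (hp : 0 < p) {S : ℕ → Torus → Mat p}
    {T : Torus → Mat p} (hS : ∀ n, AEStronglyMeasurable (S n) μ) {C : ℝ}
    (hC : ∀ n θ i j, ‖S n θ i j‖ ≤ C)
    (hlim : ∀ᵐ θ ∂μ, Tendsto (fun n => S n θ) atTop (𝓝 (T θ))) :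
    Tendsto (fun n => ∫ θ, entropyIntegrand N M (S n θ) θ ∂μ) atTop
      (𝓝 (∫ θ, entropyIntegrand N M (T θ) θ ∂μ)) := by
  have := hd.finite
  obtain ⟨K, hK⟩ := exists_entropyIntegrand_bound hp C
  exact tendsto_integral_of_dominated_convergence _
    (fun n => hd.aestronglyMeasurable_entropy (hS n))
    (((integrable_const 1).add hd.integrable_trace).const_mul K)
    (fun n => Eventually.of_forall fun θ => hK N M _ θ (hd.posSemidef θ) (hC n θ))
    (hlim.mono fun θ h => ((continuous_entropyIntegrand N M θ).tendsto _).comp h)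

theorem entropyIntegrand_zero (hp : 0 < p) (N : Set Torus) (M : Torus → Mat p) (θ : Torus) :
    entropyIntegrand N M 0 θ = 0 := by
  have hp' : (p : ℝ) ≠ 0 := by exact_mod_cast hp.ne'
  have : Nonempty (Fin p) := ⟨⟨0, hp⟩⟩
  rw [entropyIntegrand, Matrix.det_zero]
  have h : (0 : ℝ) ^ (1 / (3 * p : ℝ)) = 0 := Real.zero_rpow (by positivity)
  simp only [norm_zero, ne_eq, OfNat.ofNat_ne_zero, not_false_eq_true, zero_pow, mul_zero, h,
    Set.indicator_zero, zero_mul, Matrix.trace_zero, Complex.zero_re, sub_zero]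

theorem entropyIntegrand_of_eq_one {θ : Torus} (hθ : θ ∉ N) {S : Mat p}
    (h : S * M θ * Sᴴ = 1) : entropyIntegrand N M S θ = 2 * p := by
  have hdet : ‖(M θ).det‖ * ‖S.det‖ ^ 2 = 1 := by
    have := congrArg (fun A => ‖Matrix.det A‖) h
    simp only [Matrix.det_mul, Matrix.det_conjTranspose, norm_mul, norm_star, Matrix.det_one,
      norm_one] at this
    rw [← this]
    ring
  rw [entropyIntegrand, Set.indicator_of_mem (by exact hθ), hdet, h, Real.one_rpow]
  simp
  ring

/-- A bounded measurable near-maximizer of the entropy functional. -/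
theorem IsDensity.exists_measurable_entropy (hd : IsDensity μ N M) (hp : 0 < p) {ε : ℝ}
    (hε : 0 < ε) :
    ∃ (S : Torus → Mat p) (C : ℝ), AEStronglyMeasurable S μ ∧ (∀ θ i j, ‖S θ i j‖ ≤ C) ∧
      2 * p - ε < ∫ θ, entropyIntegrand N M (S θ) θ ∂μ := by
  classical
  have := hd.finite
  have hprob : leb (Nᶜ) = 1 := by
    have h : leb Set.univ = leb (Nᶜ) := by
      rw [hd.leb_eq, Measure.restrict_apply MeasurableSet.univ, Set.univ_inter,
        Measure.restrict_apply hd.measurableSet.compl, Set.inter_self]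
    rw [← h, measure_univ]
  -- Selecting among countably many constant matrices avoids choosing `M^(-1/2)` measurably.
  set D : ℕ → Mat p := TopologicalSpace.denseSeq (Fin p → Fin p → ℂ) with hD
  have hDd : DenseRange D := TopologicalSpace.denseRange_denseSeq (Fin p → Fin p → ℂ)
  have hm : ∀ k, AEStronglyMeasurable (fun θ => entropyIntegrand N M (D k) θ) μ := fun k =>
    hd.aestronglyMeasurable_entropy aestronglyMeasurable_const
  -- `E k` consists of the points off `N` where the constant `D k` is nearly optimal. Points of `N`
  -- are left out because the integrand cannot be positive there; the candidate keeps its default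
  -- value `0` on them.
  set E : ℕ → Set Torus := fun k => {θ | θ ∉ N ∧ 2 * p - ε / 2 < (hm k).mk _ θ} with hE
  have hEm : ∀ k, MeasurableSet (E k) := fun k => hd.measurableSet.compl.inter
    (measurableSet_lt measurable_const (hm k).stronglyMeasurable_mk.measurable)
  set T : ℕ → Torus → Mat p := fun n => n.rec (fun _ => 0)
    fun k Tk θ => if θ ∈ E k then D k else Tk θ with hT
  have hT0 : ∀ θ, T 0 θ = 0 := fun _ => rfl
  have hTs : ∀ k θ, T (k + 1) θ = if θ ∈ E k then D k else T k θ := fun _ _ => rfl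
  have hTm : ∀ n, AEStronglyMeasurable (T n) μ := by
    intro n
    induction n with
    | zero => exact aestronglyMeasurable_const
    | succ k ih =>
      exact (aestronglyMeasurable_const.piecewise (s := E k) (hEm k) (ih.restrict) :)
  have hTb : ∀ n, ∃ C, ∀ θ i j, ‖T n θ i j‖ ≤ C := by
    intro n
    induction n with
    | zero => exact ⟨0, fun θ i j => by simp [hT0]⟩
    | succ k ih =>
      obtain ⟨C, hC⟩ := ih
      refine ⟨C + ∑ i, ∑ j, ‖D k i j‖, fun θ i j => ?_⟩
      have h1 : ‖D k i j‖ ≤ ∑ i, ∑ j, ‖D k i j‖ :=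
        (Finset.single_le_sum (f := fun j => ‖D k i j‖) (fun _ _ => norm_nonneg _)
          (Finset.mem_univ j)).trans (Finset.single_le_sum (f := fun i => ∑ j, ‖D k i j‖)
            (fun _ _ => Finset.sum_nonneg fun _ _ => norm_nonneg _) (Finset.mem_univ i))
      have h2 : 0 ≤ C := (norm_nonneg _).trans (hC θ i j)
      rw [hTs]
      split_ifs
      · linarith
      · linarith [hC θ i j, norm_nonneg (D k i j)]
  have hmk : ∀ᵐ θ ∂μ, ∀ k, entropyIntegrand N M (D k) θ = (hm k).mk _ θ :=
    ae_all_iff.2 fun k => (hm k).ae_eq_mk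
  set F : ℕ → Set Torus := fun n => ⋃ k < n, E k with hF
  have hFm : ∀ n, MeasurableSet (F n) := fun n =>
    MeasurableSet.iUnion fun k => MeasurableSet.iUnion fun _ => hEm k
  have hlow : ∀ᵐ θ ∂μ, ∀ n, (F n).indicator (fun _ => 2 * p - ε / 2) θ
      ≤ entropyIntegrand N M (T n θ) θ := by
    filter_upwards [hmk] with θ hθ n
    induction n with
    | zero => simp [hF, hT0, entropyIntegrand_zero hp]
    | succ k ih =>
      rw [hTs]
      by_cases h : θ ∈ E k
      · rw [if_pos h, hθ k, Set.indicator_of_mem]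
        · exact h.2.le
        · exact Set.mem_biUnion (Nat.lt_succ_self k) h
      · rw [if_neg h]
        refine le_trans (le_of_eq ?_) ih
        have : θ ∈ F (k + 1) ↔ θ ∈ F k := by
          simp only [hF, Set.mem_iUnion, exists_prop, Nat.lt_succ_iff_lt_or_eq]
          constructor
          · rintro ⟨i, hi | rfl, hi'⟩
            · exact ⟨i, hi, hi'⟩
            · exact absurd hi' h
          · rintro ⟨i, hi, hi'⟩
            exact ⟨i, Or.inl hi, hi'⟩
        simp only [Set.indicator, this]
  have hcover : leb (⋃ n, F n) = 1 := by
    have hac : ∀ᵐ θ ∂leb, ∀ k, entropyIntegrand N M (D k) θ = (hm k).mk _ θ := by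
      rw [hd.leb_eq]
      exact ae_restrict_of_ae hmk
    have hNae : ∀ᵐ θ ∂leb, θ ∉ N := by
      rw [hd.leb_eq]
      exact ae_restrict_mem hd.measurableSet.compl
    refine (mem_ae_iff_prob_eq_one (MeasurableSet.iUnion hFm)).1 ?_
    filter_upwards [hac, hNae, hd.posDef] with θ h1 h2 h3
    obtain ⟨S, hS⟩ := exists_mul_mul_conjTranspose_eq_one h3
    have hval := entropyIntegrand_of_eq_one h2 hS
    obtain ⟨k, hk⟩ := hDd.exists_mem_open
      (isOpen_lt continuous_const (continuous_entropyIntegrand N M θ) :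
        IsOpen {S | 2 * p - ε / 2 < entropyIntegrand N M S θ}) ⟨S, by
          rw [Set.mem_ofPred_eq, hval]; linarith⟩
    refine Set.mem_iUnion.2 ⟨k + 1, Set.mem_biUnion (Nat.lt_succ_self k) ⟨h2, ?_⟩⟩
    rw [← h1 k]
    exact hk
  have hmono : Monotone F := fun a b hab =>
    Set.biUnion_subset_biUnion_left fun k hk => lt_of_lt_of_le hk hab
  have hμF : ∀ n, μ.real (F n) = leb.real (F n) := by
    intro n
    have hsub : F n ⊆ Nᶜ := Set.iUnion₂_subset fun k _ θ hθ => hθ.1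
    rw [measureReal_def, measureReal_def, hd.leb_eq, Measure.restrict_apply (hFm n),
      Set.inter_eq_left.2 hsub]
  have hlim : Tendsto (fun n => (2 * p - ε / 2) * μ.real (F n)) atTop
      (𝓝 ((2 * p - ε / 2) * 1)) := by
    refine Tendsto.const_mul _ ?_
    simp only [hμF]
    have h := tendsto_measure_iUnion_atTop (μ := leb) hmono
    rw [hcover] at h
    exact (ENNReal.tendsto_toReal ENNReal.one_ne_top).comp h
  obtain ⟨n, hn⟩ := (hlim.eventually (lt_mem_nhds
    (by linarith : 2 * p - ε < (2 * p - ε / 2) * 1))).exists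
  obtain ⟨C, hC⟩ := hTb n
  refine ⟨T n, C, hTm n, hC, hn.trans_le ?_⟩
  calc (2 * p - ε / 2) * μ.real (F n)
      = ∫ θ, (F n).indicator (fun _ => 2 * p - ε / 2) θ ∂μ := by
        rw [integral_indicator_const _ (hFm n), smul_eq_mul, mul_comm]
    _ ≤ _ := integral_mono_ae ((integrable_const _).indicator (hFm n))
        (hd.integrable_entropy hp (hTm n) hC) (hlow.mono fun θ h => h n)

end

/-! ### Passage from measurable to polynomial near-maximizers. -/

/-- A matrix function on the circle that is a trigonometric polynomial. -/
def IsTrigPolynomial (R : Torus → Mat p) : Prop :=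
  ∃ (m : ℕ) (S : (Mat p)[X]), ∀ θ, zOf θ ^ m • R θ = evalMat S (zOf θ)

theorem IsTrigPolynomial.add {R T : Torus → Mat p} (hR : IsTrigPolynomial R)
    (hT : IsTrigPolynomial T) : IsTrigPolynomial fun θ => R θ + T θ := by
  obtain ⟨m, S, hS⟩ := hR
  obtain ⟨n, U, hU⟩ := hT
  refine ⟨m + n, X ^ n * S + X ^ m * U, fun θ => ?_⟩
  rw [evalMat_add, evalMat_X_pow_mul, evalMat_X_pow_mul, ← hS, ← hU, smul_add, smul_smul,
    smul_smul, pow_add, mul_comm (zOf θ ^ n)]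

theorem isTrigPolynomial_zero : IsTrigPolynomial fun _ => (0 : Mat p) := ⟨0, 0, fun θ => by simp⟩

theorem IsTrigPolynomial.sum {ι : Type*} (s : Finset ι) {R : ι → Torus → Mat p}
    (h : ∀ i ∈ s, IsTrigPolynomial (R i)) : IsTrigPolynomial fun θ => ∑ i ∈ s, R i θ := by
  classical
  induction s using Finset.induction_on with
  | empty => simpa using isTrigPolynomial_zero
  | insert a s ha ih =>
    simp only [Finset.sum_insert ha]
    exact (h a (Finset.mem_insert_self _ _)).add
      (ih fun i hi => h i (Finset.mem_insert_of_mem hi))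

theorem isTrigPolynomial_of_mem_span {r : C(Torus, ℂ)}
    (hr : r ∈ Submodule.span ℂ (Set.range (@fourier (2 * Real.pi)))) (A : Mat p) :
    IsTrigPolynomial fun θ => r θ • A := by
  induction hr using Submodule.span_induction with
  | mem x h =>
    obtain ⟨n, rfl⟩ := h
    -- The factor `z^|n|` makes the exponent `|n| + n` nonnegative.
    refine ⟨n.natAbs, X ^ (n.natAbs + n).toNat * C A, fun θ => ?_⟩
    have h : (((n.natAbs + n).toNat : ℕ) : ℤ) = n.natAbs + n := Int.toNat_of_nonneg (by omega)
    rw [evalMat_X_pow_mul, evalMat_C, smul_smul, fourier_apply, AddCircle.toCircle_zsmul,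
      Circle.coe_zpow, ← zpow_natCast (zOf θ) (n.natAbs + n).toNat, h,
      zpow_add₀ (zOf_ne_zero θ), zpow_natCast]
    rfl
  | zero => simpa using isTrigPolynomial_zero
  | add x y _ _ hx hy => simpa only [ContinuousMap.add_apply, add_smul] using hx.add hy
  | smul a x _ hx =>
    obtain ⟨m, S, hS⟩ := hx
    refine ⟨m, C (a • 1) * S, fun θ => ?_⟩
    change zOf θ ^ m • (a • x) θ • A = _
    rw [evalMat_C_mul, ← hS, ContinuousMap.smul_apply, smul_mul_assoc, one_mul, smul_eq_mul]
    simp only [smul_smul]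
    congr 1
    ring

theorem exists_isTrigPolynomial_near {T : Torus → Mat p} (hT : Continuous T) {δ : ℝ} (hδ : 0 < δ) :
    ∃ R, IsTrigPolynomial R ∧ ∀ θ i j, ‖R θ i j - T θ i j‖ ≤ δ := by
  have h : ∀ i j, ∃ r ∈ Submodule.span ℂ (Set.range (@fourier (2 * Real.pi))),
      ∀ θ, ‖r θ - T θ i j‖ ≤ δ := by
    intro i j
    set f : C(Torus, ℂ) := ⟨fun θ => T θ i j, hT.matrix_elem i j⟩
    have hf : f ∈ (Submodule.span ℂ (Set.range (@fourier (2 * Real.pi)))).topologicalClosure := by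
      rw [span_fourier_closure_eq_top]
      trivial
    obtain ⟨r, hr, hd⟩ := Metric.mem_closure_iff.1 hf δ hδ
    refine ⟨r, hr, fun θ => ?_⟩
    rw [← dist_eq_norm, dist_comm]
    exact (ContinuousMap.dist_apply_le_dist (f := f) (g := r) θ).trans hd.le
  choose r hr hd using h
  refine ⟨fun θ => ∑ i, ∑ j, r i j θ • Matrix.single i j 1,
    .sum _ fun i _ => .sum _ fun j _ => isTrigPolynomial_of_mem_span (hr i j) _, fun θ i j => ?_⟩
  have : (∑ i, ∑ j, r i j θ • Matrix.single i j (1 : ℂ)) i j = r i j θ := by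
    have := Matrix.matrix_eq_sum_single (Matrix.of fun i j => r i j θ)
    simp only [Matrix.smul_single, smul_eq_mul, mul_one]
    conv_rhs => rw [← Matrix.of_apply (fun i j => r i j θ) i j, this]
    rfl
  refine (congrArg (fun w => ‖w - T θ i j‖) this).trans_le (hd i j θ)

/-- A trigonometric polynomial differs from a polynomial by a power of `z`, which on the circle is a
unimodular scalar and does not affect the functional. -/
theorem entropyIntegrand_smul {N : Set Torus} {M : Torus → Mat p} {c : ℂ} (hc : ‖c‖ = 1) (S : Mat p)
    (θ : Torus) : entropyIntegrand N M (c • S) θ = entropyIntegrand N M S θ := by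
  have h1 : star c * c = 1 := by
    rw [← starRingEnd_apply, mul_comm, Complex.mul_conj, Complex.normSq_eq_norm_sq, hc]
    simp
  rw [entropyIntegrand, entropyIntegrand, Matrix.det_smul, norm_mul, norm_pow, hc, one_pow, one_mul,
    Matrix.conjTranspose_smul, smul_mul_assoc, smul_mul_assoc, mul_smul_comm, smul_smul,
    mul_comm c, h1, one_smul]

/-- Radial truncation onto the ball of radius `C` restores the uniform bound that approximation in
mean does not provide, and it fixes the limit. -/
theorem continuous_truncation {E : Type*} [NormedAddCommGroup E] [NormedSpace ℝ E] {C : ℝ}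
    (hC : 0 < C) : Continuous fun x : E => (C / max C ‖x‖) • x := by
  refine Continuous.smul (continuous_const.div (by fun_prop) fun x => ?_) continuous_id
  exact (lt_max_of_lt_left hC).ne'

theorem norm_truncation_le {E : Type*} [NormedAddCommGroup E] [NormedSpace ℝ E] {C : ℝ}
    (hC : 0 < C) (x : E) : ‖(C / max C ‖x‖) • x‖ ≤ C := by
  have h : 0 < max C ‖x‖ := lt_max_of_lt_left hC
  rw [norm_smul, Real.norm_of_nonneg (by positivity), div_mul_eq_mul_div, div_le_iff₀ h]
  exact mul_le_mul_of_nonneg_left (le_max_right _ _) hC.le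

theorem truncation_eq {E : Type*} [NormedAddCommGroup E] [NormedSpace ℝ E] {C : ℝ}
    (hC : 0 < C) {x : E} (hx : ‖x‖ ≤ C) : (C / max C ‖x‖) • x = x := by
  rw [max_eq_left hx, div_self hC.ne', one_smul]

/-- A bounded measurable function is the limit almost everywhere of continuous functions with a
common bound. -/
theorem exists_continuous_seq_tendsto_ae {E : Type*} [NormedAddCommGroup E] [NormedSpace ℝ E]
    {μ : Measure Torus} [IsFiniteMeasure μ] {T : Torus → E} (hT : AEStronglyMeasurable T μ) {C : ℝ}
    (hC : 0 < C) (hTC : ∀ θ, ‖T θ‖ ≤ C) :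
    ∃ g : ℕ → Torus → E, (∀ n, Continuous (g n)) ∧ (∀ n θ, ‖g n θ‖ ≤ C) ∧
      ∀ᵐ θ ∂μ, Tendsto (fun n => g n θ) atTop (𝓝 (T θ)) := by
  have hmem : MemLp T 1 μ := MemLp.of_bound hT C (Eventually.of_forall hTC)
  have h : ∀ n : ℕ, ∃ g : BoundedContinuousFunction Torus E,
      eLpNorm (T - (g : Torus → E)) 1 μ ≤ ((n : ENNReal) + 1)⁻¹ ∧ MemLp g 1 μ := fun n =>
    hmem.exists_boundedContinuous_eLpNorm_sub_le ENNReal.one_ne_top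
      (ENNReal.inv_ne_zero.2 (by finiteness))
  choose g hg hgm using h
  have hlim : Tendsto (fun n => eLpNorm ((g n : Torus → E) - T) 1 μ) atTop (𝓝 0) := by
    refine tendsto_of_tendsto_of_tendsto_of_le_of_le tendsto_const_nhds
      (h := fun n : ℕ => ((n : ENNReal) + 1)⁻¹) ?_ (fun n => zero_le) fun n => ?_
    · have := (tendsto_add_atTop_iff_nat 1).2 ENNReal.tendsto_inv_nat_nhds_zero
      simpa using this
    · rw [eLpNorm_sub_comm]
      exact hg n
  obtain ⟨ns, -, hns⟩ := (tendstoInMeasure_of_tendsto_eLpNorm one_ne_zero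
    (fun n => (hgm n).1) hT hlim).exists_seq_tendsto_ae
  refine ⟨fun n θ => (C / max C ‖g (ns n) θ‖) • g (ns n) θ,
    fun n => (continuous_truncation hC).comp (g (ns n)).continuous,
    fun n θ => norm_truncation_le hC _, ?_⟩
  filter_upwards [hns] with θ hθ
  have := ((continuous_truncation hC).tendsto (T θ)).comp hθ
  rwa [truncation_eq hC (hTC θ)] at this

/-- A polynomial near-maximizer of the entropy functional. -/
theorem IsDensity.exists_polynomial_entropy {μ : Measure Torus} {N : Set Torus} {M : Torus → Mat p}
    (hd : IsDensity μ N M) (hp : 0 < p) {ε : ℝ} (hε : 0 < ε) :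
    ∃ S : (Mat p)[X], 2 * p - ε < ∫ θ, entropyIntegrand N M (evalMat S (zOf θ)) θ ∂μ := by
  have := hd.finite
  obtain ⟨T, C, hT, hTC, hTε⟩ := hd.exists_measurable_entropy hp hε
  set C' : ℝ := max C 1 with hC'
  have hC0 : 0 < C' := lt_max_of_lt_right one_pos
  obtain ⟨g, hgc, hgC, hgT⟩ := exists_continuous_seq_tendsto_ae (E := Fin p → Fin p → ℂ) hT hC0
    fun θ => (pi_norm_le_iff_of_nonneg hC0.le).2 fun i => (pi_norm_le_iff_of_nonneg hC0.le).2
      fun j => (hTC θ i j).trans (le_max_left _ _)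
  have hg := fun n : ℕ => exists_isTrigPolynomial_near (T := g n) (hgc n)
    (δ := 1 / ((n : ℝ) + 1)) (by positivity)
  choose R hR hRg using hg
  choose m S hS using hR
  have hRS : ∀ n, R n = fun θ => (zOf θ ^ m n)⁻¹ • evalMat (S n) (zOf θ) := fun n => by
    funext θ
    rw [← hS, inv_smul_smul₀ (pow_ne_zero _ (zOf_ne_zero θ))]
  have hRc : ∀ n, Continuous (R n) := fun n => by
    rw [hRS]
    exact ((continuous_zOf.pow _).inv₀ fun θ => pow_ne_zero _ (zOf_ne_zero θ)).smul
      (continuous_evalMat_zOf _)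
  have hlim := hd.tendsto_entropy hp (S := R) (T := T) (C := C' + 1)
    (fun n => aestronglyMeasurable_of_entries fun i j =>
      ((hRc n).matrix_elem i j).aestronglyMeasurable) (fun n θ i j => ?_) ?_
  · obtain ⟨n, hn⟩ := (hlim.eventually (lt_mem_nhds hTε)).exists
    refine ⟨S n, hn.trans_eq (integral_congr_ae (Eventually.of_forall fun θ => ?_))⟩
    simp only [hRS]
    refine entropyIntegrand_smul ?_ _ _
    rw [norm_inv, norm_pow, norm_zOf, one_pow, inv_one]
  · have h1 : ‖g n θ i j‖ ≤ C' := (norm_le_pi_norm (g n θ i) j).trans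
      ((norm_le_pi_norm (g n θ) i).trans (hgC n θ))
    have h2 : 1 / ((n : ℝ) + 1) ≤ 1 := by
      rw [div_le_one (by positivity)]
      linarith [(Nat.cast_nonneg n : (0 : ℝ) ≤ n)]
    have h3 := norm_add_le (R n θ i j - g n θ i j) (g n θ i j)
    rw [sub_add_cancel] at h3
    linarith [hRg n θ i j]
  · filter_upwards [hgT] with θ hθ
    refine tendsto_pi_nhds.2 fun i => tendsto_pi_nhds.2 fun j => ?_
    have h1 := tendsto_pi_nhds.1 (tendsto_pi_nhds.1 hθ i) j
    have h2 : Tendsto (fun n => R n θ i j - g n θ i j) atTop (𝓝 0) :=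
      squeeze_zero_norm (fun n => hRg n θ i j) tendsto_one_div_add_atTop_nhds_zero_nat
    simpa using h2.add h1

theorem MatIntegrable.trace_re {μ : Measure Torus} {F : Torus → Mat p} (hF : MatIntegrable μ F) :
    Integrable (fun θ => (F θ).trace.re) μ := hF.trace.re

theorem trace_re_matInt {μ : Measure Torus} {F : Torus → Mat p} (hF : MatIntegrable μ F) :
    (matInt μ F).trace.re = ∫ θ, (F θ).trace.re ∂μ := by
  rw [trace_matInt hF]
  exact (integral_re hF.trace).symm

/-! ### Convergence of the scaled weight and of the recursion coefficients. -/

/-- The matrix `F = ψₙ M ψₙ^*`, which tends to the identity in mean. -/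
def scaledWeight (M : Torus → Mat p) (ψ : ℕ → (Mat p)[X]) (n : ℕ) (θ : Torus) : Mat p :=
  evalMat (ψ n) (zOf θ) * M θ * (evalMat (ψ n) (zOf θ))ᴴ

/-- A fractional power of the determinant of `scaledWeight`. -/
def scaledDet (M : Torus → Mat p) (ψ : ℕ → (Mat p)[X]) (n : ℕ) (θ : Torus) : ℝ :=
  ‖(scaledWeight M ψ n θ).det‖ ^ (1 / (2 * p : ℝ))

section

variable {μ : Measure Torus} {N : Set Torus} {M : Torus → Mat p} (hd : IsDensity μ N M)
  {φ ψ : ℕ → (Mat p)[X]}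
include hd

theorem IsDensity.restrict {F : Torus → Mat p} (hF : MatIntegrable μ F) : MatIntegrable leb F := by
  intro i j
  rw [hd.leb_eq]
  exact (hF i j).integrableOn

theorem IsDensity.posSemidef_scaledWeight (n : ℕ) (θ : Torus) :
    (scaledWeight M ψ n θ).PosSemidef := (hd.posSemidef θ).mul_mul_conjTranspose_same _

theorem IsDensity.matIntegrable_scaledWeight (n : ℕ) : MatIntegrable μ (scaledWeight M ψ n) :=
  hd.integrable.weight _ _

theorem IsDensity.integrable_scaledDet (hp : 0 < p) (n : ℕ) :
    Integrable (scaledDet M ψ n) leb := by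
  have hF := hd.restrict (hd.matIntegrable_scaledWeight (ψ := ψ) n)
  have hc : Continuous fun A : Mat p => ‖A.det‖ ^ (1 / (2 * p : ℝ)) :=
    Continuous.rpow_const (by fun_prop) fun _ => Or.inr (by positivity)
  refine Integrable.mono' ((integrable_const 1).add hF.trace_re)
    (hc.comp_aestronglyMeasurable hF.aestronglyMeasurable) (Eventually.of_forall fun θ => ?_)
  have h1 := card_mul_sq_rpow_le_trace hp (hd.posSemidef_scaledWeight (ψ := ψ) n θ)
  have h2 : (1 : ℝ) ≤ p := by exact_mod_cast hp
  have h3 : 0 ≤ scaledDet M ψ n θ := by unfold scaledDet; positivity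
  change p * scaledDet M ψ n θ ^ 2 ≤ _ at h1
  rw [Real.norm_of_nonneg h3]
  change scaledDet M ψ n θ ≤ 1 + (scaledWeight M ψ n θ).trace.re
  nlinarith [sq_nonneg (scaledDet M ψ n θ - 1), sq_nonneg (scaledDet M ψ n θ)]

variable (hS : IsSzegoPair (weightForm μ M) φ ψ) (hdef : ∀ P, weightForm μ M P P = 0 → P = 0)
include hS hdef

/-- Both integrals in the functional become Lebesgue integrals: the determinant term by definition,
the trace term because the Bernstein–Szegő weight has the same moments up to order `n`. The
inequality then holds pointwise with `T = S ψₙ⁻¹`, from `three_mul_rpow_le` and `p |det T|^(2/p) ≤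
tr T Tᴴ`. -/
theorem IsDensity.integral_entropy_le (hp : 0 < p) {n : ℕ} {S : (Mat p)[X]}
    (hSn : S.natDegree ≤ n) :
    ∫ θ, entropyIntegrand N M (evalMat S (zOf θ)) θ ∂μ ≤ 2 * p * ∫ θ, scaledDet M ψ n θ ∂leb := by
  have hB := isToeplitzForm_weightForm hd.integrable fun θ => (hd.posSemidef θ).1
  have hSc := continuous_evalMat_zOf S
  have hQ := matIntegrable_of_continuous (μ := leb) (hS.continuous_bernsteinSzego hB hdef n)
  set u : Torus → ℝ := fun θ =>
    3 * p * (‖(M θ).det‖ * ‖(evalMat S (zOf θ)).det‖ ^ 2) ^ (1 / (3 * p : ℝ)) with hu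
  have hw := (hd.integrable.weight S S).trace_re
  have hent : Integrable (fun θ => entropyIntegrand N M (evalMat S (zOf θ)) θ) μ := by
    have hb : ∀ i j, ∃ c, ∀ θ, ‖evalMat S (zOf θ) i j‖ ≤ c := exists_bound_of_continuous hSc
    choose c hc using hb
    refine hd.integrable_entropy hp
      (aestronglyMeasurable_of_entries fun i j => (hSc.matrix_elem i j).aestronglyMeasurable)
      (C := ∑ i, ∑ j, c i j) fun θ i j => (hc i j θ).trans ?_
    have h0 : ∀ i j, 0 ≤ c i j := fun i j => (norm_nonneg _).trans (hc i j θ)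
    exact (Finset.single_le_sum (f := fun j => c i j) (fun _ _ => h0 _ _)
      (Finset.mem_univ j)).trans (Finset.single_le_sum (f := fun i => ∑ j, c i j)
        (fun _ _ => Finset.sum_nonneg fun _ _ => h0 _ _) (Finset.mem_univ i))
  have hsum : ∀ θ, entropyIntegrand N M (evalMat S (zOf θ)) θ
      + (evalMat S (zOf θ) * M θ * (evalMat S (zOf θ))ᴴ).trace.re = Nᶜ.indicator u θ := fun θ =>
    sub_add_cancel _ _
  have hind : Integrable (Nᶜ.indicator u) μ :=
    (hent.add hw).congr (Eventually.of_forall hsum)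
  have hul : Integrable u leb := by
    rw [hd.leb_eq]
    exact (integrable_indicator_iff hd.measurableSet.compl).1 hind
  have e1 : ∫ θ, entropyIntegrand N M (evalMat S (zOf θ)) θ ∂μ + (weightForm μ M S S).trace.re
      = ∫ θ, u θ ∂leb := by
    have := trace_re_matInt (hd.integrable.weight S S)
    rw [weightForm, this, ← integral_add hent hw, integral_congr_ae (Eventually.of_forall hsum),
      integral_indicator hd.measurableSet.compl, hd.leb_eq]
  have hwl := (hQ.weight S S).trace_re
  have e2 : (weightForm μ M S S).trace.re = ∫ θ, (evalMat S (zOf θ) * bernsteinSzego ψ n θ *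
      (evalMat S (zOf θ))ᴴ).trace.re ∂leb := by
    rw [← hS.weightForm_eq hB hdef hSn]
    exact trace_re_matInt (hQ.weight S S)
  have hpt : ∀ θ, u θ ≤ 2 * p * scaledDet M ψ n θ + (evalMat S (zOf θ) * bernsteinSzego ψ n θ *
      (evalMat S (zOf θ))ᴴ).trace.re := by
    intro θ
    set g := evalMat (ψ n) (zOf θ) with hg
    set s := evalMat S (zOf θ) with hs
    have hgu : IsUnit g := hS.isUnit_right_zOf hB hdef n θ
    have hgd := (Matrix.isUnit_iff_isUnit_det _).1 hgu
    have hT : s * bernsteinSzego ψ n θ * sᴴ = (s * g⁻¹) * (s * g⁻¹)ᴴ := by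
      rw [bernsteinSzego, ← hg, Matrix.mul_inv_rev, Matrix.conjTranspose_mul,
        Matrix.conjTranspose_nonsing_inv]
      simp only [mul_assoc]
    rw [hT]
    have h1 := card_mul_det_rpow_le_trace_mul_conjTranspose hp (s * g⁻¹)
    have h2 := three_mul_rpow_le hp (norm_nonneg (scaledWeight M ψ n θ).det)
      (norm_nonneg (s * g⁻¹).det)
    have h3 : ‖(scaledWeight M ψ n θ).det‖ * ‖(s * g⁻¹).det‖ ^ 2 = ‖(M θ).det‖ * ‖s.det‖ ^ 2 := by
      have hg0 : ‖g.det‖ ≠ 0 := norm_ne_zero_iff.2 hgd.ne_zero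
      rw [scaledWeight, ← hg]
      simp only [Matrix.det_mul, Matrix.det_conjTranspose, norm_mul, norm_star,
        Matrix.det_nonsing_inv, Ring.inverse_eq_inv', norm_inv]
      field_simp
    rw [h3] at h2
    have hp0 : (0 : ℝ) ≤ p := Nat.cast_nonneg p
    have h4 := mul_le_mul_of_nonneg_left h2 hp0
    simp only [hu, scaledDet]
    linarith
  have hdl := hd.integrable_scaledDet (ψ := ψ) hp n
  have e3 := integral_mono hul ((hdl.const_mul (2 * p)).add hwl) hpt
  have e4 := integral_add (hdl.const_mul (2 * p : ℝ)) hwl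
  rw [integral_const_mul] at e4
  have e6 := e3.trans_eq e4
  rw [← e2, ← e1] at e6
  linarith

theorem IsDensity.eventually_lt_integral_scaledDet (hp : 0 < p) {ε : ℝ} (hε : 0 < ε) :
    ∀ᶠ n in atTop, 2 * p - ε < 2 * p * ∫ θ, scaledDet M ψ n θ ∂leb := by
  obtain ⟨S, hSε⟩ := hd.exists_polynomial_entropy hp hε
  filter_upwards [eventually_ge_atTop S.natDegree] with n hn
  exact hSε.trans_le (hd.integral_entropy_le hS hdef hp hn)

omit hdef in
theorem IsDensity.integral_trace_scaledWeight (n : ℕ) :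
    ∫ θ, (scaledWeight M ψ n θ).trace.re ∂leb + ∫ θ in N, (scaledWeight M ψ n θ).trace.re ∂μ = p := by
  have hF := hd.matIntegrable_scaledWeight (ψ := ψ) n
  rw [hd.leb_eq, add_comm, integral_add_compl hd.measurableSet hF.trace_re, ← trace_re_matInt hF]
  change (weightForm μ M (ψ n) (ψ n)).trace.re = p
  rw [hS.right_norm n, Matrix.trace_one, Fintype.card_fin, Complex.natCast_re]

/-- On the circle `V = zφₙ ψₙ⁻¹` is unitary and has mean zero, so the identity may be subtracted
from `F` on the Lebesgue part. What remains is the trace of `F` over `N` and the distance of `F`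
from the identity, both controlled by how far the mean of `scaledDet` falls short of one. -/
theorem IsDensity.norm_reflection_le (hp : 0 < p) {η : ℝ} (hη : 0 < η) (n : ℕ) (k j : Fin p) :
    ‖weightForm μ M (X * φ n) (ψ n) k j‖
      ≤ p * ((2 + 1 / η) * (2 * p - 2 * p * ∫ θ, scaledDet M ψ n θ ∂leb) + η * p) := by
  have hB := isToeplitzForm_weightForm hd.integrable fun θ => (hd.posSemidef θ).1
  set g := fun θ => evalMat (ψ n) (zOf θ) with hg
  set V := fun θ => evalMat (X * φ n) (zOf θ) * (g θ)⁻¹ with hV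
  set F := scaledWeight M ψ n with hF
  have hgu : ∀ θ, IsUnit (g θ) := fun θ => hS.isUnit_right_zOf hB hdef n θ
  have hVc : Continuous V := (continuous_evalMat_zOf _).mul
    (continuous_inv_of_isUnit (continuous_evalMat_zOf _) hgu)
  have hV1 : ∀ θ k l, ‖V θ k l‖ ≤ 1 := by
    intro θ k l
    have h := norm_mul_inv_apply_le_one (hgu θ) (hS.conjTranspose_mul_self_eq hB hdef n (norm_zOf θ))
      k l
    simp only [hV, evalMat_X_mul, smul_mul_assoc, Matrix.smul_apply, norm_smul, norm_zOf, one_mul]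
    exact h
  have hV0 : matInt leb V = 0 := by
    have h := matInt_evalMat_mul_inv (P := X * φ n)
      fun z hz => (hS.isUnit_right_eval hB hdef n hz).1
    rwa [coeff_X_mul_zero, zero_mul] at h
  have hFi : MatIntegrable μ F := hd.matIntegrable_scaledWeight n
  have hFl : MatIntegrable leb F := hd.restrict hFi
  have hVF : ∀ θ, evalMat (X * φ n) (zOf θ) * M θ * (g θ)ᴴ = V θ * F θ := by
    intro θ
    have hgd := (Matrix.isUnit_iff_isUnit_det _).1 (hgu θ)
    simp only [hV, hF, scaledWeight, ← mul_assoc]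
    rw [mul_assoc _ (g θ)⁻¹, Matrix.nonsing_inv_mul _ hgd, mul_one]
  have hVi := hFi.continuous_mul hVc
  have hone : MatIntegrable leb fun _ => (1 : Mat p) := matIntegrable_of_continuous continuous_const
  have hsplit : weightForm μ M (X * φ n) (ψ n) k j
      = ∫ θ in N, (V θ * F θ) k j ∂μ + ∫ θ, (V θ * (F θ - 1)) k j ∂leb := by
    have h1 : weightForm μ M (X * φ n) (ψ n) k j = ∫ θ, (V θ * F θ) k j ∂μ := by
      rw [weightForm, matInt, Matrix.of_apply]
      exact integral_congr_ae (Eventually.of_forall fun θ => congrFun (congrFun (hVF θ) k) j)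
    have h2 : ∫ θ, (V θ * F θ) k j ∂leb = ∫ θ, (V θ * (F θ - 1)) k j ∂leb := by
      have h3 : ∀ θ, (V θ * F θ) k j = (V θ * (F θ - 1)) k j + V θ k j := fun θ => by
        rw [mul_sub, mul_one, Matrix.sub_apply, sub_add_cancel]
      simp only [h3]
      rw [integral_add ((hFl.sub hone).continuous_mul hVc k j) (matIntegrable_of_continuous hVc k j)]
      have : ∫ θ, V θ k j ∂leb = 0 := congrFun (congrFun hV0 k) j
      rw [this, add_zero]
    rw [h1, ← h2, ← integral_add_compl hd.measurableSet (hVi k j), hd.leb_eq]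
  have hmul : ∀ (θ : Torus) (A : Mat p) (c : ℝ), (∀ l, ‖A l j‖ ≤ c) → ‖(V θ * A) k j‖ ≤ p * c := by
    intro θ A c hc
    rw [Matrix.mul_apply]
    refine (norm_sum_le_of_le _ (n := fun _ => c) fun l _ => ?_).trans_eq (by simp)
    rw [norm_mul]
    calc ‖V θ k l‖ * ‖A l j‖ ≤ 1 * c :=
          mul_le_mul (hV1 θ k l) (hc l) (norm_nonneg _) zero_le_one
      _ = c := one_mul c
  have htr := hFi.trace_re
  have htl := hFl.trace_re
  have hdl := hd.integrable_scaledDet (ψ := ψ) hp n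
  have hpsd := fun θ => hd.posSemidef_scaledWeight (ψ := ψ) n θ
  have b1 : ‖∫ θ in N, (V θ * F θ) k j ∂μ‖ ≤ p * ∫ θ in N, (F θ).trace.re ∂μ := by
    rw [← integral_const_mul]
    exact norm_integral_le_of_norm_le (htr.integrableOn.const_mul _)
      (Eventually.of_forall fun θ => hmul θ _ _ fun l => norm_apply_le_trace (hpsd θ) l j)
  have hei : Integrable (fun θ => (F θ).trace.re - 2 * p * scaledDet M ψ n θ + p) leb :=
    (htl.sub (hdl.const_mul _)).add (integrable_const _)
  have b2 : ‖∫ θ, (V θ * (F θ - 1)) k j ∂leb‖ ≤ p * ((1 + 1 / η) *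
      (∫ θ, (F θ).trace.re ∂leb - 2 * p * ∫ θ, scaledDet M ψ n θ ∂leb + p) + η * p) := by
    have e1 : ∫ θ, (F θ).trace.re ∂leb - 2 * p * ∫ θ, scaledDet M ψ n θ ∂leb + p
        = ∫ θ, ((F θ).trace.re - 2 * p * scaledDet M ψ n θ + p) ∂leb := by
      have h1 := integral_add (htl.sub (hdl.const_mul (2 * p : ℝ))) (integrable_const (μ := leb) (p : ℝ))
      have h2 := integral_sub htl (hdl.const_mul (2 * p : ℝ))
      rw [integral_const_mul] at h2
      simp only [Pi.sub_apply, integral_const, probReal_univ, smul_eq_mul, one_mul] at h1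
      rw [h1, h2]
    have e2 : (1 + 1 / η) * ∫ θ, ((F θ).trace.re - 2 * p * scaledDet M ψ n θ + p) ∂leb + η * p
        = ∫ θ, ((1 + 1 / η) * ((F θ).trace.re - 2 * p * scaledDet M ψ n θ + p) + η * p) ∂leb := by
      rw [integral_add (hei.const_mul _) (integrable_const _), integral_const_mul]
      simp
    rw [e1, e2, ← integral_const_mul]
    exact norm_integral_le_of_norm_le
      (((hei.const_mul _).add (integrable_const _)).const_mul _)
      (Eventually.of_forall fun θ => hmul θ _ _ fun l => norm_sub_one_apply_le hp (hpsd θ) hη l j)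
  have htot := hd.integral_trace_scaledWeight hS n
  have hN0 : 0 ≤ ∫ θ in N, (F θ).trace.re ∂μ := integral_nonneg fun θ => trace_re_nonneg (hpsd θ)
  -- Pointwise `2pd - p ≤ p d² ≤ tr F` with `d` the scaled determinant. Since the total trace is
  -- `p`, this bounds the part over `N` by `2p - 2p ∫ d`.
  have hlow : 2 * p * ∫ θ, scaledDet M ψ n θ ∂leb - p ≤ ∫ θ, (F θ).trace.re ∂leb := by
    have h1 : ∫ θ, (2 * p * scaledDet M ψ n θ - p) ∂leb
        = 2 * p * ∫ θ, scaledDet M ψ n θ ∂leb - p := by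
      rw [integral_sub (hdl.const_mul _) (integrable_const _), integral_const_mul]
      simp
    rw [← h1]
    refine integral_mono ((hdl.const_mul _).sub (integrable_const _)) htl fun θ => ?_
    have h2 : p * scaledDet M ψ n θ ^ 2 ≤ (F θ).trace.re := card_mul_sq_rpow_le_trace hp (hpsd θ)
    change 2 * p * scaledDet M ψ n θ - p ≤ (F θ).trace.re
    have h3 : 0 ≤ p * (scaledDet M ψ n θ - 1) ^ 2 := by positivity
    linarith
  have hp0 : (0 : ℝ) ≤ p := Nat.cast_nonneg p
  have hη' : 0 ≤ 1 + 1 / η := by positivity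
  rw [hsplit]
  refine (norm_add_le _ _).trans ((add_le_add b1 b2).trans ?_)
  rw [← mul_add]
  refine mul_le_mul_of_nonneg_left ?_ hp0
  -- The Lebesgue part contributes the factor `1 + 1 / η` and the part over `N` one more unit,
  -- whence `2 + 1 / η`.
  have h4 := mul_le_mul_of_nonneg_left (a := 1 + 1 / η)
    (b := ∫ θ, (F θ).trace.re ∂leb - 2 * p * ∫ θ, scaledDet M ψ n θ ∂leb + p)
    (c := 2 * p - 2 * p * ∫ θ, scaledDet M ψ n θ ∂leb) (by linarith) hη'
  linarith

theorem IsDensity.tendsto_shift (hp : 0 < p) :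
    Tendsto (fun n => weightForm μ M (X * φ n) (ψ n)) atTop (𝓝 0) := by
  refine tendsto_pi_nhds.2 fun k => tendsto_pi_nhds.2 fun j => ?_
  refine Metric.tendsto_atTop'.2 fun ε hε => ?_
  have hp0 : (0 : ℝ) < p := by exact_mod_cast hp
  -- `η` and `δ` are chosen so that the two terms of the bound contribute `ε / 2` each.
  set η : ℝ := ε / (2 * p * p) with hη
  have hη0 : 0 < η := by positivity
  set δ : ℝ := ε / (2 * p * (2 + 1 / η)) with hδ
  have hδ0 : 0 < δ := by positivity
  obtain ⟨n₀, hn₀⟩ := eventually_atTop.1 (hd.eventually_lt_integral_scaledDet hS hdef hp hδ0)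
  refine ⟨n₀, fun n hn => ?_⟩
  change dist (weightForm μ M (X * φ n) (ψ n) k j) 0 < ε
  rw [dist_zero_right]
  refine (hd.norm_reflection_le hS hdef hp hη0 n k j).trans_lt ?_
  have h1 : (2 + 1 / η) * (2 * p - 2 * p * ∫ θ, scaledDet M ψ n θ ∂leb) < (2 + 1 / η) * δ :=
    mul_lt_mul_of_pos_left (by linarith [hn₀ n hn.le]) (by positivity)
  calc _ < p * ((2 + 1 / η) * δ + η * p) := mul_lt_mul_of_pos_left (by linarith) hp0
    _ = ε := by
      have : 2 + 1 / η ≠ 0 := by positivity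
      rw [hδ, mul_add]
      have e1 : (p : ℝ) * ((2 + 1 / η) * (ε / (2 * p * (2 + 1 / η)))) = ε / 2 := by
        field_simp
      have e2 : (p : ℝ) * (η * p) = ε / 2 := by
        rw [hη]; field_simp
      rw [e1, e2]
      ring

end

/-! ### Nondegeneracy of the form and existence of orthonormal polynomials. -/

theorem eq_zero_of_mul_mul_conjTranspose {A S : Mat p} (hA : A.PosDef) (h : S * A * Sᴴ = 0) :
    S = 0 := by
  ext i j
  by_contra hne
  have hv : star (S i) ≠ 0 := fun h0 => hne (by simpa using congrFun h0 j)
  have h1 := hA.dotProduct_mulVec_pos hv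
  have h2 : (S * A * Sᴴ) i i = star (star (S i)) ⬝ᵥ A *ᵥ star (S i) := by
    rw [star_star, Matrix.dotProduct_mulVec]
    rfl
  rw [← h2, h] at h1
  exact lt_irrefl _ h1

theorem coeff_zero_eq_zero_of_evalMat_zOf {P : (Mat p)[X]} (hP : ∀ θ, evalMat P (zOf θ) = 0) :
    P.coeff 0 = 0 := by
  have h := matInt_evalMat_mul_inv (P := P) (G := 1) fun z _ => by simp
  simp only [hP, zero_mul, coeff_one_zero, inv_one, mul_one] at h
  rw [← h]
  ext i j
  simp [matInt]

theorem coeff_eq_zero_of_evalMat_zOf (k : ℕ) :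
    ∀ P : (Mat p)[X], (∀ θ, evalMat P (zOf θ) = 0) → P.coeff k = 0 := by
  induction k with
  | zero => exact fun P hP => coeff_zero_eq_zero_of_evalMat_zOf hP
  | succ k ih =>
    intro P hP
    have h1 : X * P.divX = P := by
      have := X_mul_divX_add P
      rwa [coeff_zero_eq_zero_of_evalMat_zOf hP, C_0, add_zero] at this
    rw [← coeff_divX]
    refine ih _ fun θ => ?_
    have h2 := hP θ
    rw [← h1, evalMat_X_mul] at h2
    exact (smul_eq_zero_iff_right (zOf_ne_zero θ)).1 h2

section

variable {μ : Measure Torus} {N : Set Torus} {M : Torus → Mat p} (hd : IsDensity μ N M)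
include hd

theorem IsDensity.isToeplitzForm : IsToeplitzForm (weightForm μ M) :=
  isToeplitzForm_weightForm hd.integrable fun θ => (hd.posSemidef θ).1

/-- The trace of a positive semidefinite integrand has integral zero, so it vanishes almost
everywhere. Where `M` is positive definite this forces `P(z) = 0`; continuity extends it to the
whole circle, and mean values recover the coefficients. -/
theorem IsDensity.eq_zero_of_weightForm {P : (Mat p)[X]} (h : weightForm μ M P P = 0) : P = 0 := by
  have hi := hd.integrable.weight P P
  have hpsd := fun θ => (hd.posSemidef θ).mul_mul_conjTranspose_same (evalMat P (zOf θ))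
  have h1 := trace_re_matInt hi
  rw [← weightForm, h, Matrix.trace_zero, Complex.zero_re] at h1
  have h2 := (integral_eq_zero_iff_of_nonneg (fun θ => trace_re_nonneg (hpsd θ)) hi.trace_re).1
    h1.symm
  have h3 : ∀ᵐ θ ∂leb,
      (evalMat P (zOf θ) * M θ * (evalMat P (zOf θ))ᴴ).trace.re = 0 := by
    rw [hd.leb_eq]
    exact ae_restrict_of_ae h2
  have h4 : (fun θ => evalMat P (zOf θ)) =ᵐ[leb] fun _ => 0 := by
    filter_upwards [h3, hd.posDef] with θ h3 h4
    refine eq_zero_of_mul_mul_conjTranspose h4 ?_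
    ext i j
    have := norm_apply_le_trace (hpsd θ) i j
    rw [h3] at this
    exact norm_le_zero_iff.1 this
  have h5 := (Continuous.ae_eq_iff_eq leb (continuous_evalMat_zOf P) continuous_const).1 h4
  ext1 k
  exact coeff_eq_zero_of_evalMat_zOf k P fun θ => congrFun h5 θ

theorem IsDensity.exists_orthonormal : ∃ φ, IsOrthonormalSeq (weightForm μ M) φ :=
  hd.isToeplitzForm.exists_orthonormal
    (weightForm_posSemidef hd.integrable hd.posSemidef) fun _ => hd.eq_zero_of_weightForm

/-- The image of the weight under `θ ↦ -θ`. -/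
theorem IsDensity.neg :
    IsDensity (μ.map (MeasurableEquiv.neg Torus)) (MeasurableEquiv.neg Torus ⁻¹' N)
      fun θ => M (-θ) := by
  have hfin := hd.finite
  have hm := (MeasurableEquiv.neg Torus).measurable
  have hleb : leb = (μ.map (MeasurableEquiv.neg Torus)).restrict
      (MeasurableEquiv.neg Torus ⁻¹' N)ᶜ := by
    have h1 : MeasurableEquiv.neg Torus ⁻¹' (MeasurableEquiv.neg Torus ⁻¹' N)ᶜ = Nᶜ := by
      ext θ
      simp
    have h2 : Measure.map (MeasurableEquiv.neg Torus) leb = leb := Measure.map_neg_eq_self leb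
    rw [Measure.restrict_map hm (hm hd.measurableSet).compl, h1, ← hd.leb_eq, h2]
  have hneg : Measure.QuasiMeasurePreserving (fun θ : Torus => -θ) leb leb :=
    ⟨measurable_neg, (Measure.map_neg_eq_self leb).le.absolutelyContinuous⟩
  have hint : MatIntegrable (μ.map (MeasurableEquiv.neg Torus)) fun θ => M (-θ) := fun i j => by
    rw [integrable_map_equiv]
    refine (hd.integrable i j).congr (Eventually.of_forall fun θ => ?_)
    simp
  have hpos : ∀ᵐ θ ∂leb, (M (-θ)).PosDef :=
    Measure.QuasiMeasurePreserving.ae (p := fun θ => (M θ).PosDef) hneg hd.posDef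
  exact ⟨inferInstance, hm hd.measurableSet, hleb, hint, fun θ => hd.posSemidef _, hpos⟩

end

/-! ### Right orthonormality as left orthonormality for the reflected weight. -/

/-- The polynomial `P(z̄)^*`, whose coefficients are the conjugate transposes of those of `P`. -/
def conjCoeff (P : (Mat p)[X]) : (Mat p)[X] :=
  ∑ k ∈ Finset.range (P.natDegree + 1), C (P.coeff k)ᴴ * X ^ k

theorem coeff_conjCoeff (P : (Mat p)[X]) (k : ℕ) : (conjCoeff P).coeff k = (P.coeff k)ᴴ := by
  rw [conjCoeff, finsetSum_coeff]
  simp only [coeff_C_mul_X_pow, Finset.sum_ite_eq, Finset.mem_range]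
  split_ifs with h
  · rfl
  · rw [coeff_eq_zero_of_natDegree_lt (by omega), Matrix.conjTranspose_zero]

theorem natDegree_conjCoeff_le (P : (Mat p)[X]) : (conjCoeff P).natDegree ≤ P.natDegree :=
  natDegree_le_iff_coeff_eq_zero.2 fun m hm => by
    rw [coeff_conjCoeff, coeff_eq_zero_of_natDegree_lt hm, Matrix.conjTranspose_zero]

theorem conjCoeff_conjCoeff (P : (Mat p)[X]) : conjCoeff (conjCoeff P) = P := by
  ext1 k
  rw [coeff_conjCoeff, coeff_conjCoeff, Matrix.conjTranspose_conjTranspose]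

theorem conjCoeff_X_pow (j : ℕ) : conjCoeff (X ^ j : (Mat p)[X]) = X ^ j := by
  ext1 k
  rw [coeff_conjCoeff, coeff_X_pow]
  split_ifs <;> simp

theorem zOf_neg (θ : Torus) : zOf (-θ) = star (zOf θ) := by
  rw [zOf, AddCircle.toCircle_neg, Circle.coe_inv_eq_conj]
  rfl

theorem evalMat_conjCoeff_zOf_neg (P : (Mat p)[X]) (θ : Torus) :
    evalMat (conjCoeff P) (zOf (-θ)) = (evalMat P (zOf θ))ᴴ := by
  rw [evalMat_eq_sum_range (natDegree_conjCoeff_le P), evalMat_eq_sum_range le_rfl,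
    Matrix.conjTranspose_sum]
  refine Finset.sum_congr rfl fun k _ => ?_
  rw [coeff_conjCoeff, Matrix.conjTranspose_smul, zOf_neg, star_pow]

section

variable {ρ : MatrixMeasure p} {μ : Measure Torus} {M : Torus → Mat p} (hM : MatIntegrable μ M)
  (hρM : ∀ E, MeasurableSet E → ρ E = Matrix.of fun i j => ∫ θ in E, M θ i j ∂μ)
include hM hρM

theorem innerL_eq_weightForm : innerL ρ = weightForm μ M := by
  funext P Q
  exact matrixIntegral_eq hM hρM (continuous_evalMat_zOf P)
    (continuous_evalMat_zOf Q).matrix_conjTranspose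

theorem innerR_eq (P Q : (Mat p)[X]) :
    innerR ρ P Q = matInt μ fun θ => (evalMat P (zOf θ))ᴴ * M θ * evalMat Q (zOf θ) :=
  matrixIntegral_eq hM hρM (continuous_evalMat_zOf P).matrix_conjTranspose
    (continuous_evalMat_zOf Q)

/-- Under `θ ↦ -θ` the adjoint `P(z)^*` becomes a polynomial in `z`, so existence and orthogonality
on the right follow from the left theory. -/
theorem innerR_eq_weightForm (P Q : (Mat p)[X]) :
    innerR ρ P Q = weightForm (μ.map (MeasurableEquiv.neg Torus)) (fun θ => M (-θ))
      (conjCoeff P) (conjCoeff Q) := by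
  rw [innerR_eq hM hρM]
  ext i j
  rw [weightForm, matInt, matInt, Matrix.of_apply, Matrix.of_apply, integral_map_equiv]
  simp only [MeasurableEquiv.neg_apply, neg_neg, evalMat_conjCoeff_zOf_neg,
    Matrix.conjTranspose_conjTranspose]

theorem isLeftOrthonormal_iff {φ : ℕ → (Mat p)[X]} :
    IsLeftOrthonormal ρ φ ↔ IsOrthonormalSeq (weightForm μ M) φ := by
  rw [← innerL_eq_weightForm hM hρM]
  exact ⟨fun h => ⟨h.1, h.2⟩, fun h => ⟨h.1, h.2⟩⟩

theorem isRightOrthonormal_iff {φ : ℕ → (Mat p)[X]} :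
    IsRightOrthonormal ρ φ ↔
      IsOrthonormalSeq (weightForm (μ.map (MeasurableEquiv.neg Torus)) fun θ => M (-θ))
        fun n => conjCoeff (φ n) := by
  refine ⟨fun h => ⟨fun n => (natDegree_conjCoeff_le _).trans (h.1 n), fun m n => ?_⟩,
    fun h => ⟨fun n => ?_, fun m n => ?_⟩⟩
  · rw [← innerR_eq_weightForm hM hρM, h.2]
  · have := (natDegree_conjCoeff_le (conjCoeff (φ n))).trans (h.1 n)
    rwa [conjCoeff_conjCoeff] at this
  · rw [innerR_eq_weightForm hM hρM]
    exact h.2 m n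

end

/-- Reversal exchanges the two pairings: the left pairing of `zⁿ φₙ^R(z)^*` with `zʲ⁺¹` is the right
pairing of `φₙ^R` with `zⁿ⁻¹⁻ʲ`, which vanishes for `j < n`. -/
theorem isSzegoPair_of_orthonormal {ρ : MatrixMeasure p} {μ : Measure Torus} {N : Set Torus}
    {M : Torus → Mat p} (hd : IsDensity μ N M)
    (hρM : ∀ E, MeasurableSet E → ρ E = Matrix.of fun i j => ∫ θ in E, M θ i j ∂μ)
    {φL φR : ℕ → (Mat p)[X]} (hL : IsLeftOrthonormal ρ φL) (hR : IsRightOrthonormal ρ φR) :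
    IsSzegoPair (weightForm μ M) φL fun n => conjReverse n (φR n) := by
  have hM := hd.integrable
  have hL' := (isLeftOrthonormal_iff hM hρM).1 hL
  have hz : ∀ θ, zOf θ * star (zOf θ) = 1 := fun θ => by rw [mul_comm, star_zOf_mul]
  refine ⟨hL.1, fun n => natDegree_conjReverse_le n _, fun n => hL'.orth hd.isToeplitzForm n,
    fun n j hj => ?_, fun n => by rw [hL'.2, if_pos rfl], fun n => ?_⟩
  · have h := ((isRightOrthonormal_iff hM hρM).1 hR).orth hd.neg.isToeplitzForm n (n - 1 - j)
      (by omega)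
    rw [← conjCoeff_X_pow, ← innerR_eq_weightForm hM hρM, innerR_eq hM hρM] at h
    rw [weightForm, ← h]
    congr 1
    funext θ
    rw [evalMat_conjReverse_zOf (hR.1 n), ← pow_succ', evalMat_X_pow, evalMat_X_pow,
      Matrix.conjTranspose_smul, Matrix.conjTranspose_one, smul_mul_assoc, smul_mul_smul_comm,
      mul_smul_comm, star_pow]
    congr 1
    have : zOf θ ^ n = zOf θ ^ (n - 1 - j) * zOf θ ^ (j + 1) := by
      rw [← pow_add]
      congr 1
      omega
    rw [this, mul_assoc, ← mul_pow, hz, one_pow, mul_one]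
  · have h := hR.2 n n
    rw [if_pos rfl, innerR_eq hM hρM] at h
    refine Eq.trans (congrArg (matInt μ) (funext fun θ => ?_)) h
    rw [evalMat_conjReverse_zOf (hR.1 n), Matrix.conjTranspose_smul, smul_mul_assoc,
      smul_mul_smul_comm, star_pow, ← mul_pow, hz, one_pow, one_smul,
      Matrix.conjTranspose_conjTranspose]

end MatrixOPUC

end

theorem mainTheorem1 (p : ℕ) (ρ : MatrixOPUC.MatrixMeasure p)
    (hρ : ∀ E : Set MatrixOPUC.Torus, (ρ E).PosSemidef)
    (ρ' : MatrixOPUC.Torus → MatrixOPUC.Mat p) (ρs : MatrixOPUC.MatrixMeasure p)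
    (hdec : MatrixOPUC.IsLebesgueDecomposition ρ ρ' ρs)
    (hdet : ∀ᵐ θ ∂MatrixOPUC.leb, 0 < (ρ' θ).det) :
    (∃ φL, MatrixOPUC.IsLeftOrthonormal ρ φL) ∧
    (∃ φR, MatrixOPUC.IsRightOrthonormal ρ φR) ∧
    ∀ φL φR : ℕ → (MatrixOPUC.Mat p)[X],
      MatrixOPUC.IsLeftOrthonormal ρ φL → MatrixOPUC.IsRightOrthonormal ρ φR →
      (∀ n, IsUnit ((φL n).coeff n) ∧ IsUnit ((φR n).coeff n) ∧
        MatrixOPUC.reflectionCoeff φL φR n =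
          (φL n).coeff 0 * (((φR n).coeff n)ᴴ)⁻¹) ∧
      Tendsto (MatrixOPUC.reflectionCoeff φL φR) atTop (𝓝 0) := by
  open MatrixOPUC in
  obtain ⟨μ, N, M, hd, hρM⟩ := exists_density hρ hdec hdet
  have hM := hd.integrable
  have hB := hd.isToeplitzForm
  refine ⟨?_, ?_, fun φL φR hL hR => ?_⟩
  · obtain ⟨φ, hφ⟩ := hd.exists_orthonormal
    exact ⟨φ, (isLeftOrthonormal_iff hM hρM).2 hφ⟩
  · obtain ⟨φ, hφ⟩ := hd.neg.exists_orthonormal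
    refine ⟨fun n => conjCoeff (φ n), (isRightOrthonormal_iff hM hρM).2 ?_⟩
    simpa only [conjCoeff_conjCoeff] using hφ
  · have hS := isSzegoPair_of_orthonormal hd hρM hL hR
    have hdef : ∀ P, weightForm μ M P P = 0 → P = 0 := fun _ => hd.eq_zero_of_weightForm
    have h0 : ∀ n, (conjReverse n (φR n)).coeff 0 = ((φR n).coeff n)ᴴ := fun n => by
      rw [coeff_conjReverse n _ n.zero_le, Nat.sub_zero]
    have hn : ∀ n, (conjReverse n (φR n)).coeff n = ((φR n).coeff 0)ᴴ := fun n => by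
      rw [coeff_conjReverse n _ le_rfl, Nat.sub_self]
    have hrefl : ∀ n, reflectionCoeff φL φR n = (φL n).coeff 0 * (((φR n).coeff n)ᴴ)⁻¹ := by
      intro n
      have h := hS.conjTranspose_inv_mul hB n
      rwa [h0, hn, Matrix.conjTranspose_conjTranspose] at h
    refine ⟨fun n => ⟨hS.isUnit_left hB n, ?_, hrefl n⟩, ?_⟩
    · have h := hS.isUnit_right hB n
      rw [h0] at h
      exact (Matrix.isUnit_conjTranspose _).1 h
    · have hA : Tendsto (fun n => weightForm μ M (X * φL n) (conjReverse n (φR n))) atTop (𝓝 0) := by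
        -- The exponents `1/p` need `p > 0`; for `p = 0` all matrices coincide.
        rcases Nat.eq_zero_or_pos p with rfl | hp
        · exact tendsto_const_nhds.congr fun n => Subsingleton.elim _ _
        · exact hd.tendsto_shift hS hdef hp
      have h := hS.tendsto_reflection hB hdef hA
      refine h.congr fun n => ?_
      rw [hrefl, h0]
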